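/- Let $d\ge 2$ and $k\ge 2$ be integers, let $\Omega\subset\mathbb{R}^d$ be a bounded open set with Lipschitz boundary $\Gamma=\partial\Omega$, let $\omega\subset\Omega$ be a (measurable) set of class $C^k$, and let $\alpha>0$, $f\in L^2(\Omega)$, $u_n,u_d\in H^1(\Omega)$. For a domain $D$ with a subset $\sigma\subset D$, consider the coupled state system on $(D,\sigma)$: find $(u,p)\in H^1(D)\times H^1(D)$ such that $$\int_{D}(\nabla u\cdot\nabla v+uv)\,dx+\frac1\alpha\int_{\sigma}pv\,dx=\int_{D}fv\,dx+\int_{\partial D}u_n v\,ds\qquad\forall v\in H^1(D),$$ $$\int_{D}(\nabla p\cdot\nabla w+pw)\,dx=\int_{\partial D}(u-u_d)\,w\,ds\qquad\forall w\in H^1(D),$$ where boundary values are understood in the sense of traces. Let $\varepsilon>0$ and let $V\in C([0,\varepsilon];\mathcal{D}^k(\Omega;\mathbb{R}^d))$, where $\mathcal{D}^k(\Omega;\mathbb{R}^d)$ is the space of $C^k$ vector fields with compact support in $\Omega$, with its canonical LF topology. Put $T_t(x)=x+tV(t,x)$, $\Omega_t=T_t(\Omega)$, $\omega_t=T_t(\omega)$.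 Then the system on $(\Omega,\omega)$ has exactly one solution $(u,p)\in H^1(\Omega)\times H^1(\Omega)$. There is $\tau\in(0,\varepsilon]$ such that for every $t\in(0,\tau)$ the map $T_t$ is a bijection of $\Omega$ onto itself (so $\Omega_t=\Omega$ and $\partial\Omega_t=\Gamma$) and the system on $(\Omega_t,\omega_t)$, with the same data $f,u_n,u_d$, has exactly one solution $(u_t,p_t)\in H^1(\Omega_t)\times H^1(\Omega_t)$. Moreover, the weak material derivatives of $u$ and $p$ in the direction $V$ exist in $H^1(\Omega)$: for all sufficiently small $t>0$ the functions $u^t=u_t\circ T_t$ and $p^t=p_t\circ T_t$ belong to $H^1(\Omega)$, and there are $\dot u,\dot p\in H^1(\Omega)$ such that $$\frac{u^t-u}{t}\rightharpoonup\dot u,\qquad \frac{p^t-p}{t}\rightharpoonup\dot p\qquad\text{weakly in }H^1(\Omega)\text{ as }t\to0^+ .$$ -/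

import Mathlib

open MeasureTheory Set Filter Topology
open scoped Distributions

noncomputable section

namespace ShapeSensitivity

/-- The Euclidean space `ℝᵈ`. -/
abbrev E (d : ℕ) : Type := EuclideanSpace ℝ (Fin d)

variable {d : ℕ}

/-- Around each of its boundary points, `D` lies, in a suitable orthonormal frame with vertical
direction `e`, strictly above the graph of a function `g` (of the regularity `P`) on the hyperplane
`eᗮ`, up to points of that graph itself. For an open set `D` no point of the graph can belong to
`D`, so that `D ∩ U` is exactly the part of `U` strictly above the graph. -/
def IsLocallyEpigraph (P : ∀ e : E d, ((ℝ ∙ e)ᗮ → ℝ) → Prop) (D : Set (E d)) : Prop :=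
  ∀ x ∈ frontier D, ∃ e : E d, ‖e‖ = 1 ∧ ∃ g : (ℝ ∙ e)ᗮ → ℝ, P e g ∧
    ∃ U : Set (E d), IsOpen U ∧ x ∈ U ∧
      (∀ y ∈ U, g ((ℝ ∙ e)ᗮ.orthogonalProjectionOnto y) < inner ℝ e y → y ∈ D) ∧
      (∀ y ∈ U, y ∈ D → g ((ℝ ∙ e)ᗮ.orthogonalProjectionOnto y) ≤ inner ℝ e y)

/-- `D` has a Lipschitz boundary. -/
def HasLipschitzBoundary (D : Set (E d)) : Prop :=
  IsLocallyEpigraph (fun _ g => ∃ K, LipschitzWith K g) D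

/-- `D` is of class `C^k`. -/
def IsOfClassC (k : ℕ) (D : Set (E d)) : Prop :=
  IsLocallyEpigraph (fun _ g => ContDiff ℝ k g) D

open scoped ContDiff in
/-- `G` is the weak (distributional) gradient of `u` in `Ω`. -/
def HasWeakGradient (Ω : Set (E d)) (u : E d → ℝ) (G : E d → E d) : Prop :=
  ∀ φ : E d → ℝ, ContDiff ℝ ∞ φ → HasCompactSupport φ → tsupport φ ⊆ Ω → ∀ y : E d,
    ∫ x in Ω, u x * fderiv ℝ φ x y = - ∫ x in Ω, φ x * inner ℝ (G x) y

theorem integrable_mul_of_test {μ : Measure (E d)} [IsFiniteMeasureOnCompacts μ]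
    {u ψ : E d → ℝ} (hu : MemLp u 2 μ) (hψ : Continuous ψ) (hc : HasCompactSupport ψ) :
    Integrable (fun x => u x * ψ x) μ :=
  MemLp.integrable_mul (p := 2) (q := 2) hu (hψ.memLp_of_hasCompactSupport hc)

theorem integrable_mul_inner_of_test {μ : Measure (E d)} [IsFiniteMeasureOnCompacts μ]
    {G : E d → E d} {ψ : E d → ℝ} (hG : MemLp G 2 μ) (hψ : Continuous ψ)
    (hc : HasCompactSupport ψ) (y : E d) :
    Integrable (fun x => ψ x * inner ℝ (G x) y) μ := by
  have h := integrable_mul_of_test (hG.inner_const (𝕜 := ℝ) y) hψ hc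
  simpa only [mul_comm] using h

open scoped ContDiff in
theorem test_fderiv {φ : E d → ℝ} (hφ : ContDiff ℝ ∞ φ) (hc : HasCompactSupport φ) (y : E d) :
    Continuous (fun x => fderiv ℝ φ x y) ∧ HasCompactSupport (fun x => fderiv ℝ φ x y) := by
  refine ⟨(hφ.continuous_fderiv (by simp)).clm_apply continuous_const, hc.fderiv_apply ℝ y⟩

/-- The Sobolev space `H¹(Ω)`: the pairs of a function `u ∈ L²(Ω)` and its weak gradient
`∇u ∈ L²(Ω; ℝᵈ)`, with the inner product `∫_Ω (u v + ∇u · ∇v)` inherited from `L² × L²`. -/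
def H1 (Ω : Set (E d)) :
    Submodule ℝ (WithLp 2 (Lp ℝ 2 (volume.restrict Ω) × Lp (E d) 2 (volume.restrict Ω))) where
  carrier := {w | HasWeakGradient Ω w.fst w.snd}
  zero_mem' := by
    intro φ hφ hc _ y
    have h1 : ∫ x in Ω, (0 : Lp ℝ 2 (volume.restrict Ω)) x * fderiv ℝ φ x y = 0 := by
      apply integral_eq_zero_of_ae
      filter_upwards [Lp.coeFn_zero ℝ 2 (volume.restrict Ω)] with x hx
      simp only [hx, Pi.zero_apply, zero_mul, inner_zero_left, mul_zero]
    have h2 : ∫ x in Ω, φ x * inner ℝ ((0 : Lp (E d) 2 (volume.restrict Ω)) x) y = 0 := by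
      apply integral_eq_zero_of_ae
      filter_upwards [Lp.coeFn_zero (E d) 2 (volume.restrict Ω)] with x hx
      simp only [hx, Pi.zero_apply, zero_mul, inner_zero_left, mul_zero]
    change ∫ x in Ω, (0 : Lp ℝ 2 (volume.restrict Ω)) x * fderiv ℝ φ x y =
      - ∫ x in Ω, φ x * inner ℝ ((0 : Lp (E d) 2 (volume.restrict Ω)) x) y
    rw [h1, h2, neg_zero]
  add_mem' := by
    intro a b ha hb φ hφ hc hs y
    obtain ⟨hd1, hd2⟩ := test_fderiv hφ hc y
    have h1 : ∫ x in Ω, (a.fst + b.fst) x * fderiv ℝ φ x y =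
        (∫ x in Ω, a.fst x * fderiv ℝ φ x y) + ∫ x in Ω, b.fst x * fderiv ℝ φ x y := by
      rw [← integral_add (integrable_mul_of_test (Lp.memLp _) hd1 hd2)
        (integrable_mul_of_test (Lp.memLp _) hd1 hd2)]
      apply integral_congr_ae
      filter_upwards [Lp.coeFn_add a.fst b.fst] with x hx
      simp only [hx, Pi.add_apply, add_mul]
    have h2 : ∫ x in Ω, φ x * inner ℝ ((a.snd + b.snd) x) y =
        (∫ x in Ω, φ x * inner ℝ (a.snd x) y) + ∫ x in Ω, φ x * inner ℝ (b.snd x) y := by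
      rw [← integral_add (integrable_mul_inner_of_test (Lp.memLp _) hφ.continuous hc y)
        (integrable_mul_inner_of_test (Lp.memLp _) hφ.continuous hc y)]
      apply integral_congr_ae
      filter_upwards [Lp.coeFn_add a.snd b.snd] with x hx
      simp only [hx, Pi.add_apply, inner_add_left, mul_add]
    have e1 := ha φ hφ hc hs y
    have e2 := hb φ hφ hc hs y
    change ∫ x in Ω, (a.fst + b.fst) x * fderiv ℝ φ x y =
      - ∫ x in Ω, φ x * inner ℝ ((a.snd + b.snd) x) y
    rw [h1, h2, e1, e2]
    ring
  smul_mem' := by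
    intro c a ha φ hφ hc hs y
    have h1 : ∫ x in Ω, (c • a.fst) x * fderiv ℝ φ x y =
        c * ∫ x in Ω, a.fst x * fderiv ℝ φ x y := by
      rw [← integral_const_mul]
      apply integral_congr_ae
      filter_upwards [Lp.coeFn_smul c a.fst] with x hx
      simp [hx, mul_assoc]
    have h2 : ∫ x in Ω, φ x * inner ℝ ((c • a.snd) x) y =
        c * ∫ x in Ω, φ x * inner ℝ (a.snd x) y := by
      rw [← integral_const_mul]
      apply integral_congr_ae
      filter_upwards [Lp.coeFn_smul c a.snd] with x hx
      simp [hx, inner_smul_left, mul_left_comm]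
    have e1 := ha φ hφ hc hs y
    change ∫ x in Ω, (c • a.fst) x * fderiv ℝ φ x y =
      - ∫ x in Ω, φ x * inner ℝ ((c • a.snd) x) y
    rw [h1, h2, e1]
    ring

/-- The function `u` itself (a representative). -/
def fn {Ω : Set (E d)} (u : H1 Ω) : E d → ℝ := u.1.fst

/-- The weak gradient `∇u` (a representative). -/
def grad {Ω : Set (E d)} (u : H1 Ω) : E d → E d := u.1.snd

/-- The surface measure `ds` on `Γ = ∂Ω`: the `(d-1)`-dimensional Hausdorff measure. -/
def surfaceMeasure (Ω : Set (E d)) : Measure (E d) := μHE[d - 1].restrict (frontier Ω)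

open scoped ContDiff in
/-- `g ∈ L²(∂Ω)` is the trace of `u ∈ H¹(Ω)`: some sequence of functions smooth up to the boundary
converges to `u` in `H¹(Ω)` while its boundary values converge to `g` in `L²(∂Ω)`. -/
def IsTrace {Ω : Set (E d)} (u : H1 Ω) (g : Lp ℝ 2 (surfaceMeasure Ω)) : Prop :=
  ∃ φ : ℕ → E d → ℝ, (∀ n, ContDiff ℝ ∞ (φ n)) ∧
    Tendsto (fun n => eLpNorm (fun x => φ n x - fn u x) 2 (volume.restrict Ω)) atTop (𝓝 0) ∧
    Tendsto (fun n => eLpNorm (fun x => gradient (φ n) x - grad u x) 2 (volume.restrict Ω))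
      atTop (𝓝 0) ∧
    Tendsto (fun n => eLpNorm (fun x => φ n x - g x) 2 (surfaceMeasure Ω)) atTop (𝓝 0)

open Classical in
/-- The trace of `u ∈ H¹(Ω)` on `∂Ω`. (On a bounded open set with Lipschitz boundary every `u` has
exactly one trace, so that the value `0` of the second branch is never used.) -/
def trace {Ω : Set (E d)} (u : H1 Ω) : Lp ℝ 2 (surfaceMeasure Ω) :=
  if h : ∃ g, IsTrace u g then h.choose else 0

/-- `x = (u, p)` is a weak solution in `H¹(Ω) × H¹(Ω)` of the coupled system
`-Δu + u = f - α⁻¹ p χ_ω` and `-Δp + p = 0` in `Ω`, `∂ₙu = gn` and `∂ₙp = u - gd` on `∂Ω`. -/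
def IsStateSolution (Ω ω : Set (E d)) (α : ℝ) (f gn gd : E d → ℝ) (x : H1 Ω × H1 Ω) : Prop :=
  (∀ v : H1 Ω,
    (∫ y in Ω, (inner ℝ (grad x.1 y) (grad v y) + fn x.1 y * fn v y)) +
        1 / α * ∫ y in ω, fn x.2 y * fn v y =
      (∫ y in Ω, f y * fn v y) + ∫ y, gn y * trace v y ∂surfaceMeasure Ω) ∧
  (∀ w : H1 Ω,
    ∫ y in Ω, (inner ℝ (grad x.2 y) (grad w y) + fn x.2 y * fn w y) =
      ∫ y, (trace x.1 y - gd y) * trace w y ∂surfaceMeasure Ω)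

/-- The perturbation of identity `T_t = Id + t V(t)`. -/
def perturb {k : ℕ} {Ω : TopologicalSpace.Opens (E d)} (V : ℝ → 𝓓^{k}(Ω, E d)) (t : ℝ) :
    E d → E d :=
  fun x => x + t • V t x

/-- `du ∈ H¹(Ω)` is the weak material derivative, along the transformations `T t`, of the function
`u` on `Ω` with the associated functions `ut t` on `T t (Ω)`: for all small `t > 0` the function
`ut t ∘ T t` belongs to `H¹(Ω)`, and its difference quotients `(ut t ∘ T t - u) / t` converge to
`du` in the weak topology of `H¹(Ω)` as `t → 0⁺`. -/
def IsWeakMaterialDerivative {Ω : Set (E d)} (T : ℝ → E d → E d) (u : H1 Ω)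
    (ut : ∀ t : ℝ, H1 (T t '' Ω)) (du : H1 Ω) : Prop :=
  ∃ U : ℝ → H1 Ω,
    (∀ᶠ t in 𝓝[>] (0 : ℝ), fn (U t) =ᵐ[volume.restrict Ω] fun x => fn (ut t) (T t x)) ∧
    Tendsto (fun t : ℝ => toWeakSpace ℝ (H1 Ω) (t⁻¹ • (U t - u))) (𝓝[>] 0)
      (𝓝 (toWeakSpace ℝ (H1 Ω) du))

end ShapeSensitivity

end

open ShapeSensitivity

open MeasureTheory Set Filter Topology
open scoped Distributions

noncomputable section

namespace ShapeSensitivity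

/-! Each `perturb V t` with t > 0 small moves only points of a compact subset of Ω. It therefore
maps Ω onto itself, and u ↦ u ∘ T_t is a bijection of H¹(Ω) that preserves traces. Pulling back the
states and the test functions turns the system on (Ω, T_t(ω)) into one on the fixed space H¹(Ω) ×
H¹(Ω) with the fixed region ω. Its coefficients are J_t = |det DT_t| and A_t = J_t DT_t⁻¹ DT_t⁻*,
its load is J_t (f ∘ T_t), and its boundary terms are unchanged
(`isStateSolution_iff_of_isPullback`). With γ the trace operator, it reads M_t x_t = F_t, where M_t
is the block operator (u, p) ↦ (a u + b p, a p - γ†γ u).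

For J = 1 and A = 1 the operator a is the identity of H¹ and b ≥ 0. Eliminating unknowns reduces
bijectivity to that of 1 + γ b γ†, which is coercive, so Lax-Milgram applies without any smallness
assumption (`isUnit_coupledOp_one`). This solves the system uniquely for every measurable control
region in Ω, hence also for T_t(ω).

J_t and A_t are differentiable at t = 0 in the uniform norm, so M_t is differentiable in operator
norm. The obstacle is the load: f is only in L², so (J_t (f ∘ T_t) - f)/t need not converge in L². A
change of variables moves the difference quotient to the test function: paired with v it equals
-⟨J_t (f ∘ T_t), (v ∘ T_t - v)/t⟩ (`inner_slope_load`). For v in H¹ the quotient (v ∘ T_t - v)/t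
converges in L² to V₀ · ∇v, where V₀ = V(0), with a bound by the H¹ norm of v. The load quotients
are thus bounded in the dual of H¹ and converge weakly, and `exists_weak_deriv_of_eq` transfers this
to the states.

The analysis on Ω comes from the local epigraphs. They give a uniform interior cone, hence density
of smooth functions by shifted mollification (`exists_smooth_approx`). Integration along vertical
segments gives the trace inequality (`exists_trace_le`). Together these produce a continuous trace
operator `traceL` that agrees with `trace`. -/

variable {d : ℕ}

/-! ### Hilbert space part: coupled block operators and weak differentiability of solutions. -/

section Abstract

variable {H K X Y : Type*} [NormedAddCommGroup H] [InnerProductSpace ℝ H] [CompleteSpace H]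
  [NormedAddCommGroup K] [InnerProductSpace ℝ K] [CompleteSpace K]
  [NormedAddCommGroup X] [NormedSpace ℝ X] [NormedAddCommGroup Y] [NormedSpace ℝ Y]

/-- The block operator `(u, p) ↦ (a u + b p, a p - c u)`. -/
def coupledOp (a b c : X →L[ℝ] X) : X × X →L[ℝ] X × X :=
  ((a ∘L .fst ℝ X X) + (b ∘L .snd ℝ X X)).prod ((a ∘L .snd ℝ X X) - (c ∘L .fst ℝ X X))

@[simp]
theorem coupledOp_apply (a b c : X →L[ℝ] X) (x : X × X) :
    coupledOp a b c x = (a x.1 + b x.2, a x.2 - c x.1) := rfl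

/-- On a Hilbert space, `1 + g b g†` is bijective for `b ≥ 0`. -/
theorem exists_add_conj_eq (b : H →L[ℝ] H) (hb : ∀ x, 0 ≤ inner ℝ (b x) x) (g : H →L[ℝ] K) (y : K) :
    ∃ z, z + g (b (g.adjoint z)) = y := by
  let N : K →L[ℝ] K := 1 + g ∘L b ∘L g.adjoint
  let B : K →L[ℝ] K →L[ℝ] ℝ := (innerSL ℝ) ∘L N
  -- The constant is 1: ⟨g b g† u, u⟩ = ⟨b g† u, g† u⟩ is nonnegative, so the conjugated term only
  -- helps. Lax-Milgram then gives surjectivity.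
  have hB : IsCoercive B := by
    refine ⟨1, one_pos, fun u => ?_⟩
    have h : B u u = ‖u‖ * ‖u‖ + inner ℝ (b (g.adjoint u)) (g.adjoint u) := by
      have h0 : B u u = inner ℝ (u + g (b (g.adjoint u))) u := rfl
      rw [h0, inner_add_left, real_inner_self_eq_norm_mul_norm,
        ContinuousLinearMap.adjoint_inner_right]
    rw [h]
    linarith [hb (g.adjoint u)]
  let e := hB.continuousLinearEquivOfBilin
  refine ⟨e.symm y, ?_⟩
  have h : ∀ u, e u = N u := by
    intro u
    refine ext_inner_right ℝ fun w => ?_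
    rw [hB.continuousLinearEquivOfBilin_apply]
    rfl
  have := h (e.symm y)
  rw [e.apply_symm_apply] at this
  exact this.symm

/-- The opposite signs of the two coupling terms make the system solvable whatever their size.
Eliminating p, then u, leaves z + g b g† z = g (F - b G) for the single unknown z = g u. -/
theorem isUnit_coupledOp_one (b : H →L[ℝ] H) (hb : ∀ x, 0 ≤ inner ℝ (b x) x) (g : H →L[ℝ] K) :
    IsUnit (coupledOp 1 b (g.adjoint ∘L g)) := by
  rw [ContinuousLinearMap.isUnit_iff_bijective]
  constructor
  · rw [injective_iff_map_eq_zero]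
    rintro ⟨u, p⟩ h
    simp only [coupledOp_apply, one_apply_eq_self, ContinuousLinearMap.comp_apply,
      Prod.mk_eq_zero] at h
    obtain ⟨h1, h2⟩ := h
    have hp : p = g.adjoint (g u) := sub_eq_zero.mp h2
    -- Pair u + b p = 0 with p = g† g u; both resulting terms are nonnegative.
    have h3 : ‖g u‖ * ‖g u‖ + inner ℝ (b p) p = 0 := by
      rw [← real_inner_self_eq_norm_mul_norm, ← ContinuousLinearMap.adjoint_inner_right, ← hp,
        ← inner_add_left, h1, inner_zero_left]
    have h4 : g u = 0 := by
      have := hb p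
      have h5 : ‖g u‖ * ‖g u‖ ≤ 0 := by linarith
      exact norm_eq_zero.mp (by nlinarith [norm_nonneg (g u)])
    have h5 : p = 0 := by rw [hp, h4, map_zero]
    rw [h5, map_zero, add_zero] at h1
    rw [h1, h5, Prod.mk_zero_zero]
  · rintro ⟨F, G⟩
    obtain ⟨z, hz⟩ := exists_add_conj_eq b hb g (g (F - b G))
    refine ⟨(F - b (G + g.adjoint z), G + g.adjoint z), ?_⟩
    have h : g (F - b (G + g.adjoint z)) = z := by
      rw [map_sub] at hz
      rw [map_add, map_sub, map_add, ← sub_sub, ← hz]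
      abel
    simp only [coupledOp_apply, one_apply_eq_self, ContinuousLinearMap.comp_apply, h]
    congr 1 <;> abel

/-- A uniform operator bound controls the error of replacing x by a nearby e z, so strong
convergence need only be checked on a dense range. In the applications these are smooth functions in
H¹ or bounded continuous functions in L². -/
theorem tendsto_apply_of_denseRange {ι Z : Type*} {l : Filter ι} {L : ι → X →L[ℝ] Y}
    {L₀ : X →L[ℝ] Y} {C : ℝ} (hC : ∀ᶠ t in l, ‖L t‖ ≤ C) {e : Z → X} (he : DenseRange e)
    (h : ∀ z, Tendsto (fun t => L t (e z)) l (𝓝 (L₀ (e z)))) (x : X) :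
    Tendsto (fun t => L t x) l (𝓝 (L₀ x)) := by
  rw [Metric.tendsto_nhds]
  intro ε hε
  set D := |C| + ‖L₀‖ + 1 with hD
  have hD0 : 0 < D := by positivity
  obtain ⟨z, hz⟩ := he.exists_dist_lt x (show 0 < ε / 2 / D by positivity)
  filter_upwards [hC, (Metric.tendsto_nhds.mp (h z)) (ε / 2) (by positivity)] with t h1 h2
  have e1 : L t x - L₀ x = (L t (x - e z) - L₀ (x - e z)) + (L t (e z) - L₀ (e z)) := by
    simp only [map_sub]; abel
  rw [dist_eq_norm] at hz h2 ⊢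
  have e2 : ‖L t (x - e z) - L₀ (x - e z)‖ ≤ D * ‖x - e z‖ := by
    refine (norm_sub_le _ _).trans ?_
    have i1 := (L t).le_of_opNorm_le (h1.trans (le_abs_self C)) (x - e z)
    have i2 := L₀.le_opNorm (x - e z)
    have := norm_nonneg (x - e z)
    rw [hD]; nlinarith
  have e3 : D * ‖x - e z‖ < ε / 2 := by
    rw [lt_div_iff₀ hD0] at hz; linarith
  rw [e1]
  linarith [norm_add_le (L t (x - e z) - L₀ (x - e z)) (L t (e z) - L₀ (e z))]

/-- Weak differentiability of the solutions of `M t (x t) = F t` at `t = 0`, for `M` differentiable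
in norm and `F` weakly differentiable. -/
theorem exists_weak_deriv_of_eq {M : ℝ → X →L[ℝ] X} {M₀ M' : X →L[ℝ] X} (hM₀ : IsUnit M₀)
    (hM : Tendsto (fun t : ℝ => t⁻¹ • (M t - M₀)) (𝓝[>] 0) (𝓝 M'))
    (hM1 : Tendsto M (𝓝[>] 0) (𝓝 M₀))
    {F : ℝ → X} {F₀ F' : X} {C : ℝ} (hC : ∀ᶠ t : ℝ in 𝓝[>] 0, ‖t⁻¹ • (F t - F₀)‖ ≤ C)
    (hF : ∀ ℓ : StrongDual ℝ X, Tendsto (fun t : ℝ => ℓ (t⁻¹ • (F t - F₀))) (𝓝[>] 0) (𝓝 (ℓ F')))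
    {x : ℝ → X} {x₀ : X} (hx : ∀ᶠ t in 𝓝[>] 0, M t (x t) = F t) (hx₀ : M₀ x₀ = F₀) :
    ∃ x' : X, ∀ ℓ : StrongDual ℝ X,
      Tendsto (fun t : ℝ => ℓ (t⁻¹ • (x t - x₀))) (𝓝[>] 0) (𝓝 (ℓ x')) := by
  obtain ⟨U, hU⟩ := hM₀
  set N : X →L[ℝ] X := ↑U⁻¹ with hN
  have hNM : ∀ y, N (M₀ y) = y := fun y => by
    rw [← mul_apply_eq_comp, hN, ← hU, Units.inv_mul, one_apply_eq_self]
  set D : ℝ → X := fun t => t⁻¹ • (x t - x₀) with hD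
  set R : ℝ → X := fun t => t⁻¹ • (F t - F₀) - (t⁻¹ • (M t - M₀)) x₀ with hR
  have hMD : ∀ᶠ t in 𝓝[>] 0, M t (D t) = R t := by
    filter_upwards [hx] with t ht
    simp only [hD, hR, map_smul, map_sub, ht, smul_apply,
      sub_apply, hx₀, ← smul_sub]
    congr 1
    abel
  -- N inverts only M₀. Solving for D t perturbatively avoids inverting M t, since the solutions x t
  -- are given.
  have hDeq : ∀ᶠ t in 𝓝[>] 0, D t = N (R t) - (N ∘L (M t - M₀)) (D t) := by
    filter_upwards [hMD] with t ht
    rw [← ht, ContinuousLinearMap.comp_apply, ← map_sub, sub_apply,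
      sub_sub_cancel, hNM]
  have hsmall : Tendsto (fun t => N ∘L (M t - M₀)) (𝓝[>] 0) (𝓝 0) := by
    have h1 : Tendsto (fun t => M t - M₀) (𝓝[>] 0) (𝓝 0) := by
      simpa using hM1.sub_const M₀
    have h2 := h1.const_mul N
    rw [mul_zero] at h2
    exact h2
  have hRb : ∀ᶠ t in 𝓝[>] 0, ‖R t‖ ≤ C + (‖M'‖ + 1) * ‖x₀‖ := by
    filter_upwards [hC, (hM.norm).eventually (gt_mem_nhds (lt_add_one ‖M'‖))] with t h1 h2
    refine (norm_sub_le _ _).trans (add_le_add h1 ?_)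
    exact ContinuousLinearMap.le_of_opNorm_le _ h2.le _
  -- Once the perturbation has norm below 1/2, half of ‖D t‖ is absorbed on the left; hence the
  -- factor 2. Boundedness of D t then makes the perturbation term tend to zero in norm, so only N
  -- (R t) contributes to the weak limit.
  have hDb : ∀ᶠ t in 𝓝[>] 0, ‖D t‖ ≤ 2 * (‖N‖ * (C + (‖M'‖ + 1) * ‖x₀‖)) := by
    have h1 : ∀ᶠ t in 𝓝[>] (0 : ℝ), ‖N ∘L (M t - M₀)‖ < 1 / 2 := by
      have := hsmall.norm
      rw [norm_zero] at this
      exact this.eventually (gt_mem_nhds (by norm_num))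
    filter_upwards [hRb, hDeq, h1] with t h1 h2 h3
    have h4 : ‖D t‖ ≤ ‖N (R t)‖ + ‖(N ∘L (M t - M₀)) (D t)‖ := by
      conv_lhs => rw [h2]
      exact norm_sub_le _ _
    have h5 := N.le_opNorm (R t)
    have h6 := (N ∘L (M t - M₀)).le_opNorm (D t)
    have h7 := mul_le_mul_of_nonneg_left h1 (norm_nonneg N)
    have h8 := mul_le_mul_of_nonneg_right h3.le (norm_nonneg (D t))
    linarith
  refine ⟨N (F' - M' x₀), fun ℓ => ?_⟩
  have t1 : Tendsto (fun t => (ℓ ∘L N) (R t)) (𝓝[>] 0) (𝓝 ((ℓ ∘L N) (F' - M' x₀))) := by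
    simp only [hR, map_sub]
    refine (hF (ℓ ∘L N)).sub ?_
    exact ((ℓ ∘L N).continuous.tendsto _).comp
      (((ContinuousLinearMap.apply ℝ X x₀).continuous.tendsto _).comp hM)
  have t2 : Tendsto (fun t => (N ∘L (M t - M₀)) (D t)) (𝓝[>] 0) (𝓝 0) := by
    refine squeeze_zero_norm' (a := fun t => ‖N ∘L (M t - M₀)‖ *
      (2 * (‖N‖ * (C + (‖M'‖ + 1) * ‖x₀‖)))) ?_ ?_
    · filter_upwards [hDb] with t ht
      exact (ContinuousLinearMap.le_opNorm _ _).trans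
        (mul_le_mul_of_nonneg_left ht (norm_nonneg _))
    · simpa using hsmall.norm.mul_const (2 * (‖N‖ * (C + (‖M'‖ + 1) * ‖x₀‖)))
  have t3 := t1.sub ((ℓ.continuous.tendsto _).comp t2)
  rw [map_zero, sub_zero] at t3
  refine t3.congr' ?_
  filter_upwards [hDeq] with t ht
  have h := congrArg ℓ ht
  rw [map_sub] at h
  exact h.symm

end Abstract

/-! ### The Hilbert space H¹(Ω). -/

section Sobolev

variable {Ω : Set (E d)}

theorem HasWeakGradient.congr {u u' : E d → ℝ} {G G' : E d → E d} (h : HasWeakGradient Ω u G)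
    (hu : u' =ᵐ[volume.restrict Ω] u) (hG : G' =ᵐ[volume.restrict Ω] G) :
    HasWeakGradient Ω u' G' := by
  intro φ hφ hc hs y
  have h1 : ∫ x in Ω, u' x * fderiv ℝ φ x y = ∫ x in Ω, u x * fderiv ℝ φ x y :=
    integral_congr_ae (hu.mono fun x hx => by simp only [hx])
  have h2 : ∫ x in Ω, φ x * inner ℝ (G' x) y = ∫ x in Ω, φ x * inner ℝ (G x) y :=
    integral_congr_ae (hG.mono fun x hx => by simp only [hx])
  rw [h1, h2]
  exact h φ hφ hc hs y

/-- The test function is supported in Ω, so both integrals extend to the whole space and integration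
by parts has no boundary term. No regularity of Ω enters. -/
theorem hasWeakGradient_of_contDiff {φ : E d → ℝ} (hφ : ContDiff ℝ 1 φ) :
    HasWeakGradient Ω φ (gradient φ) := by
  intro η hη hc hs y
  have hφ' : Continuous fun x => fderiv ℝ φ x y :=
    (hφ.continuous_fderiv (by simp)).clm_apply continuous_const
  obtain ⟨h1, h2⟩ := test_fderiv hη hc y
  have e1 : ∫ x in Ω, φ x * fderiv ℝ η x y = ∫ x, φ x * fderiv ℝ η x y := by
    refine setIntegral_eq_integral_of_forall_compl_eq_zero fun x hx => ?_
    rw [image_eq_zero_of_notMem_tsupport (f := fun x => fderiv ℝ η x y), mul_zero]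
    exact fun h => hx (hs (tsupport_fderiv_apply_subset ℝ y h))
  have e2 : ∫ x in Ω, η x * inner ℝ (gradient φ x) y = ∫ x, fderiv ℝ φ x y * η x := by
    simp only [inner_gradient_left, mul_comm (η _)]
    refine setIntegral_eq_integral_of_forall_compl_eq_zero fun x hx => ?_
    rw [image_eq_zero_of_notMem_tsupport (fun h => hx (hs h)), mul_zero]
  rw [e1, e2]
  refine integral_mul_fderiv_eq_neg_fderiv_mul_of_integrable ?_ ?_ ?_ ?_ ?_
  · exact (hφ'.mul hη.continuous).integrable_of_hasCompactSupport hc.mul_left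
  · exact (hφ.continuous.mul h1).integrable_of_hasCompactSupport h2.mul_left
  · exact (hφ.continuous.mul hη.continuous).integrable_of_hasCompactSupport hc.mul_left
  · exact fun x _ => hφ.differentiable (by simp) x
  · exact fun x _ => hη.differentiable (by simp) x

theorem memLp_of_continuous {F : Type*} [NormedAddCommGroup F] (hΩ : Bornology.IsBounded Ω)
    {φ : E d → F} (hφ : Continuous φ) (p : ENNReal) : MemLp φ p (volume.restrict Ω) := by
  have hcomp : IsCompact (closure Ω) := hΩ.isCompact_closure
  have : IsFiniteMeasure (volume.restrict (closure Ω)) :=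
    ⟨by rw [Measure.restrict_apply_univ]; exact hcomp.measure_lt_top⟩
  obtain ⟨C, hC⟩ := hcomp.exists_bound_of_continuousOn hφ.continuousOn
  have h : MemLp φ p (volume.restrict (closure Ω)) := by
    refine MemLp.of_bound hφ.aestronglyMeasurable C ?_
    exact (ae_restrict_mem isClosed_closure.measurableSet).mono fun x hx => hC x hx
  exact h.mono_measure (Measure.restrict_mono subset_closure le_rfl)

theorem continuous_gradient {φ : E d → ℝ} (hφ : ContDiff ℝ 1 φ) : Continuous (gradient φ) :=
  (LinearIsometryEquiv.continuous _).comp (hφ.continuous_fderiv (by simp))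

/-- The element of `H¹(Ω)` with given function and weak gradient. -/
def H1.mk {u : E d → ℝ} {G : E d → E d} (hu : MemLp u 2 (volume.restrict Ω))
    (hG : MemLp G 2 (volume.restrict Ω)) (h : HasWeakGradient Ω u G) : H1 Ω :=
  ⟨WithLp.toLp 2 (hu.toLp u, hG.toLp G), h.congr hu.coeFn_toLp hG.coeFn_toLp⟩

/-- The embedding of `H¹(Ω)` into `L²(Ω)`. -/
def fnL (Ω : Set (E d)) : H1 Ω →L[ℝ] Lp ℝ 2 (volume.restrict Ω) :=
  WithLp.fstL 2 ℝ _ _ ∘L (H1 Ω).subtypeL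

/-- The weak gradient as an operator from `H¹(Ω)` to `L²(Ω; ℝᵈ)`. -/
def gradL (Ω : Set (E d)) : H1 Ω →L[ℝ] Lp (E d) 2 (volume.restrict Ω) :=
  WithLp.sndL 2 ℝ _ _ ∘L (H1 Ω).subtypeL

theorem coe_fnL (u : H1 Ω) : (fnL Ω u : E d → ℝ) = fn u := rfl

theorem coe_gradL (u : H1 Ω) : (gradL Ω u : E d → E d) = grad u := rfl

theorem H1.inner_eq (u v : H1 Ω) :
    inner ℝ u v = inner ℝ (fnL Ω u) (fnL Ω v) + inner ℝ (gradL Ω u) (gradL Ω v) := rfl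

theorem H1.norm_sq_eq (u : H1 Ω) : ‖u‖ ^ 2 = ‖fnL Ω u‖ ^ 2 + ‖gradL Ω u‖ ^ 2 := by
  have h1 := real_inner_self_eq_norm_sq u
  have h2 := real_inner_self_eq_norm_sq (fnL Ω u)
  have h3 := real_inner_self_eq_norm_sq (gradL Ω u)
  rw [← h1, ← h2, ← h3]
  exact H1.inner_eq u u

theorem H1.ext {u v : H1 Ω} (h1 : fnL Ω u = fnL Ω v) (h2 : gradL Ω u = gradL Ω v) : u = v :=
  Subtype.ext (WithLp.ofLp_injective 2 (Prod.ext h1 h2))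

theorem norm_gradL_le (u : H1 Ω) : ‖gradL Ω u‖ ≤ ‖u‖ :=
  le_of_sq_le_sq (by nlinarith [H1.norm_sq_eq u, sq_nonneg ‖fnL Ω u‖]) (norm_nonneg _)

theorem tendsto_H1 {ι : Type*} {l : Filter ι} {u : ι → H1 Ω} {v : H1 Ω}
    (h1 : Tendsto (fun n => fnL Ω (u n)) l (𝓝 (fnL Ω v)))
    (h2 : Tendsto (fun n => gradL Ω (u n)) l (𝓝 (gradL Ω v))) : Tendsto u l (𝓝 v) := by
  rw [tendsto_iff_norm_sub_tendsto_zero] at h1 h2 ⊢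
  have h : ∀ n, ‖u n - v‖ = Real.sqrt (‖fnL Ω (u n) - fnL Ω v‖ ^ 2 +
      ‖gradL Ω (u n) - gradL Ω v‖ ^ 2) := fun n => by
    have e1 : fnL Ω (u n) - fnL Ω v = fnL Ω (u n - v) := ((fnL Ω).map_sub _ _).symm
    have e2 : gradL Ω (u n) - gradL Ω v = gradL Ω (u n - v) := ((gradL Ω).map_sub _ _).symm
    have e3 := H1.norm_sq_eq (u n - v)
    rw [e1, e2]
    exact (Real.sqrt_sq (norm_nonneg (u n - v))).symm.trans (congrArg Real.sqrt e3)
  simp only [h]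
  have := ((h1.pow 2).add (h2.pow 2)).sqrt
  simpa using this

/-- For a fixed test function, the weak gradient identity equates two continuous linear functionals
of (u, G) in L² × L², namely the pairings with ∂φ and with φ y. It therefore survives limits, and H¹
is complete. -/
theorem isClosed_H1 (Ω : Set (E d)) : IsClosed (H1 Ω : Set
    (WithLp 2 (Lp ℝ 2 (volume.restrict Ω) × Lp (E d) 2 (volume.restrict Ω)))) := by
  rw [← isSeqClosed_iff_isClosed]
  intro w v hw hv φ hφ hc hs y
  obtain ⟨hd1, hd2⟩ := test_fderiv hφ hc y
  have m1 : MemLp (fun x => fderiv ℝ φ x y) 2 (volume.restrict Ω) :=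
    hd1.memLp_of_hasCompactSupport hd2
  have m2 : MemLp (fun x => φ x • y) 2 (volume.restrict Ω) :=
    (hφ.continuous.smul continuous_const).memLp_of_hasCompactSupport hc.smul_right
  have e1 : ∀ u : Lp ℝ 2 (volume.restrict Ω),
      ∫ x in Ω, u x * fderiv ℝ φ x y = inner ℝ (m1.toLp _) u := fun u => by
    rw [L2.inner_def]
    refine integral_congr_ae (m1.coeFn_toLp.mono fun x hx => ?_)
    simp [hx]
  have e2 : ∀ G : Lp (E d) 2 (volume.restrict Ω),
      ∫ x in Ω, φ x * inner ℝ (G x) y = inner ℝ (m2.toLp _) G := fun G => by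
    rw [L2.inner_def]
    refine integral_congr_ae (m2.coeFn_toLp.mono fun x hx => ?_)
    simp [hx, inner_smul_left, real_inner_comm]
  rw [e1, e2]
  have t1 := ((WithLp.fstL 2 ℝ _ _).continuous.tendsto v).comp hv
  have t2 := ((WithLp.sndL 2 ℝ _ _).continuous.tendsto v).comp hv
  have t3 := (tendsto_const_nhds (x := m1.toLp _)).inner (𝕜 := ℝ) t1
  have t4 := ((tendsto_const_nhds (x := m2.toLp _)).inner (𝕜 := ℝ) t2).neg
  refine tendsto_nhds_unique t3 (t4.congr fun n => ?_)
  have := hw n φ hφ hc hs y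
  rw [e1, e2] at this
  exact this.symm

instance : CompleteSpace (H1 Ω) := (isClosed_H1 Ω).completeSpace_coe

/-- The restriction to a bounded set of a `C¹` function, as an element of `H¹`. -/
def H1.ofC1 (hΩ : Bornology.IsBounded Ω) {φ : E d → ℝ} (hφ : ContDiff ℝ 1 φ) : H1 Ω :=
  H1.mk (memLp_of_continuous hΩ hφ.continuous 2)
    (memLp_of_continuous hΩ (continuous_gradient hφ) 2) (hasWeakGradient_of_contDiff hφ)

end Sobolev

/-! ### Mollification in L². -/

section Mollify

open scoped ENNReal ContDiff

theorem eLpNorm_two_sq {α F : Type*} [MeasurableSpace α] [NormedAddCommGroup F] (f : α → F)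
    (μ : Measure α) : eLpNorm f 2 μ ^ 2 = ∫⁻ x, ‖f x‖ₑ ^ 2 ∂μ := by
  have h := eLpNorm_nnreal_pow_eq_lintegral (f := f) (μ := μ) (p := 2) (by norm_num)
  norm_num at h
  exact_mod_cast h

/-- Cauchy-Schwarz against the constant 1, whose norm is 1 for a probability measure. -/
theorem sq_lintegral_le {α : Type*} [MeasurableSpace α] {ν : Measure α} [IsProbabilityMeasure ν]
    {g : α → ℝ≥0∞} (hg : AEMeasurable g ν) : (∫⁻ x, g x ∂ν) ^ 2 ≤ ∫⁻ x, g x ^ 2 ∂ν := by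
  have h := ENNReal.lintegral_mul_le_Lp_mul_Lq ν Real.HolderConjugate.two_two hg
    (aemeasurable_const (b := 1))
  simp only [Pi.mul_apply, mul_one, ENNReal.one_rpow, lintegral_one, measure_univ] at h
  have h2 := pow_le_pow_left' h 2
  rw [← ENNReal.rpow_natCast (_ ^ (1 / (2 : ℝ))), ← ENNReal.rpow_mul] at h2
  norm_num at h2
  exact h2

/-- Continuity of translations in `L²`. -/
theorem tendsto_eLpNorm_translate {F : Type*} [NormedAddCommGroup F] {v : E d → F}
    (hv : MemLp v 2 volume) :
    Tendsto (fun z => eLpNorm (fun x => v (x - z) - v x) 2 volume) (𝓝 0) (𝓝 0) := by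
  let g : E d → C(E d, E d) := fun z => ⟨fun x => x - z, by fun_prop⟩
  have hg : Continuous g :=
    ContinuousMap.continuous_of_continuous_uncurry _ (by
      change Continuous fun p : E d × E d => p.2 - p.1
      fun_prop)
  have hm : ∀ z, MeasurePreserving (g z) volume volume := fun z =>
    measurePreserving_sub_right volume z
  have h := Filter.Tendsto.compMeasurePreservingLp (f := fun _ : E d => hv.toLp v)
    tendsto_const_nhds (hg.tendsto 0) hm (hm 0) (by norm_num)
  simp only [Lp.toLp_compMeasurePreserving] at h
  rw [Lp.tendsto_Lp_iff_tendsto_eLpNorm'] at h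
  refine h.congr fun z => eLpNorm_congr_ae ?_
  filter_upwards [(hv.comp_measurePreserving (hm z)).coeFn_toLp,
    (hv.comp_measurePreserving (hm 0)).coeFn_toLp] with x h1 h2
  rw [Pi.sub_apply, h1, h2]
  simp [g]

/-- `∫ k(x - t) v(t) dt`. -/
def mollify {F : Type*} [NormedAddCommGroup F] [NormedSpace ℝ F] (k : E d → ℝ) (v : E d → F)
    (x : E d) : F :=
  ∫ t, k (x - t) • v t

theorem integrable_mollify {F : Type*} [NormedAddCommGroup F] [NormedSpace ℝ F] {k : E d → ℝ}
    {v : E d → F} (hk : Continuous k) (hkc : HasCompactSupport k) (hv : LocallyIntegrable v)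
    (x : E d) : Integrable fun t => k (x - t) • v t := by
  refine hv.integrable_smul_left_of_hasCompactSupport (by fun_prop) ?_
  exact hkc.comp_homeomorph (Homeomorph.subLeft x)

/-- A mollification is an average of translates with the probability density k. By Jensen and
Tonelli its L² error is at most the largest translation error over the points where k is nonzero. -/
theorem eLpNorm_mollify_sub_le {F : Type*} [NormedAddCommGroup F] [NormedSpace ℝ F]
    [CompleteSpace F] {k : E d → ℝ}
    {v : E d → F} (hk : Continuous k) (hkc : HasCompactSupport k) (hk0 : ∀ x, 0 ≤ k x)
    (hk1 : ∫ x, k x = 1) (hv : StronglyMeasurable v) (hvi : LocallyIntegrable v) {δ : ℝ≥0∞}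
    (hδ : ∀ z, k z ≠ 0 → eLpNorm (fun x => v (x - z) - v x) 2 volume ≤ δ) :
    eLpNorm (fun x => mollify k v x - v x) 2 volume ≤ δ := by
  have hki : Integrable k := hk.integrable_of_hasCompactSupport hkc
  let ν : Measure (E d) := volume.withDensity fun z => ENNReal.ofReal (k z)
  have hν1 : ν univ = 1 := by
    rw [withDensity_apply _ MeasurableSet.univ, Measure.restrict_univ,
      ← ofReal_integral_eq_lintegral_ofReal hki (Eventually.of_forall hk0), hk1, ENNReal.ofReal_one]
  have : IsProbabilityMeasure ν := ⟨hν1⟩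
  have hmk : Measurable fun z => ENNReal.ofReal (k z) := hk.measurable.ennreal_ofReal
  have hsm : StronglyMeasurable fun p : E d × E d => v (p.1 - p.2) - v p.1 :=
    (hv.comp_measurable (measurable_fst.sub measurable_snd)).sub (hv.comp_measurable measurable_fst)
  have hmz : ∀ x, Measurable fun z => ‖v (x - z) - v x‖ₑ := fun x =>
    (hsm.comp_measurable measurable_prodMk_left).enorm
  have key : ∀ x, ‖mollify k v x - v x‖ₑ ≤ ∫⁻ z, ‖v (x - z) - v x‖ₑ ∂ν := by
    intro x
    have e1 : mollify k v x = ∫ z, k z • v (x - z) := by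
      rw [mollify, ← integral_sub_left_eq_self _ volume x]
      simp only [sub_sub_cancel]
    have i1 : Integrable fun z => k z • v (x - z) := by
      have := (integrable_mollify hk hkc hvi x).comp_sub_left x
      simpa only [sub_sub_cancel] using this
    have e2 : v x = ∫ z, k z • v x := by rw [integral_smul_const, hk1, one_smul]
    have e3 : mollify k v x - v x = ∫ z, k z • (v (x - z) - v x) := by
      conv_lhs => rw [e1, e2]
      rw [← integral_sub i1 (hki.smul_const _)]
      simp only [smul_sub]
    rw [e3]
    refine (enorm_integral_le_lintegral_enorm _).trans_eq ?_
    rw [lintegral_withDensity_eq_lintegral_mul _ hmk (hmz x)]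
    refine lintegral_congr fun z => ?_
    rw [enorm_smul, Pi.mul_apply, Real.enorm_of_nonneg (hk0 z)]
  have hsq : eLpNorm (fun x => mollify k v x - v x) 2 volume ^ 2 ≤ δ ^ 2 := by
    rw [eLpNorm_two_sq]
    calc ∫⁻ x, ‖mollify k v x - v x‖ₑ ^ 2
        ≤ ∫⁻ x, ∫⁻ z, ‖v (x - z) - v x‖ₑ ^ 2 ∂ν := by
          refine lintegral_mono fun x => ?_
          exact (pow_le_pow_left' (key x) 2).trans (sq_lintegral_le (hmz x).aemeasurable)
      _ = ∫⁻ z, ∫⁻ x, ‖v (x - z) - v x‖ₑ ^ 2 ∂volume ∂ν := by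
          rw [lintegral_lintegral_swap]
          exact (hsm.enorm.pow_const 2).aemeasurable
      _ ≤ ∫⁻ z, δ ^ 2 ∂ν := by
          refine lintegral_mono_ae ?_
          have h0 : ∀ᵐ z ∂ν, k z ≠ 0 := by
            rw [ae_withDensity_iff hmk]
            exact Eventually.of_forall fun z hz h => hz (by rw [h, ENNReal.ofReal_zero])
          refine h0.mono fun z hz => ?_
          rw [← eLpNorm_two_sq]
          exact pow_le_pow_left' (hδ z hz) 2
      _ = δ ^ 2 := by rw [lintegral_const, hν1, mul_one]
  exact (ENNReal.pow_le_pow_left_iff two_ne_zero).mp hsq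

theorem mollify_eq_convolution {F : Type*} [NormedAddCommGroup F] [NormedSpace ℝ F] (k : E d → ℝ)
    (v : E d → F) :
    mollify k v = convolution v k (ContinuousLinearMap.lsmul ℝ ℝ).flip volume := rfl

theorem contDiff_mollify {F : Type*} [NormedAddCommGroup F] [NormedSpace ℝ F] {k : E d → ℝ}
    {v : E d → F} (hk : ContDiff ℝ ∞ k) (hkc : HasCompactSupport k) (hvi : LocallyIntegrable v) :
    ContDiff ℝ ∞ (mollify k v) := by
  rw [mollify_eq_convolution]
  exact hkc.contDiff_convolution_right _ hvi hk

theorem fderiv_mollify {k : E d → ℝ} {v : E d → ℝ} (hk : ContDiff ℝ ∞ k)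
    (hkc : HasCompactSupport k) (hvi : LocallyIntegrable v) (x y : E d) :
    fderiv ℝ (mollify k v) x y = ∫ t, v t * fderiv ℝ k (x - t) y := by
  have hk1 : ContDiff ℝ 1 k := hk.of_le (by exact_mod_cast le_top)
  rw [mollify_eq_convolution, (hkc.hasFDerivAt_convolution_right _ hvi hk1 x).fderiv,
    convolution_precompR_apply _ hvi (hkc.fderiv ℝ) (hk1.continuous_fderiv (by simp))]
  simp only [convolution, ContinuousLinearMap.flip_apply, ContinuousLinearMap.lsmul_apply,
    smul_eq_mul, mul_comm]

/-- Where the kernel does not see the boundary, mollification commutes with the weak gradient. -/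
theorem gradient_mollify {Ω : Set (E d)} (hΩ : MeasurableSet Ω) {k : E d → ℝ}
    (hk : ContDiff ℝ ∞ k) (hkc : HasCompactSupport k) {u : E d → ℝ} {G : E d → E d}
    (hu : LocallyIntegrable (Ω.indicator u)) (hG : LocallyIntegrable (Ω.indicator G))
    (h : HasWeakGradient Ω u G) {x : E d} (hx : ∀ z ∈ tsupport k, x - z ∈ Ω) :
    gradient (mollify k (Ω.indicator u)) x = mollify k (Ω.indicator G) x := by
  refine ext_inner_right ℝ fun y => ?_
  rw [inner_gradient_left, fderiv_mollify hk hkc hu]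
  have hφ : ContDiff ℝ ∞ fun t => k (x - t) := hk.comp (contDiff_const.sub contDiff_id)
  have hφc : HasCompactSupport fun t => k (x - t) := hkc.comp_homeomorph (Homeomorph.subLeft x)
  have hφs : tsupport (fun t => k (x - t)) ⊆ Ω := by
    intro t ht
    have h1 : x - t ∈ tsupport k :=
      tsupport_comp_subset_preimage k (f := fun t => x - t) (by fun_prop) ht
    simpa using hx _ h1
  have hfd : ∀ t, fderiv ℝ (fun t => k (x - t)) t y = - fderiv ℝ k (x - t) y := by
    intro t
    have h1 : HasFDerivAt k (fderiv ℝ k (x - t)) (x - t) :=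
      (hk.differentiable (by simp) _).hasFDerivAt
    have h2 : HasFDerivAt (fun t => x - t) (-ContinuousLinearMap.id ℝ (E d)) t :=
      (hasFDerivAt_id t).const_sub x
    have h3 : HasFDerivAt (fun t => k (x - t)) _ t := h1.comp t h2
    rw [h3.fderiv]
    simp
  -- The reflected kernel t ↦ k (x - t) is an admissible test function by `hx`. The minus sign of
  -- its derivative cancels the one in the definition of the weak gradient.
  have key := h _ hφ hφc hφs y
  simp only [hfd, mul_neg, integral_neg, neg_inj] at key
  have e1 : ∫ t, Ω.indicator u t * fderiv ℝ k (x - t) y = ∫ t in Ω, u t * fderiv ℝ k (x - t) y := by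
    rw [← integral_indicator hΩ]
    exact integral_congr_ae (Eventually.of_forall fun t => by
      by_cases ht : t ∈ Ω <;> simp [ht])
  have e2 : inner ℝ (mollify k (Ω.indicator G) x) y = ∫ t in Ω, k (x - t) * inner ℝ (G t) y := by
    rw [mollify, real_inner_comm, ← integral_inner (integrable_mollify hk.continuous hkc hG x),
      ← integral_indicator hΩ]
    exact integral_congr_ae (Eventually.of_forall fun t => by
      by_cases ht : t ∈ Ω <;> simp [ht, inner_smul_right, real_inner_comm])
  rw [e1, e2, key]

end Mollify

/-! ### Density of smooth functions on bounded Lipschitz domains. -/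

section Density

open scoped ENNReal ContDiff

variable {Ω : Set (E d)}

/-- Uniform interior cone condition. -/
theorem exists_cone (hΩ : IsOpen Ω) (hlip : HasLipschitzBoundary Ω) {x : E d}
    (hx : x ∈ closure Ω) : ∃ c : E d, ∃ W : Set (E d), IsOpen W ∧ x ∈ W ∧ ∃ ε₀ : ℝ, 0 < ε₀ ∧
      ∀ y ∈ W, y ∈ Ω → ∀ ε ∈ Ioo 0 ε₀, ∀ z : E d, ‖z‖ ≤ 1 → y + ε • (c + z) ∈ Ω := by
  by_cases hxΩ : x ∈ Ω
  · obtain ⟨r, hr, hball⟩ := Metric.isOpen_iff.mp hΩ x hxΩ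
    refine ⟨0, Metric.ball x (r / 2), Metric.isOpen_ball, Metric.mem_ball_self (by positivity),
      r / 2, by positivity, fun y hy _ ε hε z hz => hball ?_⟩
    rw [Metric.mem_ball, dist_eq_norm] at hy ⊢
    have e1 : y + ε • (0 + z) - x = (y - x) + ε • z := by rw [zero_add]; abel
    have e2 : ‖ε • z‖ ≤ ε * 1 := by
      rw [norm_smul, Real.norm_of_nonneg hε.1.le]
      exact mul_le_mul_of_nonneg_left hz hε.1.le
    rw [e1]
    linarith [norm_add_le (y - x) (ε • z), hε.2]
  · have hxf : x ∈ frontier Ω := by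
      rw [hΩ.frontier_eq]; exact ⟨hx, hxΩ⟩
    obtain ⟨e, he, g, ⟨K, hK⟩, U, hU, hxU, hup, hlow⟩ := hlip x hxf
    obtain ⟨r, hr, hball⟩ := Metric.isOpen_iff.mp hU x hxU
    have hK0 : (0 : ℝ) ≤ K := K.2
    -- Along ε (c + z) with ‖z‖ ≤ 1 the height grows by at least ε (K + 1), the graph by at most ε
    -- K, so the point ends strictly above the graph. K + 3 bounds ‖c + z‖ and keeps the
    -- displacement below r / 2.
    refine ⟨(K + 2 : ℝ) • e, Metric.ball x (r / 2), Metric.isOpen_ball,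
      Metric.mem_ball_self (by positivity), r / 2 / (K + 3), by positivity, ?_⟩
    intro y hy hyΩ ε hε z hz
    have hε2 : ε * (K + 3) < r / 2 := by
      have := hε.2
      rwa [lt_div_iff₀ (by positivity)] at this
    have hyU : y ∈ U := hball (Metric.ball_subset_ball (by linarith) hy)
    have hnc : ‖((K + 2 : ℝ) • e + z)‖ ≤ K + 3 := by
      refine (norm_add_le _ _).trans ?_
      rw [norm_smul, he, Real.norm_of_nonneg (by positivity)]
      linarith
    refine hup _ (hball ?_) ?_
    · rw [Metric.mem_ball, dist_eq_norm] at hy ⊢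
      have e1 : y + ε • ((K + 2 : ℝ) • e + z) - x = (y - x) + ε • ((K + 2 : ℝ) • e + z) := by abel
      have e2 : ‖ε • ((K + 2 : ℝ) • e + z)‖ ≤ ε * (K + 3) := by
        rw [norm_smul, Real.norm_of_nonneg hε.1.le]
        exact mul_le_mul_of_nonneg_left hnc hε.1.le
      rw [e1]
      linarith [norm_add_le (y - x) (ε • ((K + 2 : ℝ) • e + z))]
    · set P := (ℝ ∙ e)ᗮ.orthogonalProjectionOnto with hP
      have hPe : P e = 0 := by
        rw [hP, Submodule.orthogonalProjectionOnto_eq_zero_iff, Submodule.orthogonal_orthogonal]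
        exact Submodule.mem_span_singleton_self e
      have hPy : P (y + ε • ((K + 2 : ℝ) • e + z)) = P y + ε • P z := by
        simp only [map_add, map_smul, hPe, smul_zero, zero_add]
      have hPz : ‖P z‖ ≤ 1 := ((ℝ ∙ e)ᗮ.norm_orthogonalProjectionOnto_apply_le z).trans hz
      have hg : g (P y + ε • P z) ≤ g (P y) + K * ε := by
        have h1 := hK.dist_le_mul (P y + ε • P z) (P y)
        rw [dist_eq_norm, dist_eq_norm, add_sub_cancel_left, norm_smul,
          Real.norm_of_nonneg hε.1.le] at h1
        have h2 : (K : ℝ) * (ε * ‖P z‖) ≤ K * ε := by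
          have : ε * ‖P z‖ ≤ ε := mul_le_of_le_one_right hε.1.le hPz
          exact mul_le_mul_of_nonneg_left this hK0
        have h3 := le_abs_self (g (P y + ε • P z) - g (P y))
        rw [← Real.norm_eq_abs] at h3
        linarith
      have hez : -1 ≤ inner ℝ e z := by
        have := abs_real_inner_le_norm e z
        rw [he, one_mul] at this
        linarith [neg_abs_le (inner ℝ e z)]
      have hin : inner ℝ e (y + ε • ((K + 2 : ℝ) • e + z)) =
          inner ℝ e y + ε * ((K + 2) + inner ℝ e z) := by
        rw [inner_add_right, inner_smul_right, inner_add_right, inner_smul_right,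
          real_inner_self_eq_norm_sq, he]
        ring
      rw [hPy, hin]
      have := hlow y hyU hyΩ
      nlinarith [hε.1]

/-- A finite smooth partition of unity subordinate to the cone condition. -/
theorem exists_cone_partition (hΩ : IsOpen Ω) (hbdd : Bornology.IsBounded Ω)
    (hlip : HasLipschitzBoundary Ω) :
    ∃ (ι : Type) (_ : Fintype ι) (θ : ι → E d → ℝ) (c : ι → E d) (ε₀ : ℝ), 0 < ε₀ ∧
      (∀ i, ContDiff ℝ ∞ (θ i)) ∧ (∀ i x, 0 ≤ θ i x) ∧ (∀ i x, θ i x ≤ 1) ∧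
      (∀ x ∈ closure Ω, ∑ i, θ i x = 1) ∧
      ∀ i, ∀ y ∈ Ω, θ i y ≠ 0 → ∀ ε ∈ Ioo 0 ε₀, ∀ z : E d, ‖z‖ ≤ 1 → y + ε • (c i + z) ∈ Ω := by
  have H : ∀ x : closure Ω, ∃ c : E d, ∃ W : Set (E d), IsOpen W ∧ (x : E d) ∈ W ∧ ∃ ε₀ : ℝ,
      0 < ε₀ ∧ ∀ y ∈ W, y ∈ Ω → ∀ ε ∈ Ioo 0 ε₀, ∀ z : E d, ‖z‖ ≤ 1 → y + ε • (c + z) ∈ Ω :=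
    fun x => exists_cone hΩ hlip x.2
  choose c W hWo hxW ε₀ hε₀ hcone using H
  obtain ⟨t, ht⟩ := hbdd.isCompact_closure.elim_finite_subcover W hWo
    (fun x hx => mem_iUnion.mpr ⟨⟨x, hx⟩, hxW ⟨x, hx⟩⟩)
  obtain ⟨n, ⟨q⟩⟩ := Finite.exists_equiv_fin t
  let x : Fin n → closure Ω := fun i => (q.symm i).1
  have hcov : closure Ω ⊆ ⋃ i, W (x i) := by
    intro y hy
    obtain ⟨z, hz, hyz⟩ := mem_iUnion₂.mp (ht hy)
    exact mem_iUnion.mpr ⟨q ⟨z, hz⟩, by simpa [x] using hyz⟩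
  obtain ⟨f, hf⟩ := SmoothPartitionOfUnity.exists_isSubordinate (modelWithCornersSelf ℝ (E d))
    (isClosed_closure (s := Ω)) (fun i => W (x i)) (fun i => hWo _) hcov
  have hmin : ∃ r : ℝ, 0 < r ∧ ∀ i, r ≤ ε₀ (x i) := by
    -- The starting value 1 keeps the minimum positive even if the cover is empty.
    refine ⟨(Finset.univ.image fun i => ε₀ (x i)).fold min 1 id, ?_, fun i => ?_⟩
    · rw [Finset.lt_fold_min]
      refine ⟨one_pos, fun r hr => ?_⟩
      obtain ⟨i, -, rfl⟩ := Finset.mem_image.mp hr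
      exact hε₀ _
    · rw [Finset.fold_min_le]
      exact Or.inr ⟨_, Finset.mem_image_of_mem _ (Finset.mem_univ i), le_rfl⟩
  obtain ⟨r, hr, hri⟩ := hmin
  refine ⟨Fin n, inferInstance, fun i => f i, fun i => c (x i), r, hr,
    fun i => (f i).contMDiff.contDiff, fun i y => f.nonneg i y, fun i y => f.le_one i y,
    fun y hy => ?_, ?_⟩
  · have := f.sum_eq_one hy
    rwa [finsum_eq_sum_of_fintype] at this
  · intro i y hy hθ ε hε z hz
    exact hcone (x i) y (hf i (subset_tsupport _ hθ)) hy ε ⟨hε.1, hε.2.trans_le (hri i)⟩ z hz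

/-- A smooth probability density supported in the closed ball of radius `ε` around `-ε c`. -/
def bumpKernel (c : E d) (ε : ℝ) (hε : 0 < ε) : E d → ℝ :=
  (⟨ε / 2, ε, by positivity, by linarith⟩ : ContDiffBump (-(ε • c))).normed volume

section bumpKernel

variable (c : E d) {ε : ℝ} (hε : 0 < ε)

theorem contDiff_bumpKernel : ContDiff ℝ ∞ (bumpKernel c ε hε) := ContDiffBump.contDiff_normed _

theorem hasCompactSupport_bumpKernel : HasCompactSupport (bumpKernel c ε hε) :=
  ContDiffBump.hasCompactSupport_normed _

/-- Mollification at x samples the points x - z = x + ε (c + w), precisely those that the cone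
condition keeps inside Ω. This is why the kernel is centred at -ε c. -/
theorem exists_of_mem_tsupport_bumpKernel {z : E d} (hz : z ∈ tsupport (bumpKernel c ε hε)) :
    ∃ w : E d, ‖w‖ ≤ 1 ∧ z = -(ε • (c + w)) := by
  rw [bumpKernel, ContDiffBump.tsupport_normed_eq, Metric.mem_closedBall, dist_eq_norm,
    sub_neg_eq_add] at hz
  refine ⟨-(ε⁻¹ • (z + ε • c)), ?_, ?_⟩
  · rw [norm_neg, norm_smul, norm_inv, Real.norm_of_nonneg hε.le, inv_mul_le_iff₀ hε, mul_one]
    exact hz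
  · rw [smul_add, smul_neg, smul_inv_smul₀ hε.ne']
    abel

theorem norm_le_of_mem_tsupport_bumpKernel {z : E d} (hz : z ∈ tsupport (bumpKernel c ε hε)) :
    ‖z‖ ≤ ε * (‖c‖ + 1) := by
  obtain ⟨w, hw, rfl⟩ := exists_of_mem_tsupport_bumpKernel c hε hz
  rw [norm_neg, norm_smul, Real.norm_of_nonneg hε.le]
  exact mul_le_mul_of_nonneg_left ((norm_add_le _ _).trans (by linarith)) hε.le

end bumpKernel

/-- The kernel's support lies within ε (‖c‖ + 1) of the origin, so the shift of its centre does no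
harm and continuity of translations applies. -/
theorem tendsto_mollify {F : Type*} [NormedAddCommGroup F] [NormedSpace ℝ F] [CompleteSpace F]
    {v : E d → F} (hv : StronglyMeasurable v) (hv2 : MemLp v 2 volume) (c : E d) {ε : ℕ → ℝ}
    (hε : ∀ n, 0 < ε n) (hlim : Tendsto ε atTop (𝓝 0)) :
    Tendsto (fun n => eLpNorm (fun x => mollify (bumpKernel c (ε n) (hε n)) v x - v x) 2 volume)
      atTop (𝓝 0) := by
  rw [ENNReal.tendsto_nhds_zero]
  intro δ hδ
  have h1 := (ENNReal.tendsto_nhds_zero.mp (tendsto_eLpNorm_translate hv2)) δ hδ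
  rw [Metric.eventually_nhds_iff_ball] at h1
  obtain ⟨ρ, hρ, h1⟩ := h1
  have h2 : Tendsto (fun n => ε n * (‖c‖ + 1)) atTop (𝓝 0) := by simpa using hlim.mul_const (‖c‖ + 1)
  filter_upwards [h2.eventually (gt_mem_nhds hρ)] with n hn
  refine eLpNorm_mollify_sub_le (contDiff_bumpKernel c (hε n)).continuous
    (hasCompactSupport_bumpKernel c (hε n)) (fun x => ContDiffBump.nonneg_normed _ x)
    (ContDiffBump.integral_normed _) hv (hv2.locallyIntegrable (by norm_num)) fun z hz => h1 z ?_
  rw [mem_ball_zero_iff]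
  exact (norm_le_of_mem_tsupport_bumpKernel c (hε n) (subset_tsupport _ hz)).trans_lt hn

/-- Functions smooth up to the boundary are dense in `H¹(Ω)`. -/
theorem exists_smooth_approx (hΩ : IsOpen Ω) (hbdd : Bornology.IsBounded Ω)
    (hlip : HasLipschitzBoundary Ω) (u : H1 Ω) :
    ∃ φ : ℕ → E d → ℝ, (∀ n, ContDiff ℝ ∞ (φ n)) ∧
      Tendsto (fun n => eLpNorm (fun x => φ n x - fn u x) 2 (volume.restrict Ω)) atTop (𝓝 0) ∧
      Tendsto (fun n => eLpNorm (fun x => gradient (φ n) x - grad u x) 2 (volume.restrict Ω))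
        atTop (𝓝 0) := by
  obtain ⟨ι, _, θ, c, ε₀, hε₀, hθs, hθ0, hθ1, hθsum, hcone⟩ := exists_cone_partition hΩ hbdd hlip
  have hmeas := hΩ.measurableSet
  set v := Ω.indicator (fn u) with hvdef
  set G := Ω.indicator (grad u) with hGdef
  have hv2 : MemLp v 2 volume := (memLp_indicator_iff_restrict hmeas).mpr (Lp.memLp u.1.fst)
  have hG2 : MemLp G 2 volume := (memLp_indicator_iff_restrict hmeas).mpr (Lp.memLp u.1.snd)
  have hvm : StronglyMeasurable v := (Lp.stronglyMeasurable u.1.fst).indicator hmeas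
  have hGm : StronglyMeasurable G := (Lp.stronglyMeasurable u.1.snd).indicator hmeas
  have hvi : LocallyIntegrable v := hv2.locallyIntegrable (by norm_num)
  have hGi : LocallyIntegrable G := hG2.locallyIntegrable (by norm_num)
  -- The shift 2 makes ε n strictly smaller than ε₀ also for n = 0.
  let ε : ℕ → ℝ := fun n => ε₀ / (n + 2)
  have hε : ∀ n, 0 < ε n := fun n => by positivity
  have hεlt : ∀ n, ε n < ε₀ := fun n => div_lt_self hε₀ (by
    have : (0 : ℝ) ≤ n := n.cast_nonneg
    linarith)
  have hεlim : Tendsto ε atTop (𝓝 0) :=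
    tendsto_const_nhds.div_atTop (tendsto_atTop_add_const_right _ _ tendsto_natCast_atTop_atTop)
  let k : ι → ℕ → E d → ℝ := fun i n => bumpKernel (c i) (ε n) (hε n)
  have hJs : ∀ i n, ContDiff ℝ ∞ (mollify (k i n) v) := fun i n =>
    contDiff_mollify (contDiff_bumpKernel _ _) (hasCompactSupport_bumpKernel _ _) hvi
  have hJ : ∀ i, Tendsto (fun n => eLpNorm (fun x => mollify (k i n) v x - v x) 2 volume)
      atTop (𝓝 0) := fun i => tendsto_mollify hvm hv2 (c i) hε hεlim
  have hJG : ∀ i, Tendsto (fun n => eLpNorm (fun x => mollify (k i n) G x - G x) 2 volume)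
      atTop (𝓝 0) := fun i => tendsto_mollify hGm hG2 (c i) hε hεlim
  have hgJ : ∀ i n, ∀ x ∈ Ω, θ i x ≠ 0 →
      gradient (mollify (k i n) v) x = mollify (k i n) G x := by
    intro i n x hx hθ
    refine gradient_mollify hmeas (contDiff_bumpKernel _ _) (hasCompactSupport_bumpKernel _ _)
      hvi hGi u.2 fun z hz => ?_
    obtain ⟨w, hw, rfl⟩ := exists_of_mem_tsupport_bumpKernel _ _ hz
    rw [sub_neg_eq_add]
    exact hcone i x hx hθ (ε n) ⟨hε n, hεlt n⟩ w hw
  have hdθ : ∀ i x, DifferentiableAt ℝ (θ i) x := fun i x => (hθs i).differentiable (by simp) x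
  have hdJ : ∀ i n x, DifferentiableAt ℝ (mollify (k i n) v) x := fun i n x =>
    (hJs i n).differentiable (by simp) x
  -- The functions θ i add up to 1 near every point of the open set Ω. Hence v can be subtracted
  -- inside the terms carrying ∇θ i, which then tend to zero.
  have hgθ : ∀ x ∈ Ω, ∑ i, gradient (θ i) x = 0 := by
    intro x hx
    refine ext_inner_right ℝ fun y => ?_
    rw [sum_inner, inner_zero_left]
    simp only [inner_gradient_left]
    have h1 : (fun x => ∑ i, θ i x) =ᶠ[𝓝 x] fun _ => 1 :=
      (hΩ.mem_nhds hx) |> fun h => Filter.mem_of_superset h fun y hy => hθsum y (subset_closure hy)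
    have h2 := h1.fderiv_eq (𝕜 := ℝ)
    rw [fderiv_fun_sum (u := Finset.univ) (A := θ) fun i _ => hdθ i x, fderiv_const_apply] at h2
    have h3 := congrArg (fun L : E d →L[ℝ] ℝ => L y) h2
    simpa [sum_apply] using h3
  have hgφ : ∀ n, ∀ x, gradient (fun x => ∑ i, θ i x * mollify (k i n) v x) x =
      ∑ i, (θ i x • gradient (mollify (k i n) v) x + mollify (k i n) v x • gradient (θ i) x) := by
    intro n x
    refine ext_inner_right ℝ fun y => ?_
    have h1 := fderiv_fun_sum (u := Finset.univ) (A := fun i x => θ i x * mollify (k i n) v x)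
      (x := x) fun i _ => (hdθ i x).mul (hdJ i n x)
    rw [sum_inner, inner_gradient_left, h1, sum_apply]
    refine Finset.sum_congr rfl fun i _ => ?_
    rw [fderiv_fun_mul (hdθ i x) (hdJ i n x), inner_add_left, real_inner_smul_left,
      real_inner_smul_left, inner_gradient_left, inner_gradient_left]
    rfl
  have hbound : ∀ i, ∃ C : ℝ, ∀ x ∈ Ω, ‖gradient (θ i) x‖ ≤ C := by
    intro i
    obtain ⟨C, hC⟩ := hbdd.isCompact_closure.exists_bound_of_continuousOn
      (continuous_gradient ((hθs i).of_le (by exact_mod_cast le_top))).continuousOn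
    exact ⟨C, fun x hx => hC x (subset_closure hx)⟩
  choose C hC using hbound
  refine ⟨fun n x => ∑ i, θ i x * mollify (k i n) v x, fun n => ?_, ?_, ?_⟩
  · exact ContDiff.sum fun i _ => (hθs i).mul (hJs i n)
  · have hlim : Tendsto (fun n => ∑ i, eLpNorm (fun x => mollify (k i n) v x - v x) 2 volume)
        atTop (𝓝 0) := by
      simpa using tendsto_finsetSum Finset.univ fun i _ => hJ i
    refine tendsto_of_tendsto_of_tendsto_of_le_of_le tendsto_const_nhds hlim (fun _ => zero_le)
      fun n => ?_
    have hm : ∀ i, AEStronglyMeasurable (fun x => θ i x * (mollify (k i n) v x - v x))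
        (volume.restrict Ω) := fun i =>
      ((hθs i).continuous.aestronglyMeasurable.mul
        ((hJs i n).continuous.aestronglyMeasurable.sub hvm.aestronglyMeasurable))
    calc eLpNorm (fun x => ∑ i, θ i x * mollify (k i n) v x - fn u x) 2 (volume.restrict Ω)
        = eLpNorm (∑ i, fun x => θ i x * (mollify (k i n) v x - v x)) 2 (volume.restrict Ω) := by
          refine eLpNorm_congr_ae ((ae_restrict_mem hmeas).mono fun x hx => ?_)
          simp only [Finset.sum_apply, mul_sub, Finset.sum_sub_distrib, ← Finset.sum_mul,
            hθsum x (subset_closure hx), one_mul, hvdef, indicator_of_mem hx]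
      _ ≤ ∑ i, eLpNorm (fun x => θ i x * (mollify (k i n) v x - v x)) 2 (volume.restrict Ω) :=
          eLpNorm_sum_le (fun i _ => hm i) (by norm_num)
      _ ≤ ∑ i, eLpNorm (fun x => mollify (k i n) v x - v x) 2 volume := by
          refine Finset.sum_le_sum fun i _ => ?_
          refine (eLpNorm_mono fun x => ?_).trans (eLpNorm_mono_measure _ Measure.restrict_le_self)
          rw [norm_mul, Real.norm_of_nonneg (hθ0 i x)]
          exact mul_le_of_le_one_left (norm_nonneg _) (hθ1 i x)
  · have hlim : Tendsto (fun n => ∑ i, (eLpNorm (fun x => mollify (k i n) G x - G x) 2 volume +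
        ENNReal.ofReal (C i) * eLpNorm (fun x => mollify (k i n) v x - v x) 2 volume))
        atTop (𝓝 0) := by
      simpa using tendsto_finsetSum Finset.univ fun i _ => (hJG i).add
        (ENNReal.Tendsto.const_mul (hJ i) (Or.inr ENNReal.ofReal_ne_top))
    refine tendsto_of_tendsto_of_tendsto_of_le_of_le tendsto_const_nhds hlim (fun _ => zero_le)
      fun n => ?_
    have hm1 : ∀ i, AEStronglyMeasurable (fun x => θ i x • (mollify (k i n) G x - G x))
        (volume.restrict Ω) := fun i =>
      ((hθs i).continuous.aestronglyMeasurable.smul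
        ((contDiff_mollify (contDiff_bumpKernel _ _) (hasCompactSupport_bumpKernel _ _)
          hGi).continuous.aestronglyMeasurable.sub hGm.aestronglyMeasurable))
    have hm2 : ∀ i, AEStronglyMeasurable (fun x => (mollify (k i n) v x - v x) • gradient (θ i) x)
        (volume.restrict Ω) := fun i =>
      ((hJs i n).continuous.aestronglyMeasurable.sub hvm.aestronglyMeasurable).smul
        (continuous_gradient ((hθs i).of_le (by exact_mod_cast le_top))).aestronglyMeasurable
    calc eLpNorm (fun x => gradient (fun x => ∑ i, θ i x * mollify (k i n) v x) x - grad u x) 2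
          (volume.restrict Ω)
        = eLpNorm (∑ i, ((fun x => θ i x • (mollify (k i n) G x - G x)) +
            fun x => (mollify (k i n) v x - v x) • gradient (θ i) x)) 2 (volume.restrict Ω) := by
          refine eLpNorm_congr_ae ((ae_restrict_mem hmeas).mono fun x hx => ?_)
          -- The kernel of index i stays inside Ω only where θ i is nonzero; elsewhere the factor θ
          -- i x removes the discrepancy.
          have h1 : ∀ i, θ i x • gradient (mollify (k i n) v) x = θ i x • mollify (k i n) G x := by
            intro i
            by_cases h : θ i x = 0
            · rw [h, zero_smul, zero_smul]
            · rw [hgJ i n x hx h]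
          simp only [hgφ, h1, Finset.sum_apply, Pi.add_apply, smul_sub, sub_smul,
            Finset.sum_add_distrib, Finset.sum_sub_distrib, ← Finset.sum_smul, ← Finset.smul_sum,
            hθsum x (subset_closure hx), one_smul, hgθ x hx, smul_zero, sub_zero, hGdef,
            indicator_of_mem hx]
          abel
      _ ≤ ∑ i, eLpNorm ((fun x => θ i x • (mollify (k i n) G x - G x)) +
            fun x => (mollify (k i n) v x - v x) • gradient (θ i) x) 2 (volume.restrict Ω) :=
          eLpNorm_sum_le (fun i _ => (hm1 i).add (hm2 i)) (by norm_num)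
      _ ≤ _ := by
          refine Finset.sum_le_sum fun i _ => ?_
          refine (eLpNorm_add_le (hm1 i) (hm2 i) (by norm_num)).trans (add_le_add ?_ ?_)
          · refine (eLpNorm_mono fun x => ?_).trans
              (eLpNorm_mono_measure _ Measure.restrict_le_self)
            rw [norm_smul, Real.norm_of_nonneg (hθ0 i x)]
            exact mul_le_of_le_one_left (norm_nonneg _) (hθ1 i x)
          · refine (eLpNorm_le_mul_eLpNorm_of_ae_le_mul ?_ 2).trans
              (mul_le_mul_right (eLpNorm_mono_measure _ Measure.restrict_le_self) _)
            refine (ae_restrict_mem hmeas).mono fun x hx => ?_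
            rw [norm_smul, mul_comm]
            exact mul_le_mul_of_nonneg_right (hC i x hx) (norm_nonneg _)

end Density

/-! ### The trace inequality by integration along vertical segments. -/

section TraceInequality

open scoped ENNReal NNReal

/-- The fundamental theorem of calculus for (1 - s / r) h(s)², whose weight is 1 at 0 and vanishes
at r, so no term at r remains. Young's inequality splits the product h h'. -/
theorem sq_zero_le_integral {h h' : ℝ → ℝ} (hd : ∀ s, HasDerivAt h (h' s) s) (hc : Continuous h')
    {r : ℝ} (hr : 0 < r) :
    h 0 ^ 2 ≤ ∫ s in (0 : ℝ)..r, ((1 / r + 1) * h s ^ 2 + h' s ^ 2) := by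
  have hh : Continuous h := continuous_iff_continuousAt.mpr fun s => (hd s).continuousAt
  have hq : ∀ s, HasDerivAt (fun s => (1 - s / r) * h s ^ 2)
      (-(1 / r) * h s ^ 2 + (1 - s / r) * (2 * h s * h' s)) s := by
    intro s
    have h1 : HasDerivAt (fun s => 1 - s / r) (-(1 / r)) s := by
      simpa using ((hasDerivAt_id s).div_const r).const_sub 1
    have h2 : HasDerivAt (fun s => h s ^ 2) (2 * h s * h' s) s := by simpa using (hd s).fun_pow 2
    exact h1.fun_mul h2
  have hint := intervalIntegral.integral_eq_sub_of_hasDerivAt (a := 0) (b := r)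
    (fun s _ => hq s) (Continuous.intervalIntegrable (by fun_prop) _ _)
  have e1 : h 0 ^ 2 = ∫ s in (0 : ℝ)..r,
      -(-(1 / r) * h s ^ 2 + (1 - s / r) * (2 * h s * h' s)) := by
    rw [intervalIntegral.integral_neg, hint]
    simp [hr.ne']
  rw [e1]
  refine intervalIntegral.integral_mono_on hr.le (Continuous.intervalIntegrable (by fun_prop) _ _)
    (Continuous.intervalIntegrable (by fun_prop) _ _) fun s hs => ?_
  have h0 : 0 ≤ 1 - s / r := by rw [sub_nonneg, div_le_one hr]; exact hs.2
  have h1 : 1 - s / r ≤ 1 := by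
    have : 0 ≤ s / r := div_nonneg hs.1 hr.le
    linarith
  set a := 1 - s / r
  nlinarith [sq_nonneg (h s * a + h' s), mul_nonneg (mul_nonneg h0 (sub_nonneg.mpr h1))
    (sq_nonneg (h s)), mul_nonneg (sub_nonneg.mpr h1) (sq_nonneg (h s))]

theorem enorm_sq_zero_le_lintegral {h h' : ℝ → ℝ} (hd : ∀ s, HasDerivAt h (h' s) s)
    (hc : Continuous h') {r : ℝ} (hr : 0 < r) :
    ‖h 0‖ₑ ^ 2 ≤ ENNReal.ofReal (1 / r + 1) * ∫⁻ s in Ioc 0 r, (‖h s‖ₑ ^ 2 + ‖h' s‖ₑ ^ 2) := by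
  have hh : Continuous h := continuous_iff_continuousAt.mpr fun s => (hd s).continuousAt
  have e : ∀ a : ℝ, ‖a‖ₑ ^ 2 = ENNReal.ofReal (a ^ 2) := fun a => by
    rw [Real.enorm_eq_ofReal_abs, ← ENNReal.ofReal_pow (abs_nonneg a), sq_abs]
  have hc0 : (0 : ℝ) ≤ 1 / r + 1 := by positivity
  rw [e, ← lintegral_const_mul' _ _ ENNReal.ofReal_ne_top]
  refine (ENNReal.ofReal_le_ofReal (sq_zero_le_integral hd hc hr)).trans ?_
  rw [intervalIntegral.integral_of_le hr.le, ofReal_integral_eq_lintegral_ofReal]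
  · refine lintegral_mono fun s => ?_
    rw [e, e, ← ENNReal.ofReal_add (sq_nonneg _) (sq_nonneg _), ← ENNReal.ofReal_mul hc0]
    refine ENNReal.ofReal_le_ofReal ?_
    have : 0 < 1 / r := by positivity
    nlinarith [sq_nonneg (h s), sq_nonneg (h' s)]
  · exact (Continuous.integrableOn_Icc (by fun_prop)).mono_set Ioc_subset_Icc_self
  · exact Eventually.of_forall fun s => by positivity

variable {e : E d}

/-- Integration over the space in the coordinates given by a graph. -/
theorem lintegral_graph_coordinates (he : ‖e‖ = 1) {g : (ℝ ∙ e)ᗮ → ℝ}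
    {F : E d → ℝ≥0∞} (hF : Measurable F) :
    ∫⁻ b : (ℝ ∙ e)ᗮ, ∫⁻ s : ℝ, F ((b : E d) + g b • e + s • e) = ∫⁻ x, F x := by
  have hmp := (Submodule.measurePreserving_measurableEquivProd (ℝ ∙ e) (0 : E d)).symm
  rw [InnerProductSpace.euclideanHausdorffMeasure_eq_volume] at hmp
  rw [← hmp.lintegral_comp hF, Measure.volume_eq_prod, lintegral_prod_symm'
    (fun a => F (((ℝ ∙ e).measurableEquivProd (0 : E d)).symm a))
    (hF.comp (MeasurableEquiv.measurable _))]
  refine lintegral_congr fun b => ?_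
  have hs := (LinearIsometryEquiv.toSpanUnitSingleton (𝕜 := ℝ) e he).measurePreserving
  simp only [Submodule.measurableEquivProd_symm_apply, vadd_eq_add, add_zero]
  -- On each vertical line the offset g b is absorbed by translation invariance, so nothing is asked
  -- of g and no Jacobian appears.
  rw [← hs.lintegral_comp (f := fun a : (ℝ ∙ e) => F ((a : E d) + b)) (by fun_prop),
    ← lintegral_add_left_eq_self
      (fun s => F ((LinearIsometryEquiv.toSpanUnitSingleton (𝕜 := ℝ) e he s : E d) + b)) (g b)]
  refine lintegral_congr fun s => ?_
  congr 1
  simp only [LinearIsometryEquiv.toSpanUnitSingleton_apply, add_smul]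
  abel

/-- The surface measure of a Lipschitz graph is controlled by the Lebesgue measure of the base. -/
theorem lintegral_surface_le (he : ‖e‖ = 1) {g : (ℝ ∙ e)ᗮ → ℝ} {K : ℝ≥0} (hg : LipschitzWith K g)
    {S : Set (E d)} (hS : MeasurableSet S)
    (hSg : ∀ y ∈ S, g ((ℝ ∙ e)ᗮ.orthogonalProjectionOnto y) = inner ℝ e y)
    {F : E d → ℝ≥0∞} (hF : Measurable F) :
    ∫⁻ y in S, F y ∂μHE[d - 1] ≤
      ((1 + K : ℝ≥0) ^ (d - 1 : ℕ) : ℝ≥0) *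
        ∫⁻ b : (ℝ ∙ e)ᗮ, S.indicator F ((b : E d) + g b • e) := by
  set gr : (ℝ ∙ e)ᗮ → E d := fun b => (b : E d) + g b • e with hgr
  have hlip : LipschitzWith (1 + K) gr := by
    refine LipschitzWith.add (ℝ ∙ e)ᗮ.subtypeₗᵢ.lipschitz ?_
    refine LipschitzWith.of_dist_le_mul fun a b => ?_
    rw [dist_eq_norm, ← sub_smul, norm_smul, he, mul_one, ← dist_eq_norm]
    exact hg.dist_le_mul a b
  have hfr : Module.finrank ℝ (ℝ ∙ e)ᗮ = d - 1 := by
    have h1 := (ℝ ∙ e).finrank_add_finrank_orthogonal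
    rw [finrank_span_singleton (by rintro rfl; simp at he), finrank_euclideanSpace_fin] at h1
    omega
  have hvol : (μHE[d - 1] : Measure (ℝ ∙ e)ᗮ) = volume := by
    rw [← hfr]; exact InnerProductSpace.euclideanHausdorffMeasure_eq_volume
  have hgrm : Measurable gr := hlip.continuous.measurable
  have himg : ∀ y ∈ S, gr ((ℝ ∙ e)ᗮ.orthogonalProjectionOnto y) = y := by
    intro y hy
    simp only [hgr]
    rw [hSg y hy]
    have h1 := (ℝ ∙ e).starProjection_add_starProjection_orthogonal y
    rw [Submodule.starProjection_unit_singleton ℝ he] at h1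
    rw [add_comm]
    exact h1
  -- S lies in the image of the graph map, which is (1 + K)-Lipschitz on a space of dimension d - 1.
  -- Such a map enlarges (d - 1)-dimensional Hausdorff measure by at most (1 + K)^(d - 1).
  have hle : μHE[d - 1].restrict S ≤
      ((1 + K : ℝ≥0) ^ (d - 1 : ℕ) : ℝ≥0) • (volume.map gr).restrict S := by
    refine Measure.le_iff.mpr fun A hA => ?_
    rw [Measure.restrict_apply hA, Measure.smul_apply, Measure.restrict_apply hA,
      Measure.map_apply hgrm (hA.inter hS)]
    have hsub : A ∩ S ⊆ gr '' (gr ⁻¹' (A ∩ S)) := fun y hy =>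
      ⟨_, by rw [mem_preimage, himg y hy.2]; exact hy, himg y hy.2⟩
    refine (measure_mono hsub).trans ?_
    rw [← hvol]
    simp only [Measure.euclideanHausdorffMeasure_def, Measure.smul_apply]
    rw [smul_comm]
    have := hlip.hausdorffMeasure_image_le (d := ((d - 1 : ℕ) : ℝ)) (Nat.cast_nonneg _)
      (gr ⁻¹' (A ∩ S))
    rw [ENNReal.rpow_natCast] at this
    refine smul_mono_right _ ?_
    rw [ENNReal.smul_def, smul_eq_mul]
    exact_mod_cast this
  calc ∫⁻ y in S, F y ∂μHE[d - 1]
      ≤ ∫⁻ y, F y ∂(((1 + K : ℝ≥0) ^ (d - 1 : ℕ) : ℝ≥0) • (volume.map gr).restrict S) :=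
        lintegral_mono' hle le_rfl
    _ = _ := by
        rw [lintegral_smul_measure, ← lintegral_indicator hS,
          lintegral_map (hF.indicator hS) hgrm, ENNReal.smul_def, smul_eq_mul]

variable {Ω : Set (E d)}

/-- The trace inequality near a boundary point. -/
theorem exists_local_trace_le (hΩ : IsOpen Ω) (hlip : HasLipschitzBoundary Ω) {x : E d}
    (hx : x ∈ frontier Ω) : ∃ r : ℝ, 0 < r ∧ ∃ C : ℝ≥0, ∀ φ : E d → ℝ, ContDiff ℝ 1 φ →
      ∫⁻ y in frontier Ω ∩ Metric.ball x r, ‖φ y‖ₑ ^ 2 ∂μHE[d - 1] ≤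
        C * ∫⁻ y in Ω, (‖φ y‖ₑ ^ 2 + ‖gradient φ y‖ₑ ^ 2) := by
  obtain ⟨e, he, g, ⟨K, hK⟩, U, hU, hxU, hup, hlow⟩ := hlip x hx
  obtain ⟨ρ, hρ, hball⟩ := Metric.isOpen_iff.mp hU x hxU
  -- With half the radius, a vertical segment of length r starting in the small ball stays inside U.
  obtain ⟨r, hr, hρr⟩ : ∃ r : ℝ, 0 < r ∧ ρ = 2 * r := ⟨ρ / 2, by positivity, by ring⟩
  set P := (ℝ ∙ e)ᗮ.orthogonalProjectionOnto with hP
  have hPe : P e = 0 := by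
    rw [hP, Submodule.orthogonalProjectionOnto_eq_zero_iff, Submodule.orthogonal_orthogonal]
    exact Submodule.mem_span_singleton_self e
  have hee : inner ℝ e e = 1 := by rw [real_inner_self_eq_norm_sq, he, one_pow]
  have hgP : Continuous fun y : E d => g (P y) := hK.continuous.comp P.continuous
  have hie : Continuous fun y : E d => (inner ℝ e y : ℝ) := by fun_prop
  -- Above the graph y would lie in Ω, which is open and so misses its frontier. Below it y would
  -- have a neighbourhood disjoint from Ω.
  have hgraph : ∀ y ∈ U, y ∈ frontier Ω → g (P y) = inner ℝ e y := by
    intro y hyU hy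
    rw [hΩ.frontier_eq] at hy
    refine le_antisymm (not_lt.mp fun h => ?_) (not_lt.mp fun h => hy.2 (hup y hyU h))
    have ho : IsOpen (U ∩ {z | inner ℝ e z < g (P z)}) := hU.inter (isOpen_lt hie hgP)
    obtain ⟨z, ⟨hzU, hz⟩, hzΩ⟩ := mem_closure_iff.mp hy.1 _ ho ⟨hyU, h⟩
    exact absurd (hlow z hzU hzΩ) (not_le.mpr hz)
  set S := frontier Ω ∩ Metric.ball x r with hSdef
  have hS : MeasurableSet S := isClosed_frontier.measurableSet.inter Metric.isOpen_ball.measurableSet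
  have hSU : ∀ y ∈ S, y ∈ U := fun y hy =>
    hball (Metric.ball_subset_ball (by linarith) hy.2)
  have hSg : ∀ y ∈ S, g (P y) = inner ℝ e y := fun y hy => hgraph y (hSU y hy) hy.1
  have hSΩ : ∀ y ∈ S, ∀ s ∈ Ioc 0 r, y + s • e ∈ Ω := by
    intro y hy s hs
    refine hup _ (hball ?_) ?_
    · have h1 := hy.2
      rw [Metric.mem_ball, dist_eq_norm] at h1 ⊢
      have e1 : y + s • e - x = (y - x) + s • e := by abel
      have e2 : ‖s • e‖ ≤ r := by
        rw [norm_smul, he, mul_one, Real.norm_of_nonneg hs.1.le]; exact hs.2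
      rw [e1]
      linarith [norm_add_le (y - x) (s • e)]
    · have e1 : P (y + s • e) = P y := by rw [map_add, map_smul, hPe, smul_zero, add_zero]
      rw [e1, hSg y hy, inner_add_right, inner_smul_right, hee, mul_one]
      linarith [hs.1]
  refine ⟨r, hr, (1 + K) ^ (d - 1 : ℕ) * Real.toNNReal (1 / r + 1), fun φ hφ => ?_⟩
  have hcg := continuous_gradient hφ
  set Q : E d → ℝ≥0∞ := fun y => ‖φ y‖ₑ ^ 2 + ‖gradient φ y‖ₑ ^ 2 with hQ
  have hQm : Measurable Q :=
    (hφ.continuous.measurable.enorm.pow_const 2).add (hcg.measurable.enorm.pow_const 2)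
  refine (lintegral_surface_le he hK hS hSg (hφ.continuous.measurable.enorm.pow_const 2)).trans ?_
  rw [ENNReal.coe_mul, mul_assoc]
  refine mul_le_mul_right ?_ _
  rw [← lintegral_indicator hΩ.measurableSet,
    ← lintegral_graph_coordinates he (g := g) (hQm.indicator hΩ.measurableSet),
    ← lintegral_const_mul' _ _ ENNReal.coe_ne_top]
  refine lintegral_mono fun b => ?_
  by_cases hb : (b : E d) + g b • e ∈ S
  swap
  · rw [indicator_of_notMem hb]; exact zero_le
  rw [indicator_of_mem hb]
  set y := (b : E d) + g b • e with hy
  have hder : ∀ s : ℝ, HasDerivAt (fun s : ℝ => φ (y + s • e))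
      (inner ℝ (gradient φ (y + s • e)) e) s := by
    intro s
    rw [inner_gradient_left]
    have h1 : HasDerivAt (fun s : ℝ => y + s • e) e s := by
      simpa using ((hasDerivAt_id s).smul_const e).const_add y
    exact ((hφ.differentiable (by simp) _).hasFDerivAt).comp_hasDerivAt s h1
  have h1 := enorm_sq_zero_le_lintegral hder
    ((hcg.comp (by fun_prop)).inner continuous_const) hr
  rw [zero_smul, add_zero] at h1
  refine h1.trans (mul_le_mul_right ?_ _)
  rw [← lintegral_indicator measurableSet_Ioc]
  refine lintegral_mono fun s => ?_
  by_cases hs : s ∈ Ioc 0 r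
  swap
  · rw [indicator_of_notMem hs]; exact zero_le
  rw [indicator_of_mem hs, indicator_of_mem (hSΩ y hb s hs)]
  refine add_le_add le_rfl (pow_le_pow_left' ?_ 2)
  rw [← ofReal_norm, ← ofReal_norm]
  refine ENNReal.ofReal_le_ofReal ?_
  have := norm_inner_le_norm (𝕜 := ℝ) (gradient φ (y + s • e)) e
  rwa [he, mul_one] at this

/-- The trace inequality for functions smooth up to the boundary. -/
theorem exists_trace_le (hΩ : IsOpen Ω) (hbdd : Bornology.IsBounded Ω)
    (hlip : HasLipschitzBoundary Ω) : ∃ C : ℝ≥0, ∀ φ : E d → ℝ, ContDiff ℝ 1 φ →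
      eLpNorm φ 2 (surfaceMeasure Ω) ^ 2 ≤ C * (eLpNorm φ 2 (volume.restrict Ω) ^ 2 +
        eLpNorm (gradient φ) 2 (volume.restrict Ω) ^ 2) := by
  have H : ∀ x : frontier Ω, _ := fun x => exists_local_trace_le hΩ hlip x.2
  choose r hr C hC using H
  have hcomp : IsCompact (frontier Ω) :=
    hbdd.isCompact_closure.of_isClosed_subset isClosed_frontier frontier_subset_closure
  obtain ⟨t, ht⟩ := hcomp.elim_finite_subcover (fun x : frontier Ω => Metric.ball (x : E d) (r x))
    (fun x => Metric.isOpen_ball)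
    (fun x hx => mem_iUnion.mpr ⟨⟨x, hx⟩, Metric.mem_ball_self (hr ⟨x, hx⟩)⟩)
  refine ⟨∑ x : t, C x, fun φ hφ => ?_⟩
  simp only [eLpNorm_two_sq]
  rw [← lintegral_add_left (hφ.continuous.measurable.enorm.pow_const 2), surfaceMeasure]
  have hsub : frontier Ω ⊆ ⋃ x : t, (frontier Ω ∩ Metric.ball (x : E d) (r x)) := by
    intro y hy
    obtain ⟨x, hx, hyx⟩ := mem_iUnion₂.mp (ht hy)
    exact mem_iUnion.mpr ⟨⟨x, hx⟩, hy, hyx⟩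
  calc ∫⁻ y in frontier Ω, ‖φ y‖ₑ ^ 2 ∂μHE[d - 1]
      ≤ ∫⁻ y in ⋃ x : t, (frontier Ω ∩ Metric.ball (x : E d) (r x)), ‖φ y‖ₑ ^ 2 ∂μHE[d - 1] :=
        lintegral_mono_set hsub
    _ ≤ ∑' x : t, ∫⁻ y in frontier Ω ∩ Metric.ball (x : E d) (r x), ‖φ y‖ₑ ^ 2 ∂μHE[d - 1] :=
        lintegral_iUnion_le _ _
    _ = ∑ x : t, ∫⁻ y in frontier Ω ∩ Metric.ball (x : E d) (r x), ‖φ y‖ₑ ^ 2 ∂μHE[d - 1] :=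
        tsum_fintype _
    _ ≤ ∑ x : t, C x * ∫⁻ y in Ω, (‖φ y‖ₑ ^ 2 + ‖gradient φ y‖ₑ ^ 2) :=
        Finset.sum_le_sum fun x _ => hC x φ hφ
    _ = _ := by rw [← Finset.sum_mul]; push_cast; rfl

end TraceInequality

/-! ### The trace operator. -/

section Trace

open scoped ENNReal NNReal ContDiff

variable {Ω : Set (E d)}

/-- Bounded open sets with Lipschitz boundary. -/
structure IsLipschitzDomain (Ω : Set (E d)) : Prop where
  isOpen : IsOpen Ω
  isBounded : Bornology.IsBounded Ω
  lip : HasLipschitzBoundary Ω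

theorem tendsto_toLp_iff {α ι F : Type*} [MeasurableSpace α] {μ : Measure α} [NormedAddCommGroup F]
    {l : Filter ι} {f : ι → α → F} (hf : ∀ n, MemLp (f n) 2 μ) (g : Lp F 2 μ) :
    Tendsto (fun n => (hf n).toLp (f n)) l (𝓝 g) ↔
      Tendsto (fun n => eLpNorm (fun x => f n x - g x) 2 μ) l (𝓝 0) := by
  rw [Lp.tendsto_Lp_iff_tendsto_eLpNorm']
  refine tendsto_congr fun n => eLpNorm_congr_ae ?_
  filter_upwards [(hf n).coeFn_toLp] with x hx
  rw [Pi.sub_apply, hx]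

theorem tendsto_ofC1_iff {ι : Type*} {l : Filter ι} (hΩ : Bornology.IsBounded Ω)
    {φ : ι → E d → ℝ} (hφ : ∀ n, ContDiff ℝ 1 (φ n)) (u : H1 Ω) :
    Tendsto (fun n => H1.ofC1 hΩ (hφ n)) l (𝓝 u) ↔
      Tendsto (fun n => eLpNorm (fun x => φ n x - fn u x) 2 (volume.restrict Ω)) l (𝓝 0) ∧
      Tendsto (fun n => eLpNorm (fun x => gradient (φ n) x - grad u x) 2 (volume.restrict Ω))
        l (𝓝 0) := by
  have e1 := tendsto_toLp_iff (l := l) (fun n => memLp_of_continuous hΩ (hφ n).continuous 2)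
    (fnL Ω u)
  have e2 := tendsto_toLp_iff (l := l)
    (fun n => memLp_of_continuous hΩ (continuous_gradient (hφ n)) 2) (gradL Ω u)
  rw [coe_fnL] at e1
  rw [coe_gradL] at e2
  rw [← e1, ← e2]
  exact ⟨fun h => ⟨((fnL Ω).continuous.tendsto u).comp h, ((gradL Ω).continuous.tendsto u).comp h⟩,
    fun h => tendsto_H1 h.1 h.2⟩

theorem norm_ofC1_sq (hΩ : Bornology.IsBounded Ω) {φ : E d → ℝ} (hφ : ContDiff ℝ 1 φ) :
    ENNReal.ofReal (‖H1.ofC1 hΩ hφ‖ ^ 2) = eLpNorm φ 2 (volume.restrict Ω) ^ 2 +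
      eLpNorm (gradient φ) 2 (volume.restrict Ω) ^ 2 := by
  have m1 := memLp_of_continuous hΩ hφ.continuous 2
  have m2 := memLp_of_continuous hΩ (continuous_gradient hφ) 2
  have e1 : ‖fnL Ω (H1.ofC1 hΩ hφ)‖ = (eLpNorm φ 2 (volume.restrict Ω)).toReal := Lp.norm_toLp _ m1
  have e2 : ‖gradL Ω (H1.ofC1 hΩ hφ)‖ = (eLpNorm (gradient φ) 2 (volume.restrict Ω)).toReal :=
    Lp.norm_toLp _ m2
  have e3 := H1.norm_sq_eq (H1.ofC1 hΩ hφ)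
  rw [e1, e2] at e3
  rw [e3, ENNReal.ofReal_add (by positivity) (by positivity),
    ENNReal.ofReal_pow ENNReal.toReal_nonneg, ENNReal.ofReal_pow ENNReal.toReal_nonneg,
    ENNReal.ofReal_toReal m1.2.ne, ENNReal.ofReal_toReal m2.2.ne]

/-- The space `C^∞(ℝᵈ)`. -/
def smoothFunctions (d : ℕ) : Submodule ℝ (E d → ℝ) where
  carrier := {φ | ContDiff ℝ ∞ φ}
  zero_mem' := by
    rw [mem_ofPred_eq]
    exact contDiff_const
  add_mem' := by
    intro φ ψ h1 h2
    rw [mem_ofPred_eq] at *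
    exact h1.add h2
  smul_mem' := by
    intro c φ h
    rw [mem_ofPred_eq] at *
    exact contDiff_const.smul h

theorem mem_smoothFunctions {φ : E d → ℝ} : φ ∈ smoothFunctions d ↔ ContDiff ℝ ∞ φ := Iff.rfl

theorem contDiff_one_of_smooth (φ : smoothFunctions d) : ContDiff ℝ 1 (φ : E d → ℝ) :=
  ContDiff.of_le (mem_smoothFunctions.mp φ.2) (by exact_mod_cast le_top)

/-- The restriction of smooth functions as a map to `H¹(Ω)`. -/
def smoothToH1 (hΩ : Bornology.IsBounded Ω) : smoothFunctions d →ₗ[ℝ] H1 Ω where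
  toFun φ := H1.ofC1 hΩ (contDiff_one_of_smooth φ)
  map_add' φ ψ := by
    refine H1.ext (MemLp.toLp_add
      (memLp_of_continuous hΩ (contDiff_one_of_smooth φ).continuous 2)
      (memLp_of_continuous hΩ (contDiff_one_of_smooth ψ).continuous 2)) ?_
    have m1 := memLp_of_continuous hΩ (continuous_gradient (contDiff_one_of_smooth φ)) 2
    have m2 := memLp_of_continuous hΩ (continuous_gradient (contDiff_one_of_smooth ψ)) 2
    have m3 := memLp_of_continuous hΩ (continuous_gradient (contDiff_one_of_smooth (φ + ψ))) 2
    refine Eq.trans (MemLp.toLp_congr m3 (m1.add m2) (Eventually.of_forall fun x => ?_))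
      (MemLp.toLp_add m1 m2)
    · refine ext_inner_right ℝ fun y => ?_
      rw [Pi.add_apply, inner_add_left, inner_gradient_left, inner_gradient_left,
        inner_gradient_left, Submodule.coe_add,
        fderiv_add ((contDiff_one_of_smooth φ).differentiable (by simp) x)
        ((contDiff_one_of_smooth ψ).differentiable (by simp) x)]
      rfl
  map_smul' c φ := by
    refine H1.ext (MemLp.toLp_const_smul c
      (memLp_of_continuous hΩ (contDiff_one_of_smooth φ).continuous 2)) ?_
    have m1 := memLp_of_continuous hΩ (continuous_gradient (contDiff_one_of_smooth φ)) 2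
    have m2 := memLp_of_continuous hΩ (continuous_gradient (contDiff_one_of_smooth (c • φ))) 2
    refine Eq.trans (MemLp.toLp_congr m2 (m1.const_smul c) (Eventually.of_forall fun x => ?_))
      (MemLp.toLp_const_smul c m1)
    · refine ext_inner_right ℝ fun y => ?_
      rw [Pi.smul_apply, real_inner_smul_left, inner_gradient_left,
        inner_gradient_left, Submodule.coe_smul,
        fderiv_const_smul ((contDiff_one_of_smooth φ).differentiable (by simp) x)]
      rfl

theorem denseRange_smoothToH1 (hΩ : IsLipschitzDomain Ω) :
    DenseRange (smoothToH1 hΩ.isBounded) := by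
  intro u
  obtain ⟨φ, hφ, h1, h2⟩ := exists_smooth_approx hΩ.isOpen hΩ.isBounded hΩ.lip u
  have h := (tendsto_ofC1_iff hΩ.isBounded (fun n => contDiff_one_of_smooth ⟨φ n, hφ n⟩) u).mpr
    ⟨h1, h2⟩
  exact mem_closure_of_tendsto h (Eventually.of_forall fun n => ⟨⟨φ n, hφ n⟩, rfl⟩)

theorem memLp_surfaceMeasure (hΩ : IsLipschitzDomain Ω) {φ : E d → ℝ} (hφ : ContDiff ℝ 1 φ) :
    MemLp φ 2 (surfaceMeasure Ω) := by
  obtain ⟨C, hC⟩ := exists_trace_le hΩ.isOpen hΩ.isBounded hΩ.lip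
  refine ⟨hφ.continuous.aestronglyMeasurable, ?_⟩
  have h := hC φ hφ
  rw [← norm_ofC1_sq hΩ.isBounded hφ] at h
  have h2 := h.trans_lt (ENNReal.mul_lt_top ENNReal.coe_lt_top ENNReal.ofReal_lt_top)
  exact (ENNReal.pow_lt_top_iff.mp h2).resolve_right two_ne_zero

/-- The restriction of smooth functions to the boundary. -/
def smoothToBoundary (hΩ : IsLipschitzDomain Ω) :
    smoothFunctions d →ₗ[ℝ] Lp ℝ 2 (surfaceMeasure Ω) where
  toFun φ := (memLp_surfaceMeasure hΩ (contDiff_one_of_smooth φ)).toLp φ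
  map_add' _ _ := MemLp.toLp_add _ _
  map_smul' c _ := MemLp.toLp_const_smul c _

theorem smoothToH1_apply (hΩ : Bornology.IsBounded Ω) (φ : smoothFunctions d) :
    smoothToH1 hΩ φ = H1.ofC1 hΩ (contDiff_one_of_smooth φ) := rfl

theorem exists_eLpNorm_surfaceMeasure_le (hΩ : IsLipschitzDomain Ω) : ∃ C : ℝ, ∀ φ : E d → ℝ,
    ∀ hφ : ContDiff ℝ 1 φ,
      (eLpNorm φ 2 (surfaceMeasure Ω)).toReal ≤ C * ‖H1.ofC1 hΩ.isBounded hφ‖ := by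
  obtain ⟨C, hC⟩ := exists_trace_le hΩ.isOpen hΩ.isBounded hΩ.lip
  refine ⟨Real.sqrt C, fun φ hφ => ?_⟩
  have h := hC φ hφ
  rw [← norm_ofC1_sq hΩ.isBounded hφ] at h
  have ha := norm_nonneg (H1.ofC1 hΩ.isBounded hφ)
  generalize ‖H1.ofC1 hΩ.isBounded hφ‖ = a at h ha
  have h3 := ENNReal.toReal_mono (ENNReal.mul_ne_top ENNReal.coe_ne_top ENNReal.ofReal_ne_top) h
  rw [ENNReal.toReal_mul, ENNReal.coe_toReal, ENNReal.toReal_ofReal (by positivity),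
    ENNReal.toReal_pow] at h3
  refine le_of_sq_le_sq ?_ (by positivity)
  rw [mul_pow, Real.sq_sqrt (NNReal.coe_nonneg C)]
  exact h3

theorem exists_norm_smoothToBoundary_le (hΩ : IsLipschitzDomain Ω) : ∃ C : ℝ, ∀ φ,
    ‖smoothToBoundary hΩ φ‖ ≤ C * ‖smoothToH1 hΩ.isBounded φ‖ := by
  obtain ⟨C, hC⟩ := exists_eLpNorm_surfaceMeasure_le hΩ
  refine ⟨C, fun φ => ?_⟩
  rw [smoothToH1_apply]
  refine le_trans (le_of_eq ?_) (hC φ (contDiff_one_of_smooth φ))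
  exact Lp.norm_toLp _ (memLp_surfaceMeasure hΩ (contDiff_one_of_smooth φ))

/-- The trace operator. -/
def traceL (hΩ : IsLipschitzDomain Ω) : H1 Ω →L[ℝ] Lp ℝ 2 (surfaceMeasure Ω) :=
  (smoothToBoundary hΩ).extendOfNorm (smoothToH1 hΩ.isBounded)

theorem traceL_smooth (hΩ : IsLipschitzDomain Ω) (φ : smoothFunctions d) :
    traceL hΩ (smoothToH1 hΩ.isBounded φ) = smoothToBoundary hΩ φ :=
  LinearMap.extendOfNorm_eq (denseRange_smoothToH1 hΩ) (exists_norm_smoothToBoundary_le hΩ) φ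

/-- Along any smooth sequence converging to u in H¹, the boundary values converge to `traceL hΩ u`
by continuity. Uniqueness of limits then excludes any other trace, and density supplies such a
sequence. -/
theorem isTrace_iff (hΩ : IsLipschitzDomain Ω) (u : H1 Ω) (g : Lp ℝ 2 (surfaceMeasure Ω)) :
    IsTrace u g ↔ g = traceL hΩ u := by
  have key : ∀ φ : ℕ → E d → ℝ, ∀ hφ : ∀ n, ContDiff ℝ ∞ (φ n),
      Tendsto (fun n => eLpNorm (fun x => φ n x - fn u x) 2 (volume.restrict Ω)) atTop (𝓝 0) →
      Tendsto (fun n => eLpNorm (fun x => gradient (φ n) x - grad u x) 2 (volume.restrict Ω))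
        atTop (𝓝 0) →
      Tendsto (fun n => smoothToBoundary hΩ ⟨φ n, hφ n⟩) atTop (𝓝 (traceL hΩ u)) := by
    intro φ hφ h1 h2
    have h := (tendsto_ofC1_iff hΩ.isBounded (fun n => contDiff_one_of_smooth ⟨φ n, hφ n⟩) u).mpr
      ⟨h1, h2⟩
    refine (((traceL hΩ).continuous.tendsto u).comp h).congr fun n => ?_
    exact traceL_smooth hΩ ⟨φ n, hφ n⟩
  constructor
  · rintro ⟨φ, hφ, h1, h2, h3⟩
    rw [← tendsto_toLp_iff
      (fun n => memLp_surfaceMeasure hΩ (contDiff_one_of_smooth ⟨φ n, hφ n⟩))] at h3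
    exact tendsto_nhds_unique h3 (key φ hφ h1 h2)
  · rintro rfl
    obtain ⟨φ, hφ, h1, h2⟩ := exists_smooth_approx hΩ.isOpen hΩ.isBounded hΩ.lip u
    exact ⟨φ, hφ, h1, h2, (tendsto_toLp_iff
      (fun n => memLp_surfaceMeasure hΩ (contDiff_one_of_smooth ⟨φ n, hφ n⟩)) _).mp
      (key φ hφ h1 h2)⟩

/-- Makes the choice-based `trace` linear and continuous; its default branch is never reached on a
Lipschitz domain. -/
theorem trace_eq_traceL (hΩ : IsLipschitzDomain Ω) (u : H1 Ω) : trace u = traceL hΩ u := by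
  have h : ∃ g, IsTrace u g := ⟨_, (isTrace_iff hΩ u _).mpr rfl⟩
  rw [trace, dif_pos h]
  exact (isTrace_iff hΩ u _).mp h.choose_spec

end Trace

/-! ### Vanishing of the trace for functions supported inside Ω. -/

section Cutoff

open scoped ENNReal NNReal ContDiff

variable {Ω : Set (E d)}

/-- The function equals 1 on a neighbourhood of K, not merely on K, so its gradient vanishes there
too. Multiplication by χ then alters neither values nor gradients on K. -/
theorem exists_cutoff (hΩ : IsOpen Ω) {K : Set (E d)} (hK : IsCompact K) (hKΩ : K ⊆ Ω) :
    ∃ χ : E d → ℝ, ContDiff ℝ ∞ χ ∧ (∀ x, ‖χ x‖ ≤ 1) ∧ (∀ x ∈ K, χ x = 1) ∧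
      (∀ x ∈ K, gradient χ x = 0) ∧ (∀ x ∉ Ω, χ x = 0) ∧ ∃ C, ∀ x, ‖gradient χ x‖ ≤ C := by
  obtain ⟨t, ht, hKt, htΩ⟩ := exists_compact_between hK hΩ hKΩ
  obtain ⟨f, h1, h0, hf⟩ := exists_contMDiffMap_one_nhds_of_subset_interior (n := ⊤)
    (modelWithCornersSelf ℝ (E d)) hK.isClosed hKt
  have hs : ContDiff ℝ ∞ f := f.contMDiff.contDiff
  have hc : HasCompactSupport f := HasCompactSupport.intro ht h0
  have hg : Continuous (gradient f) := continuous_gradient (hs.of_le (by exact_mod_cast le_top))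
  have hgc : HasCompactSupport (gradient f) :=
    (hc.fderiv ℝ).comp_left (map_zero (InnerProductSpace.toDual ℝ (E d)).symm)
  rw [eventually_nhdsSet_iff_forall] at h1
  refine ⟨f, hs, fun x => ?_, fun x hx => (h1 x hx).self_of_nhds, fun x hx => ?_,
    fun x hx => h0 x fun h => hx (htΩ h), hg.bounded_above_of_compact_support hgc⟩
  · rw [Real.norm_of_nonneg (hf x).1]
    exact (hf x).2
  · have h2 : f =ᶠ[𝓝 x] fun _ => (1 : ℝ) := h1 x hx
    rw [gradient, h2.fderiv_eq (𝕜 := ℝ), fderiv_const_apply, map_zero]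

/-- The trace of a function supported in a compact subset of the domain vanishes. -/
theorem traceL_eq_zero (hΩ : IsLipschitzDomain Ω) {u : H1 Ω} {K : Set (E d)} (hK : IsCompact K)
    (hKΩ : K ⊆ Ω) (h0 : ∀ᵐ x ∂volume.restrict Ω, x ∉ K → fn u x = 0)
    (h0' : ∀ᵐ x ∂volume.restrict Ω, x ∉ K → grad u x = 0) : traceL hΩ u = 0 := by
  obtain ⟨χ, hχ, hχ1, hχK, hgχK, hχΩ, C, hC⟩ := exists_cutoff hΩ.isOpen hK hKΩ
  obtain ⟨φ, hφ, h1, h2⟩ := exists_smooth_approx hΩ.isOpen hΩ.isBounded hΩ.lip u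
  have hdχ : ∀ x, DifferentiableAt ℝ χ x := fun x => hχ.differentiable (by simp) x
  have hdφ : ∀ n x, DifferentiableAt ℝ (φ n) x := fun n x => (hφ n).differentiable (by simp) x
  have hs : ∀ n, ContDiff ℝ ∞ fun x => χ x * φ n x := fun n => hχ.mul (hφ n)
  have hg : ∀ n x, gradient (fun x => χ x * φ n x) x =
      χ x • gradient (φ n) x + φ n x • gradient χ x := by
    intro n x
    refine ext_inner_right ℝ fun y => ?_
    rw [inner_gradient_left, fderiv_fun_mul (hdχ x) (hdφ n x), inner_add_left,
      real_inner_smul_left, real_inner_smul_left, inner_gradient_left, inner_gradient_left]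
    rfl
  have hum : AEStronglyMeasurable (fn u) (volume.restrict Ω) := (Lp.memLp u.1.fst).1
  have hgum : AEStronglyMeasurable (grad u) (volume.restrict Ω) := (Lp.memLp u.1.snd).1
  -- As u vanishes off K and χ = 1 on K, u = χ u almost everywhere. The error of χ φ n is thus χ
  -- times that of φ n.
  have t1 : Tendsto (fun n => eLpNorm (fun x => χ x * φ n x - fn u x) 2 (volume.restrict Ω))
      atTop (𝓝 0) := by
    refine tendsto_of_tendsto_of_tendsto_of_le_of_le tendsto_const_nhds h1 (fun _ => zero_le)
      fun n => eLpNorm_mono_ae ?_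
    filter_upwards [h0] with x hx
    have e : χ x * φ n x - fn u x = χ x * (φ n x - fn u x) := by
      by_cases hxK : x ∈ K
      · rw [hχK x hxK, one_mul, one_mul]
      · rw [hx hxK, sub_zero, sub_zero]
    rw [e, norm_mul]
    exact mul_le_of_le_one_left (norm_nonneg _) (hχ1 x)
  have t2 : Tendsto (fun n => eLpNorm (fun x => gradient (fun x => χ x * φ n x) x - grad u x) 2
      (volume.restrict Ω)) atTop (𝓝 0) := by
    have hlim : Tendsto (fun n => eLpNorm (fun x => gradient (φ n) x - grad u x) 2
        (volume.restrict Ω) + ENNReal.ofReal C *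
          eLpNorm (fun x => φ n x - fn u x) 2 (volume.restrict Ω)) atTop (𝓝 0) := by
      simpa using h2.add (ENNReal.Tendsto.const_mul h1 (Or.inr ENNReal.ofReal_ne_top))
    refine tendsto_of_tendsto_of_tendsto_of_le_of_le tendsto_const_nhds hlim (fun _ => zero_le)
      fun n => ?_
    have hcg : ∀ ψ : E d → ℝ, ContDiff ℝ ∞ ψ → Continuous (gradient ψ) := fun ψ hψ =>
      continuous_gradient (hψ.of_le (by exact_mod_cast le_top))
    have hm1 : AEStronglyMeasurable (fun x => χ x • (gradient (φ n) x - grad u x))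
        (volume.restrict Ω) :=
      hχ.continuous.aestronglyMeasurable.smul
        ((hcg _ (hφ n)).aestronglyMeasurable.sub hgum)
    have hm2 : AEStronglyMeasurable (fun x => (φ n x - fn u x) • gradient χ x)
        (volume.restrict Ω) :=
      ((hφ n).continuous.aestronglyMeasurable.sub hum).smul (hcg _ hχ).aestronglyMeasurable
    have e : (fun x => gradient (fun x => χ x * φ n x) x - grad u x) =ᵐ[volume.restrict Ω]
        (fun x => χ x • (gradient (φ n) x - grad u x)) +
          fun x => (φ n x - fn u x) • gradient χ x := by
      filter_upwards [h0, h0'] with x hx hx'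
      rw [hg, Pi.add_apply]
      by_cases hxK : x ∈ K
      · rw [hχK x hxK, hgχK x hxK, one_smul, one_smul, smul_zero, smul_zero, add_zero, add_zero]
      · rw [hx hxK, hx' hxK, sub_zero, sub_zero, sub_zero]
    rw [eLpNorm_congr_ae e]
    refine (eLpNorm_add_le hm1 hm2 (by norm_num)).trans (add_le_add ?_ ?_)
    · refine eLpNorm_mono fun x => ?_
      rw [norm_smul]
      exact mul_le_of_le_one_left (norm_nonneg _) (hχ1 x)
    · refine eLpNorm_le_mul_eLpNorm_of_ae_le_mul (Eventually.of_forall fun x => ?_) 2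
      rw [norm_smul, mul_comm]
      exact mul_le_mul_of_nonneg_right (hC x) (norm_nonneg _)
  -- The approximants χ φ n vanish identically on the frontier, so zero is a trace of u.
  have h := (isTrace_iff hΩ u 0).mp ⟨_, hs, t1, t2, ?_⟩
  · exact h.symm
  · refine tendsto_const_nhds.congr fun n => ?_
    symm
    rw [eLpNorm_eq_zero_iff]
    · filter_upwards [Lp.coeFn_zero ℝ 2 (surfaceMeasure Ω),
        ae_restrict_mem (μ := μHE[d - 1]) (isClosed_frontier (s := Ω)).measurableSet] with x hx hxΩ
      have hx' : x ∉ Ω := by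
        rw [hΩ.isOpen.frontier_eq] at hxΩ
        exact hxΩ.2
      rw [hx, hχΩ x hx', zero_mul, Pi.zero_apply, sub_zero]
    · exact (hs n).continuous.aestronglyMeasurable.sub (Lp.aestronglyMeasurable _)
    · norm_num

end Cutoff

/-! ### Deformations of Ω and composition with them on L². -/

section Deformation

open scoped ENNReal NNReal ContDiff

variable {Ω : Set (E d)} {T S : E d → E d}

/-- Bi-Lipschitz `C¹` transformations of `ℝᵈ` which move only points of a compact subset of `Ω`. -/
structure IsDeformation (Ω : Set (E d)) (T : E d → E d) : Prop where
  contDiff : ContDiff ℝ 1 T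
  antilipschitz : AntilipschitzWith 2 T
  lipschitz : LipschitzWith 2 T
  surjective : Function.Surjective T
  compact : ∃ K : Set (E d), IsCompact K ∧ K ⊆ Ω ∧ ∀ x ∉ K, T x = x

namespace IsDeformation

theorem continuous (hT : IsDeformation Ω T) : Continuous T := hT.contDiff.continuous

theorem measurable (hT : IsDeformation Ω T) : Measurable T := hT.continuous.measurable

theorem injective (hT : IsDeformation Ω T) : Function.Injective T := hT.antilipschitz.injective

theorem hasFDerivAt (hT : IsDeformation Ω T) (x : E d) : HasFDerivAt T (fderiv ℝ T x) x :=
  (hT.contDiff.differentiable (by simp) x).hasFDerivAt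

theorem continuous_fderiv (hT : IsDeformation Ω T) : Continuous (fderiv ℝ T) :=
  hT.contDiff.continuous_fderiv (by simp)

theorem norm_fderiv_le (hT : IsDeformation Ω T) (x : E d) : ‖fderiv ℝ T x‖ ≤ 2 :=
  norm_fderiv_le_of_lipschitz ℝ hT.lipschitz

/-- Points outside Ω are fixed. A point of Ω sent outside Ω would have a fixed image and so equal it
by injectivity. -/
theorem mem_iff (hT : IsDeformation Ω T) (x : E d) : T x ∈ Ω ↔ x ∈ Ω := by
  obtain ⟨K, -, hK, h⟩ := hT.compact
  constructor
  · intro hx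
    by_contra hx'
    exact hx' (h x (fun hxK => hx' (hK hxK)) ▸ hx)
  · intro hx
    by_contra hx'
    have h1 : T x = x := hT.injective (h (T x) fun hxK => hx' (hK hxK))
    exact hx' (h1.symm ▸ hx)

theorem bijOn (hT : IsDeformation Ω T) : BijOn T Ω Ω := by
  refine ⟨fun x hx => (hT.mem_iff x).mpr hx, hT.injective.injOn, fun y hy => ?_⟩
  obtain ⟨x, rfl⟩ := hT.surjective y
  exact ⟨x, (hT.mem_iff x).mp hy, rfl⟩

theorem image_eq (hT : IsDeformation Ω T) : T '' Ω = Ω := hT.bijOn.image_eq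

/-- The antilipschitz constant 2 enlarges preimages by at most 2^d in d-dimensional Hausdorff
measure. This makes composition with T bounded on L²(Ω) by a constant independent of T. -/
theorem map_le (hT : IsDeformation Ω T) :
    (volume.restrict Ω).map T ≤ ((2 : ℝ≥0) ^ d) • volume.restrict Ω := by
  refine Measure.le_iff.mpr fun A hA => ?_
  have hpre : T ⁻¹' A ∩ Ω = T ⁻¹' (A ∩ Ω) := by
    ext x
    rw [preimage_inter, mem_inter_iff, mem_inter_iff, mem_preimage (s := Ω), hT.mem_iff]
  rw [Measure.map_apply hT.measurable hA, Measure.restrict_apply (hT.measurable hA), hpre,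
    Measure.smul_apply, Measure.restrict_apply hA, ← EuclideanSpace.euclideanHausdorffMeasure_eq_volume]
  simp only [Measure.euclideanHausdorffMeasure_def, Measure.smul_apply]
  rw [smul_comm]
  refine smul_mono_right _ ?_
  have h := hT.antilipschitz.hausdorffMeasure_preimage_le (d := (d : ℝ)) (Nat.cast_nonneg _) (A ∩ Ω)
  rw [ENNReal.rpow_natCast] at h
  rw [ENNReal.smul_def, smul_eq_mul]
  exact_mod_cast h

/-- A derivative of a deformation is invertible. -/
theorem antilipschitz_fderiv (hT : IsDeformation Ω T) (x y : E d) :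
    ‖y‖ ≤ 2 * ‖fderiv ℝ T x y‖ := by
  have h1 : HasDerivAt (fun s : ℝ => T (x + s • y)) (fderiv ℝ T x y) 0 := by
    have h2 : HasDerivAt (fun s : ℝ => x + s • y) y 0 := by
      simpa using ((hasDerivAt_id (0 : ℝ)).smul_const y).const_add x
    have h3 := hT.hasFDerivAt x
    have h4 : x + (0 : ℝ) • y = x := by simp
    rw [← h4] at h3
    have := h3.comp_hasDerivAt (0 : ℝ) h2
    rwa [h4] at this
  -- The antilipschitz bound holds for every difference quotient in the direction y and passes to
  -- the limit.
  have h2 := (hasDerivAt_iff_tendsto_slope_zero.mp h1).norm.const_mul 2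
  refine ge_of_tendsto h2 ?_
  filter_upwards [self_mem_nhdsWithin] with s hs
  have h3 := hT.antilipschitz.le_mul_dist (x + s • y) x
  simp only [dist_eq_norm, add_sub_cancel_left, norm_smul, NNReal.coe_ofNat] at h3
  have hs' : 0 < ‖s‖ := norm_pos_iff.mpr hs
  rw [zero_add, zero_smul, add_zero, norm_smul, norm_inv, ← mul_assoc, mul_comm 2, mul_assoc,
    le_inv_mul_iff₀ hs']
  exact h3

/-- The Lipschitz and antilipschitz constants exchange roles, which is why both are 2. The
derivative is injective, hence invertible in finite dimension, so the inverse is C¹, and it fixes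
the same points off K. -/
theorem exists_inverse (hT : IsDeformation Ω T) :
    ∃ S, IsDeformation Ω S ∧ Function.LeftInverse S T ∧ Function.RightInverse S T := by
  let e : E d ≃ E d := Equiv.ofBijective T ⟨hT.injective, hT.surjective⟩
  have hright : Function.RightInverse e.symm T := e.apply_symm_apply
  have hanti : LipschitzWith 2 e.symm := hT.antilipschitz.to_rightInverse hright
  let h : E d ≃ₜ E d := ⟨e, hT.continuous, hanti.continuous⟩
  have hinj : ∀ x, Function.Injective (fderiv ℝ T x) := fun x => by
    rw [injective_iff_map_eq_zero]
    intro y hy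
    have := hT.antilipschitz_fderiv x y
    rw [hy, norm_zero, mul_zero] at this
    exact norm_le_zero_iff.mp this
  let f' : E d → (E d ≃L[ℝ] E d) := fun x =>
    (LinearEquiv.ofInjectiveEndo (fderiv ℝ T x : E d →ₗ[ℝ] E d) (hinj x)).toContinuousLinearEquiv
  have hf' : ∀ x, HasFDerivAt h (f' x : E d →L[ℝ] E d) x := by
    intro x
    have : (f' x : E d →L[ℝ] E d) = fderiv ℝ T x := by ext y; rfl
    rw [this]
    exact hT.hasFDerivAt x
  refine ⟨e.symm, ⟨h.contDiff_symm hf' hT.contDiff, ?_, hanti, e.symm.surjective, ?_⟩,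
    e.symm_apply_apply, hright⟩
  · refine AntilipschitzWith.of_le_mul_dist fun x y => ?_
    have := hT.lipschitz.dist_le_mul (e.symm x) (e.symm y)
    rwa [hright, hright] at this
  · obtain ⟨K, hK, hKΩ, hKT⟩ := hT.compact
    refine ⟨K, hK, hKΩ, fun x hx => ?_⟩
    rw [Equiv.symm_apply_eq]
    exact (hKT x hx).symm

/-- Perturbations of the identity by small compactly supported fields are deformations. -/
theorem of_small {h : E d → E d} (hh : ContDiff ℝ 1 h) (hc : HasCompactSupport h)
    (hs : tsupport h ⊆ Ω) (hD : ∀ x, ‖fderiv ℝ h x‖ ≤ 1 / 2) : IsDeformation Ω fun x => x + h x := by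
  have hlip : LipschitzWith (1 / 2) h := by
    refine lipschitzWith_of_nnnorm_fderiv_le (𝕜 := ℝ) (hh.differentiable (by simp)) fun x => ?_
    rw [← NNReal.coe_le_coe]
    simpa using hD x
  refine ⟨contDiff_id.add hh, ?_, ?_, ?_, tsupport h, hc, hs, fun x hx => ?_⟩
  · refine AntilipschitzWith.of_le_mul_dist fun x y => ?_
    have h1 := hlip.dist_le_mul x y
    simp only [dist_eq_norm] at h1 ⊢
    have e : x - y = (x + h x - (y + h y)) - (h x - h y) := by abel
    have h2 := norm_sub_le (x + h x - (y + h y)) (h x - h y)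
    rw [← e] at h2
    push_cast at h1 ⊢
    linarith
  · have := LipschitzWith.id.add hlip
    refine this.weaken ?_
    rw [← NNReal.coe_le_coe]
    norm_num
  · intro y
    -- Solving x + h x = y is finding a fixed point of x ↦ y - h x.
    have hcon : ContractingWith (1 / 2) fun x => y - h x := by
      refine ⟨by rw [← NNReal.coe_lt_coe]; norm_num, ?_⟩
      refine LipschitzWith.of_dist_le_mul fun a b => ?_
      rw [dist_sub_left]
      exact hlip.dist_le_mul a b
    have := hcon.fixedPoint_isFixedPt
    refine ⟨hcon.fixedPoint, ?_⟩
    have h1 : y - h hcon.fixedPoint = hcon.fixedPoint := this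
    change hcon.fixedPoint + h hcon.fixedPoint = y
    exact (sub_eq_iff_eq_add.mp h1).symm
  · rw [image_eq_zero_of_notMem_tsupport hx, add_zero]

end IsDeformation

section Composition

variable {α F : Type*} [MeasurableSpace α] {μ : Measure α} [NormedAddCommGroup F] {T : α → α}
  {c : ℝ≥0}

theorem quasiMeasurePreserving_of_map_le (hT : Measurable T) (h : μ.map T ≤ c • μ) :
    Measure.QuasiMeasurePreserving T μ μ :=
  ⟨hT, (Measure.absolutelyContinuous_of_le h).trans (Measure.smul_absolutelyContinuous)⟩

theorem eLpNorm_comp_sq_le (hT : Measurable T) (h : μ.map T ≤ c • μ) {u : α → F}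
    (hu : AEStronglyMeasurable u μ) : eLpNorm (u ∘ T) 2 μ ^ 2 ≤ c * eLpNorm u 2 μ ^ 2 := by
  have hac : μ.map T ≪ μ := (quasiMeasurePreserving_of_map_le hT h).absolutelyContinuous
  rw [← eLpNorm_map_measure (hu.mono_ac hac) hT.aemeasurable, eLpNorm_two_sq, eLpNorm_two_sq]
  refine (lintegral_mono' h le_rfl).trans_eq ?_
  rw [lintegral_smul_measure, ENNReal.smul_def, smul_eq_mul]

theorem memLp_comp (hT : Measurable T) (h : μ.map T ≤ c • μ) {u : α → F} (hu : MemLp u 2 μ) :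
    MemLp (u ∘ T) 2 μ := by
  refine ⟨hu.1.comp_quasiMeasurePreserving (quasiMeasurePreserving_of_map_le hT h), ?_⟩
  have h1 := (eLpNorm_comp_sq_le hT h hu.1).trans_lt
    (ENNReal.mul_lt_top ENNReal.coe_lt_top (ENNReal.pow_lt_top hu.2))
  exact (ENNReal.pow_lt_top_iff.mp h1).resolve_right two_ne_zero

variable [NormedSpace ℝ F]

variable (F) in
/-- Composition with `T` as an operator on `L²`. -/
def compL (hT : Measurable T) (h : μ.map T ≤ c • μ) : Lp F 2 μ →L[ℝ] Lp F 2 μ :=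
  LinearMap.mkContinuous
    { toFun := fun u => (memLp_comp hT h (Lp.memLp u)).toLp _
      map_add' := fun u v => by
        rw [← MemLp.toLp_add]
        exact MemLp.toLp_congr _ _
          ((quasiMeasurePreserving_of_map_le hT h).ae_eq_comp (Lp.coeFn_add u v))
      map_smul' := fun a u => by
        have m := memLp_comp hT h (Lp.memLp u)
        exact (MemLp.toLp_congr (memLp_comp hT h (Lp.memLp (a • u))) (m.const_smul a)
          ((quasiMeasurePreserving_of_map_le hT h).ae_eq_comp (Lp.coeFn_smul a u))).trans
          (MemLp.toLp_const_smul a m) }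
    (Real.sqrt c) fun u => by
      refine le_of_sq_le_sq ?_ (by positivity)
      rw [mul_pow, Real.sq_sqrt (NNReal.coe_nonneg c)]
      change ‖MemLp.toLp (u ∘ T) (memLp_comp hT h (Lp.memLp u))‖ ^ 2 ≤ _
      rw [Lp.norm_toLp, Lp.norm_def, ← ENNReal.toReal_pow, ← ENNReal.toReal_pow]
      have h1 := ENNReal.toReal_mono
        (ENNReal.mul_ne_top ENNReal.coe_ne_top (ENNReal.pow_ne_top (Lp.memLp u).2.ne))
        (eLpNorm_comp_sq_le hT h (Lp.memLp u).1)
      rwa [ENNReal.toReal_mul, ENNReal.coe_toReal] at h1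

theorem coeFn_compL (hT : Measurable T) (h : μ.map T ≤ c • μ) (u : Lp F 2 μ) :
    compL F hT h u =ᵐ[μ] fun x => u (T x) :=
  MemLp.coeFn_toLp (memLp_comp hT h (Lp.memLp u))

theorem norm_compL_le (hT : Measurable T) (h : μ.map T ≤ c • μ) : ‖compL F hT h‖ ≤ Real.sqrt c :=
  LinearMap.mkContinuous_norm_le _ (Real.sqrt_nonneg _) _

end Composition

end Deformation

/-! ### Pullback of H¹ functions and change of variables. -/

section Transport

open scoped ENNReal NNReal ContDiff BoundedContinuousFunction

section Multiplication

variable {W F G : Type*} [NormedAddCommGroup W] [NormedSpace ℝ W] [NormedAddCommGroup F]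
  [NormedSpace ℝ F] [NormedAddCommGroup G] [NormedSpace ℝ G]

/-- Multiplication by bounded continuous coefficients, as operators on `L²`. -/
def mulL (μ : Measure (E d)) [IsFiniteMeasure μ] (B : W →L[ℝ] F →L[ℝ] G) :
    (E d →ᵇ W) →L[ℝ] (Lp F 2 μ →L[ℝ] Lp G 2 μ) :=
  B.holderL μ ⊤ 2 2 ∘L BoundedContinuousFunction.toLp ⊤ μ ℝ

theorem coeFn_mulL (μ : Measure (E d)) [IsFiniteMeasure μ] (B : W →L[ℝ] F →L[ℝ] G)
    (A : E d →ᵇ W) (u : Lp F 2 μ) : mulL μ B A u =ᵐ[μ] fun x => B (A x) (u x) := by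
  have h1 := B.coeFn_holder (r := 2) (BoundedContinuousFunction.toLp ⊤ μ ℝ A) u
  have h2 := BoundedContinuousFunction.coeFn_toLp (p := ⊤) μ ℝ A
  filter_upwards [h1, h2] with x hx1 hx2
  rw [← hx2]
  exact hx1

/-- Multiplication by the characteristic function of `s`, as an operator on `L²`. -/
def indicatorL (μ : Measure (E d)) [IsFiniteMeasure μ] {s : Set (E d)} (hs : MeasurableSet s) :
    Lp ℝ 2 μ →L[ℝ] Lp ℝ 2 μ :=
  (ContinuousLinearMap.mul ℝ ℝ).holderL μ ⊤ 2 2 (indicatorConstLp ⊤ hs (measure_ne_top μ s) 1)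

theorem coeFn_indicatorL (μ : Measure (E d)) [IsFiniteMeasure μ] {s : Set (E d)}
    (hs : MeasurableSet s) (u : Lp ℝ 2 μ) : indicatorL μ hs u =ᵐ[μ] s.indicator u := by
  have h1 := (ContinuousLinearMap.mul ℝ ℝ).coeFn_holder (r := 2)
    (indicatorConstLp (μ := μ) ⊤ hs (measure_ne_top μ s) (1 : ℝ)) u
  filter_upwards [h1, indicatorConstLp_coeFn (μ := μ) (p := ⊤) (hs := hs)
    (hμs := measure_ne_top μ s) (c := (1 : ℝ))] with x hx1 hx2
  refine Eq.trans hx1 ?_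
  rw [hx2]
  by_cases h : x ∈ s <;> simp [h]

end Multiplication

variable {Ω : Set (E d)} {T : E d → E d}

namespace IsDeformation

/-- The adjoint of the derivative of a deformation. -/
def adjointFDeriv (hT : IsDeformation Ω T) : E d →ᵇ (E d →L[ℝ] E d) :=
  BoundedContinuousFunction.ofNormedAddCommGroup
    (fun x => ContinuousLinearMap.adjoint (fderiv ℝ T x))
    ((LinearIsometryEquiv.continuous _).comp hT.continuous_fderiv) 2 fun x => by
      rw [LinearIsometryEquiv.norm_map]
      exact hT.norm_fderiv_le x

/-- For smooth u this is the chain rule ∇(u ∘ T) = DT* (∇u ∘ T). Both components depend continuously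
on u in H¹, and H¹ is closed in L² × L², so density gives the general case. -/
theorem hasWeakGradient_comp (hΩ : IsLipschitzDomain Ω) [IsFiniteMeasure (volume.restrict Ω)]
    (hT : IsDeformation Ω T) (u : H1 Ω) :
    HasWeakGradient Ω (compL ℝ hT.measurable hT.map_le (fnL Ω u))
      (mulL (volume.restrict Ω) (ContinuousLinearMap.id ℝ (E d →L[ℝ] E d)) hT.adjointFDeriv
        (compL (E d) hT.measurable hT.map_le (gradL Ω u))) := by
  have hq := quasiMeasurePreserving_of_map_le hT.measurable hT.map_le
  refine (denseRange_smoothToH1 hΩ).induction_on (p := fun u => HasWeakGradient Ω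
      (compL ℝ hT.measurable hT.map_le (fnL Ω u))
      (mulL (volume.restrict Ω) (ContinuousLinearMap.id ℝ (E d →L[ℝ] E d)) hT.adjointFDeriv
        (compL (E d) hT.measurable hT.map_le (gradL Ω u)))) u ?_ fun φ => ?_
  · refine (isClosed_H1 Ω).preimage (f := fun u => WithLp.toLp 2
      (compL ℝ hT.measurable hT.map_le (fnL Ω u), mulL (volume.restrict Ω)
        (ContinuousLinearMap.id ℝ (E d →L[ℝ] E d)) hT.adjointFDeriv
        (compL (E d) hT.measurable hT.map_le (gradL Ω u)))) ?_
    refine (WithLp.prod_continuous_toLp 2 _ _).comp (Continuous.prodMk ?_ ?_)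
    · exact (compL ℝ hT.measurable hT.map_le).continuous.comp (fnL Ω).continuous
    · exact (ContinuousLinearMap.continuous _).comp
        ((compL (E d) hT.measurable hT.map_le).continuous.comp (gradL Ω).continuous)
  · have hφ := contDiff_one_of_smooth φ
    refine (hasWeakGradient_of_contDiff (Ω := Ω) (hφ.comp hT.contDiff)).congr ?_ ?_
    · have h1 : fn (smoothToH1 hΩ.isBounded φ) =ᵐ[volume.restrict Ω] φ :=
        MemLp.coeFn_toLp (memLp_of_continuous hΩ.isBounded hφ.continuous 2)
      filter_upwards [coeFn_compL hT.measurable hT.map_le (fnL Ω (smoothToH1 hΩ.isBounded φ)),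
        hq.ae_eq_comp h1] with x hx1 hx2
      rw [hx1]
      exact hx2
    · have h1 : grad (smoothToH1 hΩ.isBounded φ) =ᵐ[volume.restrict Ω]
          gradient (φ : E d → ℝ) :=
        MemLp.coeFn_toLp (memLp_of_continuous hΩ.isBounded (continuous_gradient hφ) 2)
      filter_upwards [coeFn_compL hT.measurable hT.map_le (gradL Ω (smoothToH1 hΩ.isBounded φ)),
        hq.ae_eq_comp h1, coeFn_mulL (volume.restrict Ω)
        (ContinuousLinearMap.id ℝ (E d →L[ℝ] E d)) hT.adjointFDeriv
        (compL (E d) hT.measurable hT.map_le (gradL Ω (smoothToH1 hΩ.isBounded φ)))]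
        with x hx1 hx2 hx3
      have hx4 : gradL Ω (smoothToH1 hΩ.isBounded φ) (T x) = gradient (φ : E d → ℝ) (T x) := hx2
      rw [hx3, hx1, hx4]
      refine ext_inner_right ℝ fun y => ?_
      change inner ℝ (ContinuousLinearMap.adjoint (fderiv ℝ T x) (gradient (φ : E d → ℝ) (T x))) y = _
      rw [ContinuousLinearMap.adjoint_inner_left, inner_gradient_left, inner_gradient_left,
        ((hφ.differentiable (by simp) (T x)).hasFDerivAt.comp x (hT.hasFDerivAt x)).fderiv]
      rfl

theorem _root_.ShapeSensitivity.fderiv_eq_id_of_eq {K : Set (E d)} (hK : IsCompact K)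
    (h : ∀ x ∉ K, T x = x) {x : E d} (hx : x ∉ K) :
    fderiv ℝ T x = ContinuousLinearMap.id ℝ (E d) := by
  have h1 : T =ᶠ[𝓝 x] id := by
    filter_upwards [hK.isClosed.isOpen_compl.mem_nhds hx] with y hy
    exact h y hy
  rw [h1.fderiv_eq, fderiv_id]

/-- The composition of an `H¹` function with a deformation. -/
theorem exists_pullback (hΩ : IsLipschitzDomain Ω) [IsFiniteMeasure (volume.restrict Ω)]
    (hT : IsDeformation Ω T) (u : H1 Ω) : ∃ U : H1 Ω,
      (fn U =ᵐ[volume.restrict Ω] fun x => fn u (T x)) ∧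
      (grad U =ᵐ[volume.restrict Ω] fun x =>
        ContinuousLinearMap.adjoint (fderiv ℝ T x) (grad u (T x))) ∧
      traceL hΩ U = traceL hΩ u := by
  let U : H1 Ω := ⟨WithLp.toLp 2 (_, _), hT.hasWeakGradient_comp hΩ u⟩
  have h1 : fn U =ᵐ[volume.restrict Ω] fun x => fn u (T x) :=
    coeFn_compL hT.measurable hT.map_le (fnL Ω u)
  have h2 : grad U =ᵐ[volume.restrict Ω] fun x =>
      ContinuousLinearMap.adjoint (fderiv ℝ T x) (grad u (T x)) := by
    filter_upwards [coeFn_compL hT.measurable hT.map_le (gradL Ω u),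
      coeFn_mulL (volume.restrict Ω) (ContinuousLinearMap.id ℝ (E d →L[ℝ] E d)) hT.adjointFDeriv
        (compL (E d) hT.measurable hT.map_le (gradL Ω u))] with x hx1 hx2
    rw [hx1] at hx2
    exact hx2
  refine ⟨U, h1, h2, ?_⟩
  obtain ⟨K, hK, hKΩ, hKT⟩ := hT.compact
  -- Off K the map T is locally the identity, so U - u and its gradient vanish there and
  -- `traceL_eq_zero` applies.
  have h3 : traceL hΩ (U - u) = 0 := by
    refine traceL_eq_zero hΩ hK hKΩ ?_ ?_
    · filter_upwards [h1, Lp.coeFn_sub (fnL Ω U) (fnL Ω u)] with x hx1 hx2 hx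
      have hx3 : fn (U - u) x = fn U x - fn u x := hx2
      rw [hx3, hx1, hKT x hx, sub_self]
    · filter_upwards [h2, Lp.coeFn_sub (gradL Ω U) (gradL Ω u)] with x hx1 hx2 hx
      have hx3 : grad (U - u) x = grad U x - grad u x := hx2
      rw [hx3, hx1, hKT x hx, fderiv_eq_id_of_eq hK hKT hx]
      change ContinuousLinearMap.adjoint 1 (grad u x) - _ = 0
      rw [← ContinuousLinearMap.star_eq_adjoint, star_one]
      exact sub_self _
  rw [map_sub] at h3
  exact sub_eq_zero.mp h3

/-- Pullback by the inverse deformation. Every v in H¹(Ω) is thus a pullback, so the transported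
equation is tested against the whole space. -/
theorem exists_pushforward (hΩ : IsLipschitzDomain Ω) [IsFiniteMeasure (volume.restrict Ω)]
    (hT : IsDeformation Ω T) (v : H1 Ω) : ∃ w : H1 Ω,
      (fn v =ᵐ[volume.restrict Ω] fun x => fn w (T x)) ∧
      (grad v =ᵐ[volume.restrict Ω] fun x =>
        ContinuousLinearMap.adjoint (fderiv ℝ T x) (grad w (T x))) ∧
      traceL hΩ w = traceL hΩ v := by
  obtain ⟨S, hS, hST, hTS⟩ := hT.exists_inverse
  obtain ⟨w, h1, h2, h3⟩ := hS.exists_pullback hΩ v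
  have hq := quasiMeasurePreserving_of_map_le hT.measurable hT.map_le
  refine ⟨w, ?_, ?_, h3⟩
  · filter_upwards [hq.ae_eq_comp h1] with x hx
    have hx' : fn w (T x) = fn v (S (T x)) := hx
    rw [hx', hST]
  · filter_upwards [hq.ae_eq_comp h2] with x hx
    have hx' : grad w (T x) = ContinuousLinearMap.adjoint (fderiv ℝ S (T x)) (grad v (S (T x))) := hx
    have h4 : fderiv ℝ S (T x) ∘L fderiv ℝ T x = ContinuousLinearMap.id ℝ (E d) := by
      have h5 := ((hS.hasFDerivAt (T x)).comp x (hT.hasFDerivAt x)).fderiv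
      rw [← h5, hST.comp_eq_id, fderiv_id]
    rw [hx', hST, ← ContinuousLinearMap.comp_apply, ← ContinuousLinearMap.adjoint_comp, h4]
    change _ = ContinuousLinearMap.adjoint 1 (grad v x)
    rw [← ContinuousLinearMap.star_eq_adjoint, star_one]
    rfl

theorem setIntegral_image (hT : IsDeformation Ω T) {s : Set (E d)} (hs : MeasurableSet s)
    (g : E d → ℝ) :
    ∫ x in T '' s, g x = ∫ x in s, |(fderiv ℝ T x).det| * g (T x) :=
  integral_image_eq_integral_abs_det_fderiv_smul volume hs
    (fun x _ => (hT.hasFDerivAt x).hasFDerivWithinAt) hT.injective.injOn g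

theorem setIntegral_comp (hΩ : IsOpen Ω) (hT : IsDeformation Ω T) (g : E d → ℝ) :
    ∫ x in Ω, g x = ∫ x in Ω, |(fderiv ℝ T x).det| * g (T x) := by
  rw [← hT.setIntegral_image hΩ.measurableSet, hT.image_eq]

theorem measurableSet_image (hT : IsDeformation Ω T) {s : Set (E d)} (hs : MeasurableSet s) :
    MeasurableSet (T '' s) :=
  hs.image_of_continuousOn_injOn hT.continuous.continuousOn hT.injective.injOn

end IsDeformation

end Transport

/-! ### Continuity and differentiability of v ↦ v ∘ T_t at t = 0. -/

section Limits

open scoped ENNReal NNReal ContDiff BoundedContinuousFunction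

variable {Ω : Set (E d)}

open Classical in
variable (Ω) in
/-- Composition with a deformation `T` of `Ω`, as an operator on `L²(Ω)`. -/
def compOp (T : E d → E d) : Lp ℝ 2 (volume.restrict Ω) →L[ℝ] Lp ℝ 2 (volume.restrict Ω) :=
  if hT : IsDeformation Ω T then compL ℝ hT.measurable hT.map_le else 0

theorem coeFn_compOp {T : E d → E d} (hT : IsDeformation Ω T) (u : Lp ℝ 2 (volume.restrict Ω)) :
    compOp Ω T u =ᵐ[volume.restrict Ω] fun x => u (T x) := by
  rw [compOp, dif_pos hT]
  exact coeFn_compL hT.measurable hT.map_le u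

/-- The default value 0 makes this bound hold for every T, without asking it to be a deformation. -/
theorem norm_compOp_le (T : E d → E d) : ‖compOp Ω T‖ ≤ Real.sqrt (2 ^ d) := by
  rw [compOp]
  split_ifs with hT
  · simpa using norm_compL_le (F := ℝ) hT.measurable hT.map_le
  · rw [norm_zero]
    positivity

/-- φ(x + h x) - φ(x) is the integral of ∇φ(x + s h x) · h x over 0 ≤ s ≤ 1. Jensen, Tonelli and the
2^d bound at each s conclude, which is why every intermediate map must be a deformation. -/
theorem eLpNorm_comp_sub_sq_le {h : E d → E d} (hh : Continuous h)
    (hT : ∀ s ∈ Icc (0 : ℝ) 1, IsDeformation Ω fun x => x + s • h x) {M : ℝ≥0}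
    (hM : ∀ x, ‖h x‖ ≤ M) {φ : E d → ℝ} (hφ : ContDiff ℝ 1 φ) :
    eLpNorm (fun x => φ (x + h x) - φ x) 2 (volume.restrict Ω) ^ 2 ≤
      (M : ℝ≥0∞) ^ 2 * (2 ^ d * eLpNorm (gradient φ) 2 (volume.restrict Ω) ^ 2) := by
  have hg := continuous_gradient hφ
  have hd : ∀ x, HasFDerivAt φ (fderiv ℝ φ x) x := fun x =>
    (hφ.differentiable (by simp) x).hasFDerivAt
  have : IsProbabilityMeasure (volume.restrict (Ioc (0 : ℝ) 1)) := ⟨by simp⟩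
  have h1 : ∀ x, ‖φ (x + h x) - φ x‖ₑ ≤
      ∫⁻ s in Ioc (0 : ℝ) 1, M * ‖gradient φ (x + s • h x)‖ₑ := by
    intro x
    have e1 : ∀ s : ℝ, HasDerivAt (fun s : ℝ => φ (x + s • h x))
        (inner ℝ (gradient φ (x + s • h x)) (h x)) s := fun s => by
      have := (hd (x + s • h x)).comp_hasDerivAt s
        (((hasDerivAt_id s).smul_const (h x)).const_add x)
      rw [inner_gradient_left]
      rw [one_smul] at this
      exact this
    have e2 : Continuous fun s : ℝ => (inner ℝ (gradient φ (x + s • h x)) (h x) : ℝ) :=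
      (hg.comp (by fun_prop)).inner continuous_const
    have e3 := intervalIntegral.integral_eq_sub_of_hasDerivAt (fun s _ => e1 s)
      (e2.intervalIntegrable 0 1)
    rw [zero_smul, one_smul, add_zero] at e3
    rw [← e3, intervalIntegral.integral_of_le zero_le_one]
    refine (enorm_integral_le_lintegral_enorm _).trans (lintegral_mono fun s => ?_)
    refine (enorm_le_iff_norm_le.mpr (?_ : _ ≤ ‖(M : ℝ) * ‖gradient φ (x + s • h x)‖‖)).trans_eq ?_
    · rw [norm_mul, norm_norm, mul_comm, Real.norm_of_nonneg (NNReal.coe_nonneg M)]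
      exact (norm_inner_le_norm _ _).trans (mul_le_mul_of_nonneg_left (hM x) (norm_nonneg _))
    · rw [enorm_mul, enorm_norm, ← ofReal_norm, Real.norm_of_nonneg (NNReal.coe_nonneg M), ENNReal.ofReal_coe_nnreal]
  have hjoint : Continuous fun p : E d × ℝ => ‖gradient φ (p.1 + p.2 • h p.1)‖ₑ ^ 2 := by
    have : Continuous fun p : E d × ℝ => gradient φ (p.1 + p.2 • h p.1) := hg.comp (by fun_prop)
    exact (ENNReal.continuous_pow 2).comp this.enorm
  rw [eLpNorm_two_sq]
  calc ∫⁻ x in Ω, ‖φ (x + h x) - φ x‖ₑ ^ 2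
      ≤ ∫⁻ x in Ω, ∫⁻ s in Ioc (0 : ℝ) 1, (M : ℝ≥0∞) ^ 2 * ‖gradient φ (x + s • h x)‖ₑ ^ 2 := by
        refine lintegral_mono fun x => (pow_le_pow_left' (h1 x) 2).trans ?_
        refine (sq_lintegral_le ?_).trans_eq (lintegral_congr fun s => mul_pow _ _ _)
        have : Continuous fun s : ℝ => gradient φ (x + s • h x) := hg.comp (by fun_prop)
        exact (this.enorm.measurable.const_mul _).aemeasurable
    _ = ∫⁻ s in Ioc (0 : ℝ) 1, (∫⁻ x in Ω, (M : ℝ≥0∞) ^ 2 * ‖gradient φ (x + s • h x)‖ₑ ^ 2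
          ∂volume) ∂volume :=
        lintegral_lintegral_swap (hjoint.measurable.const_mul _).aemeasurable
    _ ≤ ∫⁻ s in Ioc (0 : ℝ) 1, (M : ℝ≥0∞) ^ 2 *
          (2 ^ d * eLpNorm (gradient φ) 2 (volume.restrict Ω) ^ 2) ∂volume := by
        refine setLIntegral_mono' measurableSet_Ioc fun s hs => ?_
        rw [lintegral_const_mul' _ _ (by simp)]
        refine mul_le_mul_right ?_ _
        have hs' := hT s ⟨hs.1.le, hs.2⟩
        have := eLpNorm_comp_sq_le (u := gradient φ) hs'.measurable hs'.map_le
          hg.aestronglyMeasurable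
        rw [eLpNorm_two_sq] at this
        simpa using this
    _ = _ := by simp

/-- The smooth estimate extends by density. It bounds the difference quotients of v ∘ T_t in L² by
the H¹ norm of v, uniformly in t. -/
theorem norm_comp_sub_le (hΩ : IsLipschitzDomain Ω) {h : E d → E d} (hh : Continuous h)
    (hT : ∀ s ∈ Icc (0 : ℝ) 1, IsDeformation Ω fun x => x + s • h x) {M : ℝ≥0}
    (hM : ∀ x, ‖h x‖ ≤ M) (u : H1 Ω) :
    ‖compOp Ω (fun x => x + h x) (fnL Ω u) - fnL Ω u‖ ≤ M * Real.sqrt (2 ^ d) * ‖u‖ := by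
  have hT1 : IsDeformation Ω fun x => x + h x := by simpa using hT 1 (by simp)
  have hq := quasiMeasurePreserving_of_map_le hT1.measurable hT1.map_le
  refine (denseRange_smoothToH1 hΩ).induction_on (p := fun u =>
    ‖compOp Ω (fun x => x + h x) (fnL Ω u) - fnL Ω u‖ ≤ M * Real.sqrt (2 ^ d) * ‖u‖) u ?_ fun φ => ?_
  · refine isClosed_le ?_ ?_
    · exact (((compOp Ω fun x => x + h x).continuous.comp (fnL Ω).continuous).sub
        (fnL Ω).continuous).norm
    · exact continuous_const.mul continuous_norm
  · have hφ := contDiff_one_of_smooth φ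
    have h1 : fn (smoothToH1 hΩ.isBounded φ) =ᵐ[volume.restrict Ω] φ :=
      MemLp.coeFn_toLp (memLp_of_continuous hΩ.isBounded hφ.continuous 2)
    have m2 := memLp_of_continuous hΩ.isBounded (continuous_gradient hφ) 2
    have h2 : ‖gradL Ω (smoothToH1 hΩ.isBounded φ)‖ =
      (eLpNorm (gradient (φ : E d → ℝ)) 2 (volume.restrict Ω)).toReal := Lp.norm_toLp _ m2
    refine le_trans ?_ (mul_le_mul_of_nonneg_left (norm_gradL_le (smoothToH1 hΩ.isBounded φ))
      (by positivity))
    rw [h2]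
    have h3 : ‖compOp Ω (fun x => x + h x) (fnL Ω (smoothToH1 hΩ.isBounded φ)) -
        fnL Ω (smoothToH1 hΩ.isBounded φ)‖ =
        (eLpNorm (fun x => (φ : E d → ℝ) (x + h x) - (φ : E d → ℝ) x) 2
          (volume.restrict Ω)).toReal := by
      rw [Lp.norm_def]
      congr 1
      refine eLpNorm_congr_ae ?_
      filter_upwards [Lp.coeFn_sub (compOp Ω (fun x => x + h x)
        (fnL Ω (smoothToH1 hΩ.isBounded φ))) (fnL Ω (smoothToH1 hΩ.isBounded φ)),
        coeFn_compOp hT1 (fnL Ω (smoothToH1 hΩ.isBounded φ)), hq.ae_eq_comp h1, h1]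
        with x hx1 hx2 hx3 hx4
      rw [hx1, Pi.sub_apply, hx2]
      exact congrArg₂ _ hx3 hx4
    rw [h3]
    refine le_of_sq_le_sq ?_ (by positivity)
    rw [mul_pow, mul_pow, Real.sq_sqrt (by positivity)]
    have h4 := ENNReal.toReal_mono ?_ (eLpNorm_comp_sub_sq_le hh hT hM hφ)
    · simpa only [ENNReal.toReal_mul, ← mul_assoc, ENNReal.toReal_pow, ENNReal.coe_toReal,
        ENNReal.toReal_ofNat] using h4
    · exact ENNReal.mul_ne_top (by simp) (ENNReal.mul_ne_top (by simp) (ENNReal.pow_ne_top m2.2.ne))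

/-- Dominated convergence in `L²` of a bounded set. -/
theorem tendsto_eLpNorm_of_dominated {F : Type*} [NormedAddCommGroup F]
    [IsFiniteMeasure (volume.restrict Ω)] (hΩ : MeasurableSet Ω) {l : Filter ℝ}
    [l.IsCountablyGenerated] {f : ℝ → E d → F} {C : ℝ}
    (hf : ∀ᶠ t in l, Continuous (f t))
    (hC : ∀ᶠ t in l, ∀ x ∈ Ω, ‖f t x‖ ≤ C) (h : ∀ x ∈ Ω, Tendsto (fun t => f t x) l (𝓝 0)) :
    Tendsto (fun t => eLpNorm (f t) 2 (volume.restrict Ω)) l (𝓝 0) := by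
  have h1 : Tendsto (fun t => ∫⁻ x in Ω, ‖f t x‖ₑ ^ 2) l (𝓝 (∫⁻ x in Ω, 0)) := by
    refine tendsto_lintegral_filter_of_dominated_convergence (fun _ => ENNReal.ofReal C ^ 2)
      ?_ ?_ ?_ ?_
    · filter_upwards [hf] with t ht
      exact ((ENNReal.continuous_pow 2).comp ht.enorm).measurable
    · filter_upwards [hC] with t ht
      filter_upwards [ae_restrict_mem hΩ] with x hx
      refine pow_le_pow_left' ?_ 2
      rw [← ofReal_norm]
      exact ENNReal.ofReal_le_ofReal (ht x hx)
    · rw [lintegral_const]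
      exact ENNReal.mul_ne_top (by simp) (measure_ne_top _ _)
    · filter_upwards [ae_restrict_mem hΩ] with x hx
      have := ((ENNReal.continuous_pow 2).tendsto _).comp (h x hx).enorm
      rw [enorm_zero, zero_pow two_ne_zero] at this
      exact this
  simp only [← eLpNorm_two_sq, lintegral_zero] at h1
  have h2 := (ENNReal.continuous_rpow_const (y := 1 / 2)).tendsto _ |>.comp h1
  refine (h2.congr fun t => ?_).trans (by simp)
  rw [Function.comp_apply, ← ENNReal.rpow_natCast, ← ENNReal.rpow_mul]
  norm_num

/-- The composition operators are uniformly bounded, so only bounded continuous functions need be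
considered, and there dominated convergence applies. -/
theorem tendsto_compOp [IsFiniteMeasure (volume.restrict Ω)] (hΩ : MeasurableSet Ω)
    {V : ℝ → E d →ᵇ E d} {V₀ : E d →ᵇ E d} (hV : Tendsto V (𝓝[>] 0) (𝓝 V₀))
    (hT : ∀ᶠ t in 𝓝[>] (0 : ℝ), IsDeformation Ω fun x => x + t • V t x)
    (u : Lp ℝ 2 (volume.restrict Ω)) :
    Tendsto (fun t => compOp Ω (fun x => x + t • V t x) u) (𝓝[>] 0) (𝓝 u) := by
  have hd : DenseRange (BoundedContinuousFunction.toLp (E := ℝ) 2 (volume.restrict Ω) ℝ) :=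
    BoundedContinuousFunction.toLp_denseRange ℝ (volume.restrict Ω) ℝ (by simp)
  refine tendsto_apply_of_denseRange (L := fun t => compOp Ω (fun x => x + t • V t x))
    (L₀ := ContinuousLinearMap.id ℝ _) (Eventually.of_forall fun t => norm_compOp_le _) hd
    (fun g => ?_) u
  have hg := BoundedContinuousFunction.coeFn_toLp (p := 2) (volume.restrict Ω) ℝ g
  rw [Lp.tendsto_Lp_iff_tendsto_eLpNorm']
  have h1 : Tendsto (fun t => eLpNorm (fun x => g (x + t • V t x) - g x) 2 (volume.restrict Ω))
      (𝓝[>] 0) (𝓝 0) := by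
    refine tendsto_eLpNorm_of_dominated hΩ (C := ‖g‖ + ‖g‖) ?_ ?_ ?_
    · exact Eventually.of_forall fun t => by fun_prop
    · exact Eventually.of_forall fun t x _ =>
        (norm_sub_le _ _).trans (add_le_add (g.norm_coe_le_norm _) (g.norm_coe_le_norm _))
    · intro x _
      have e1 : Tendsto (fun t : ℝ => x + t • V t x) (𝓝[>] 0) (𝓝 (x + (0 : ℝ) • V₀ x)) :=
        tendsto_const_nhds.add ((tendsto_id.mono_left nhdsWithin_le_nhds).smul
          (((BoundedContinuousFunction.evalCLM ℝ x).continuous.tendsto V₀).comp hV))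
      rw [zero_smul, add_zero] at e1
      simpa using ((g.continuous.tendsto x).comp e1).sub_const (g x)
  refine h1.congr' ?_
  filter_upwards [hT] with t ht
  refine eLpNorm_congr_ae ?_
  filter_upwards [coeFn_compOp ht (BoundedContinuousFunction.toLp 2 (volume.restrict Ω) ℝ g), hg,
    (quasiMeasurePreserving_of_map_le ht.measurable ht.map_le).ae_eq_comp hg] with x h1 h2 h3
  rw [Pi.sub_apply, h1]
  exact (congrArg₂ _ h3 h2).symm

theorem tendsto_slope_comp {φ : E d → ℝ} (hφ : ContDiff ℝ 1 φ) {V : ℝ → E d →ᵇ E d}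
    {V₀ : E d →ᵇ E d} (hV : Tendsto V (𝓝[>] 0) (𝓝 V₀)) (x : E d) :
    Tendsto (fun t : ℝ => t⁻¹ * (φ (x + t • V t x) - φ x)) (𝓝[>] 0)
      (𝓝 (inner ℝ (V₀ x) (gradient φ x))) := by
  have e0 := ((BoundedContinuousFunction.evalCLM ℝ x).continuous.tendsto V₀).comp hV
  -- V is known only through its right limit V₀. The value V 0 is irrelevant because it is
  -- multiplied by zero.
  have e1 : HasDerivWithinAt (fun t : ℝ => x + t • V t x) (V₀ x) (Ioi 0) 0 := by
    rw [hasDerivWithinAt_iff_tendsto_slope, sdiff_singleton_eq_self self_notMem_Ioi]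
    refine e0.congr' ?_
    filter_upwards [self_mem_nhdsWithin] with t ht
    rw [slope_def_module, sub_zero, zero_smul, add_zero, add_sub_cancel_left, smul_smul,
      inv_mul_cancel₀ (ne_of_gt ht), one_smul]
    rfl
  have e2 : HasFDerivAt φ (fderiv ℝ φ x) (x + (0 : ℝ) • V 0 x) := by
    rw [zero_smul, add_zero]
    exact (hφ.differentiable (by simp) x).hasFDerivAt
  have e3 := e2.comp_hasDerivWithinAt (0 : ℝ) e1
  rw [hasDerivWithinAt_iff_tendsto_slope, sdiff_singleton_eq_self self_notMem_Ioi] at e3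
  rw [real_inner_comm, inner_gradient_left]
  refine e3.congr fun t => ?_
  rw [slope_def_module, sub_zero, smul_eq_mul, Function.comp_apply, Function.comp_apply, zero_smul,
    add_zero]

theorem tendsto_eLpNorm_slope_comp [IsFiniteMeasure (volume.restrict Ω)] (hΩ : MeasurableSet Ω)
    (hb : Bornology.IsBounded Ω) {φ : E d → ℝ} (hφ : ContDiff ℝ 1 φ) {V : ℝ → E d →ᵇ E d}
    {V₀ : E d →ᵇ E d} (hV : Tendsto V (𝓝[>] 0) (𝓝 V₀)) :
    Tendsto (fun t : ℝ => eLpNorm (fun x => t⁻¹ * (φ (x + t • V t x) - φ x) -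
      inner ℝ (V₀ x) (gradient φ x)) 2 (volume.restrict Ω)) (𝓝[>] 0) (𝓝 0) := by
  have hg := continuous_gradient hφ
  obtain ⟨R, hR⟩ := hb.subset_closedBall (0 : E d)
  have hV1 : ∀ᶠ t in 𝓝[>] (0 : ℝ), ‖V t‖ ≤ ‖V₀‖ + 1 :=
    (hV.norm.eventually (gt_mem_nhds (lt_add_one ‖V₀‖))).mono fun t ht => ht.le
  obtain ⟨C, hC⟩ := (isCompact_closedBall (0 : E d) (R + (‖V₀‖ + 1))).exists_bound_of_continuousOn
    (hφ.continuous_fderiv (by simp)).continuousOn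
  have hlip : ∀ x ∈ Metric.closedBall (0 : E d) (R + (‖V₀‖ + 1)),
      ∀ y ∈ Metric.closedBall (0 : E d) (R + (‖V₀‖ + 1)), ‖φ y - φ x‖ ≤ C * ‖y - x‖ := fun x hx y hy =>
    (convex_closedBall _ _).norm_image_sub_le_of_norm_fderiv_le
      (fun z _ => hφ.differentiable (by simp) z) hC hx hy
  refine tendsto_eLpNorm_of_dominated hΩ (C := C * (‖V₀‖ + 1) + ‖V₀‖ * C) ?_ ?_ ?_
  · exact Eventually.of_forall fun t => by fun_prop
  · filter_upwards [hV1, Ioo_mem_nhdsGT (zero_lt_one' ℝ)] with t ht1 ht x hx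
    have hx' : x ∈ Metric.closedBall (0 : E d) R := hR hx
    rw [mem_closedBall_zero_iff] at hx'
    have hVt : ‖V t x‖ ≤ ‖V₀‖ + 1 := ((V t).norm_coe_le_norm x).trans ht1
    have h1 : x ∈ Metric.closedBall (0 : E d) (R + (‖V₀‖ + 1)) := by
      rw [mem_closedBall_zero_iff]
      linarith [norm_nonneg V₀]
    have h2 : x + t • V t x ∈ Metric.closedBall (0 : E d) (R + (‖V₀‖ + 1)) := by
      rw [mem_closedBall_zero_iff]
      refine (norm_add_le _ _).trans (add_le_add hx' ?_)
      rw [norm_smul, Real.norm_of_nonneg ht.1.le]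
      nlinarith [norm_nonneg (V t x), ht.2, ht.1]
    have hC0 : 0 ≤ C := (norm_nonneg _).trans (hC x h1)
    refine (norm_sub_le _ _).trans (add_le_add ?_ ?_)
    · rw [norm_mul, norm_inv, Real.norm_of_nonneg ht.1.le, inv_mul_le_iff₀ ht.1]
      refine (hlip _ h1 _ h2).trans ?_
      rw [add_sub_cancel_left, norm_smul, Real.norm_of_nonneg ht.1.le]
      calc C * (t * ‖V t x‖) = t * (C * ‖V t x‖) := by ring
        _ ≤ _ := by gcongr; exact ht.1.le
    · refine (norm_inner_le_norm _ _).trans ?_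
      refine mul_le_mul (V₀.norm_coe_le_norm x) ?_ (norm_nonneg _) (norm_nonneg _)
      rw [gradient, LinearIsometryEquiv.norm_map]
      exact hC x h1
  · intro x _
    simpa using (tendsto_slope_comp hφ hV x).sub_const (inner ℝ (V₀ x) (gradient φ x))

theorem eLpNorm_smul_sub_sub {α : Type*} [MeasurableSpace α] {μ : Measure α} {a b g : Lp ℝ 2 μ}
    {a' b' g' : α → ℝ} (ha : a =ᵐ[μ] a') (hb : b =ᵐ[μ] b') (hg : g =ᵐ[μ] g') (c : ℝ) :
    eLpNorm (⇑(c • (a - b)) - ⇑g) 2 μ = eLpNorm (fun x => c * (a' x - b' x) - g' x) 2 μ := by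
  refine eLpNorm_congr_ae ?_
  filter_upwards [ha, hb, hg, Lp.coeFn_smul c (a - b), Lp.coeFn_sub a b] with x h1 h2 h3 h4 h5
  rw [Pi.sub_apply, h4, Pi.smul_apply, h5, Pi.sub_apply, h1, h2, h3, smul_eq_mul]

/-- The quotients are bounded from H¹ to L² uniformly in t by `norm_comp_sub_le`, and for smooth
functions they converge by dominated convergence. Convergence in L² is strong, though only for v in
H¹. -/
theorem tendsto_slope_compOp [IsFiniteMeasure (volume.restrict Ω)] (hΩ : IsLipschitzDomain Ω)
    {V : ℝ → E d →ᵇ E d} {V₀ : E d →ᵇ E d} (hV : Tendsto V (𝓝[>] 0) (𝓝 V₀))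
    (hT : ∀ᶠ t in 𝓝[>] (0 : ℝ), ∀ s ∈ Icc (0 : ℝ) 1, IsDeformation Ω fun x => x + s • t • V t x)
    (u : H1 Ω) :
    Tendsto (fun t => t⁻¹ • (compOp Ω (fun x => x + t • V t x) (fnL Ω u) - fnL Ω u)) (𝓝[>] 0)
      (𝓝 (mulL (volume.restrict Ω) (innerSL ℝ) V₀ (gradL Ω u))) := by
  have hT1 : ∀ᶠ t in 𝓝[>] (0 : ℝ), IsDeformation Ω fun x => x + t • V t x := by
    filter_upwards [hT] with t ht
    simpa using ht 1 (by simp)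
  have hV1 : ∀ᶠ t in 𝓝[>] (0 : ℝ), ‖V t‖ ≤ ‖V₀‖ + 1 :=
    (hV.norm.eventually (gt_mem_nhds (lt_add_one ‖V₀‖))).mono fun t ht => ht.le
  refine tendsto_apply_of_denseRange (C := (‖V₀‖ + 1) * Real.sqrt (2 ^ d))
    (L := fun t => t⁻¹ • (compOp Ω (fun x => x + t • V t x) ∘L fnL Ω - fnL Ω))
    (L₀ := mulL (volume.restrict Ω) (innerSL ℝ) V₀ ∘L gradL Ω) ?_
    (denseRange_smoothToH1 hΩ) (fun φ => ?_) u
  · filter_upwards [hV1, hT, self_mem_nhdsWithin] with t ht1 ht2 (ht : 0 < t)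
    refine ContinuousLinearMap.opNorm_le_bound _ (by positivity) fun v => ?_
    have h1 := norm_comp_sub_le hΩ (h := fun x => t • V t x) (by fun_prop) ht2
      (M := ⟨t * (‖V₀‖ + 1), by positivity⟩) (fun x => by
        rw [norm_smul, Real.norm_of_nonneg ht.le]
        exact mul_le_mul_of_nonneg_left (((V t).norm_coe_le_norm x).trans ht1) ht.le) v
    change ‖t⁻¹ • (compOp Ω (fun x => x + t • V t x) (fnL Ω v) - fnL Ω v)‖ ≤ _
    rw [norm_smul, norm_inv, Real.norm_of_nonneg ht.le, inv_mul_le_iff₀ ht]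
    refine h1.trans_eq ?_
    change t * (‖V₀‖ + 1) * Real.sqrt (2 ^ d) * ‖v‖ = _
    ring
  · have hφ := contDiff_one_of_smooth φ
    have h1 : fn (smoothToH1 hΩ.isBounded φ) =ᵐ[volume.restrict Ω] φ :=
      MemLp.coeFn_toLp (memLp_of_continuous hΩ.isBounded hφ.continuous 2)
    have h2 : grad (smoothToH1 hΩ.isBounded φ) =ᵐ[volume.restrict Ω] gradient (φ : E d → ℝ) :=
      MemLp.coeFn_toLp (memLp_of_continuous hΩ.isBounded (continuous_gradient hφ) 2)
    rw [Lp.tendsto_Lp_iff_tendsto_eLpNorm']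
    refine (tendsto_eLpNorm_slope_comp hΩ.isOpen.measurableSet hΩ.isBounded hφ hV).congr' ?_
    filter_upwards [hT1] with t ht
    refine (eLpNorm_smul_sub_sub ?_ h1 ?_ t⁻¹).symm
    · exact (coeFn_compOp ht (fnL Ω (smoothToH1 hΩ.isBounded φ))).trans
        ((quasiMeasurePreserving_of_map_le ht.measurable ht.map_le).ae_eq_comp h1)
    · filter_upwards [h2, coeFn_mulL (volume.restrict Ω) (innerSL ℝ) V₀
        (gradL Ω (smoothToH1 hΩ.isBounded φ))] with x e1 e2
      exact e2.trans (congrArg (inner ℝ (V₀ x)) e1)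

end Limits

/-! ### Differentiability of the transported coefficients. -/

section Coefficients

open scoped ENNReal NNReal ContDiff BoundedContinuousFunction

/-- Differentiability of superposition operators on bounded continuous functions. -/
theorem exists_tendsto_superposition {α X Y : Type*} [TopologicalSpace α] [NormedAddCommGroup X]
    [NormedSpace ℝ X] [NormedAddCommGroup Y] [NormedSpace ℝ Y] {Φ : X → Y} {p : X}
    (hΦ : DifferentiableAt ℝ Φ p) (hc : ∀ᶠ q in 𝓝 p, ContinuousAt Φ q) {L : ℝ → α →ᵇ X}
    {L₀ : α →ᵇ X} (hL : Tendsto L (𝓝[>] 0) (𝓝 L₀)) :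
    ∃ (A : ℝ → α →ᵇ Y) (A' : α →ᵇ Y), (∀ᶠ t in 𝓝[>] (0 : ℝ), ∀ x, A t x = Φ (p + t • L t x)) ∧
      Tendsto (fun t => t⁻¹ • (A t - BoundedContinuousFunction.const α (Φ p))) (𝓝[>] 0) (𝓝 A') := by
  classical
  obtain ⟨Φ', hΦ'⟩ := hΦ
  -- All increments start from the same point p, so the Fréchet remainder is controlled by their
  -- size alone, hence uniformly in the space variable.
  have hsmall : ∀ c > 0, ∃ δ > 0, ∀ h : X, ‖h‖ < δ → ‖Φ (p + h) - Φ p - Φ' h‖ ≤ c * ‖h‖ := by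
    intro c hc0
    have h1 := (hasFDerivAt_iff_isLittleO_nhds_zero.mp hΦ').def hc0
    obtain ⟨δ, hδ, h⟩ := Metric.eventually_nhds_iff.mp h1
    exact ⟨δ, hδ, fun x hx => h (by rwa [dist_zero_right])⟩
  obtain ⟨ρ, hρ, hcont⟩ := Metric.eventually_nhds_iff.mp hc
  have hL1 : ∀ᶠ t in 𝓝[>] (0 : ℝ), ‖L t‖ ≤ ‖L₀‖ + 1 :=
    (hL.norm.eventually (gt_mem_nhds (lt_add_one ‖L₀‖))).mono fun t ht => ht.le
  have hsm : ∀ δ > 0, ∀ᶠ t in 𝓝[>] (0 : ℝ), 0 < t ∧ ‖L t‖ ≤ ‖L₀‖ + 1 ∧ ∀ x, ‖t • L t x‖ < δ := by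
    intro δ hδ
    filter_upwards [hL1, Ioo_mem_nhdsGT (show 0 < δ / (‖L₀‖ + 1) by positivity)] with t h1 h2
    refine ⟨h2.1, h1, fun x => ?_⟩
    rw [norm_smul, Real.norm_of_nonneg h2.1.le]
    have h3 := ((L t).norm_coe_le_norm x).trans h1
    have h4 := (lt_div_iff₀ (show 0 < ‖L₀‖ + 1 by positivity)).mp h2.2
    exact (mul_le_mul_of_nonneg_left h3 h2.1.le).trans_lt h4
  -- The superposition is a bounded continuous function only for small t > 0 in general; where it
  -- fails to be one, A takes the value 0.
  let P : ℝ → Prop := fun t => Continuous (fun x => Φ (p + t • L t x)) ∧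
    ∃ C, ∀ x, ‖Φ (p + t • L t x)‖ ≤ C
  let A : ℝ → α →ᵇ Y := fun t => if h : P t then
    BoundedContinuousFunction.ofNormedAddCommGroup _ h.1 h.2.choose h.2.choose_spec else 0
  have hP : ∀ᶠ t in 𝓝[>] (0 : ℝ), P t := by
    obtain ⟨δ, hδ, h⟩ := hsmall 1 one_pos
    filter_upwards [hsm δ hδ, hsm ρ hρ] with t h1 h2
    refine ⟨continuous_iff_continuousAt.mpr fun x => ?_,
      1 * δ + ‖Φ'‖ * δ + ‖Φ p‖, fun x => ?_⟩
    · refine ContinuousAt.comp (f := fun x => p + t • L t x) (hcont ?_) ?_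
      · rw [dist_eq_norm, add_sub_cancel_left]
        exact h2.2.2 x
      · exact (continuous_const.add ((L t).continuous.const_smul t)).continuousAt
    · have e : Φ (p + t • L t x) = (Φ (p + t • L t x) - Φ p - Φ' (t • L t x)) + Φ' (t • L t x) +
        Φ p := by abel
      rw [e]
      refine (norm_add_le _ _).trans (add_le_add_left ((norm_add_le _ _).trans (add_le_add ?_ ?_)) _)
      · exact (h _ (h1.2.2 x)).trans (mul_le_mul_of_nonneg_left (h1.2.2 x).le zero_le_one)
      · exact (Φ'.le_opNorm _).trans (mul_le_mul_of_nonneg_left (h1.2.2 x).le (norm_nonneg _))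
  have hA : ∀ᶠ t in 𝓝[>] (0 : ℝ), ∀ x, A t x = Φ (p + t • L t x) := by
    filter_upwards [hP] with t ht x
    simp only [A]
    rw [dif_pos ht]
    rfl
  refine ⟨A, Φ'.compLeftContinuousBounded α L₀, hA, ?_⟩
  rw [tendsto_iff_norm_sub_tendsto_zero]
  have hL2 := (tendsto_iff_norm_sub_tendsto_zero.mp hL).const_mul ‖Φ'‖
  rw [mul_zero] at hL2
  rw [Metric.tendsto_nhds]
  intro ε hε
  -- Since ‖L t‖ ≤ ‖L₀‖ + 1, the remainder divided by t is at most ε / 2. The linear error costs ε /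
  -- 3, leaving a strict inequality.
  obtain ⟨δ, hδ, h⟩ := hsmall (ε / 2 / (‖L₀‖ + 1)) (by positivity)
  filter_upwards [hsm δ hδ, hA, hL2.eventually (gt_mem_nhds (show 0 < ε / 3 by positivity))]
    with t h1 h2 h3
  rw [dist_zero_right, norm_norm]
  have ht : 0 < t := h1.1
  refine lt_of_le_of_lt ((BoundedContinuousFunction.norm_le (C := ε / 2 + ε / 3)
    (by positivity)).mpr fun x => ?_) (by linarith)
  have e : (t⁻¹ • (A t - BoundedContinuousFunction.const α (Φ p)) -
      Φ'.compLeftContinuousBounded α L₀) x =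
      t⁻¹ • (Φ (p + t • L t x) - Φ p - Φ' (t • L t x)) + Φ' (L t x - L₀ x) := by
    change t⁻¹ • (A t x - Φ p) - Φ' (L₀ x) = _
    rw [h2, smul_sub t⁻¹ _ (Φ' _), map_smul, smul_smul, inv_mul_cancel₀ ht.ne', one_smul, map_sub]
    abel
  rw [e]
  refine (norm_add_le _ _).trans (add_le_add ?_ ?_)
  · rw [norm_smul, norm_inv, Real.norm_of_nonneg ht.le, inv_mul_le_iff₀ ht]
    refine (h _ (h1.2.2 x)).trans ?_
    rw [norm_smul, Real.norm_of_nonneg ht.le]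
    have h4 := ((L t).norm_coe_le_norm x).trans h1.2.1
    calc ε / 2 / (‖L₀‖ + 1) * (t * ‖L t x‖) ≤ ε / 2 / (‖L₀‖ + 1) * (t * (‖L₀‖ + 1)) := by
          gcongr
      _ = t * (ε / 2) := by field_simp
  · refine (Φ'.le_opNorm _).trans (le_trans ?_ h3.le)
    exact mul_le_mul_of_nonneg_left ((L t - L₀).norm_coe_le_norm x) (norm_nonneg _)

theorem differentiable_det : Differentiable ℝ fun M : E d →L[ℝ] E d => M.det := by
  have h : (fun M : E d →L[ℝ] E d => M.det) = fun M => ∑ σ : Equiv.Perm (Fin d),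
      ((Equiv.Perm.sign σ : ℤ) : ℝ) * ∏ i, M (EuclideanSpace.basisFun (Fin d) ℝ i) (σ i) := by
    funext M
    rw [ContinuousLinearMap.det, ← LinearMap.det_toMatrix
      (EuclideanSpace.basisFun (Fin d) ℝ).toBasis, Matrix.det_apply']
    simp [LinearMap.toMatrix_apply]
  rw [h]
  have h2 : ∀ i j, Differentiable ℝ fun M : E d →L[ℝ] E d =>
      M (EuclideanSpace.basisFun (Fin d) ℝ i) j := fun i j =>
    ((EuclideanSpace.proj (𝕜 := ℝ) j).comp
      (ContinuousLinearMap.apply ℝ (E d) (EuclideanSpace.basisFun (Fin d) ℝ i))).differentiable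
  fun_prop

/-- The coefficient matrix of the transported Dirichlet form. -/
def pullbackCoeff (M : E d →L[ℝ] E d) : E d →L[ℝ] E d :=
  |M.det| • (Ring.inverse M * star (Ring.inverse M))

/-- The determinant of the identity is 1, away from the corner of the absolute value. -/
theorem differentiableAt_abs_det : DifferentiableAt ℝ (fun M : E d →L[ℝ] E d => |M.det|) 1 := by
  refine (differentiable_det 1).abs ?_
  rw [ContinuousLinearMap.det]
  simp

theorem continuous_abs_det : Continuous fun M : E d →L[ℝ] E d => |M.det| :=
  differentiable_det.continuous.abs

theorem differentiableAt_pullbackCoeff :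
    DifferentiableAt ℝ (pullbackCoeff : (E d →L[ℝ] E d) → E d →L[ℝ] E d) 1 := by
  have h : DifferentiableAt ℝ (Ring.inverse : (E d →L[ℝ] E d) → E d →L[ℝ] E d) 1 :=
    (hasFDerivAt_ringInverse (1 : (E d →L[ℝ] E d)ˣ)).differentiableAt
  exact differentiableAt_abs_det.smul (h.mul h.star)

/-- Continuity near the identity, not only at it, is what makes the transported coefficients
continuous in space. It holds on the units, which form an open set. -/
theorem continuousAt_pullbackCoeff :
    ∀ᶠ M in 𝓝 (1 : E d →L[ℝ] E d), ContinuousAt pullbackCoeff M := by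
  filter_upwards [Units.isOpen.mem_nhds (isUnit_one : IsUnit (1 : E d →L[ℝ] E d))] with M hM
  obtain ⟨U, rfl⟩ := hM
  have h := NormedRing.inverse_continuousAt U
  exact continuous_abs_det.continuousAt.smul (h.mul
    ((LinearIsometryEquiv.continuous (ContinuousLinearMap.adjoint (𝕜 := ℝ) (E := E d)
      (F := E d))).continuousAt.comp h))

theorem pullbackCoeff_one : pullbackCoeff (1 : E d →L[ℝ] E d) = 1 := by
  rw [pullbackCoeff, Ring.inverse_one, star_one, ContinuousLinearMap.det]
  simp

/-- Pulled-back gradients carry the factor M*; the two inverse factors in `pullbackCoeff` undo it on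
both sides and leave the Jacobian of the change of variables. -/
theorem inner_pullbackCoeff_star {M : E d →L[ℝ] E d} (hM : IsUnit M) (y z : E d) :
    inner ℝ (pullbackCoeff M (star M y)) (star M z) = |M.det| * inner ℝ y z := by
  have h1 : Ring.inverse M * star (Ring.inverse M) * star M = Ring.inverse M := by
    rw [mul_assoc, ← star_mul, Ring.mul_inverse_cancel _ hM, star_one, mul_one]
  have h2 : pullbackCoeff M (star M y) = |M.det| • Ring.inverse M y := by
    rw [pullbackCoeff, smul_apply]
    congr 1
    exact congrArg (fun L : E d →L[ℝ] E d => L y) h1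
  have h3 : M (Ring.inverse M y) = y :=
    congrArg (fun L : E d →L[ℝ] E d => L y) (Ring.mul_inverse_cancel _ hM)
  rw [h2, real_inner_smul_left, ContinuousLinearMap.star_eq_adjoint,
    ContinuousLinearMap.adjoint_inner_right, h3]

end Coefficients

/-! ### The state system in operator form and its transport to Ω. -/

section StateSystem

open scoped ENNReal NNReal ContDiff BoundedContinuousFunction

section Sandwich

variable {X Y : Type*} [NormedAddCommGroup X] [InnerProductSpace ℝ X] [CompleteSpace X]
  [NormedAddCommGroup Y] [InnerProductSpace ℝ Y] [CompleteSpace Y]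

/-- The map `K ↦ P† K P`. -/
def sandwichL (P : X →L[ℝ] Y) : (Y →L[ℝ] Y) →L[ℝ] (X →L[ℝ] X) :=
  (ContinuousLinearMap.compL ℝ X Y X P.adjoint) ∘L ((ContinuousLinearMap.compL ℝ X Y Y).flip P)

theorem inner_sandwichL (P : X →L[ℝ] Y) (K : Y →L[ℝ] Y) (x y : X) :
    inner ℝ (sandwichL P K x) y = inner ℝ (K (P x)) (P y) :=
  ContinuousLinearMap.adjoint_inner_left P y (K (P x))

section Operators

variable {Z S W₁ W₂ : Type*} [NormedAddCommGroup Z] [InnerProductSpace ℝ Z] [CompleteSpace Z]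
  [NormedAddCommGroup S] [InnerProductSpace ℝ S] [CompleteSpace S]
  [NormedAddCommGroup W₁] [NormedSpace ℝ W₁] [NormedAddCommGroup W₂] [NormedSpace ℝ W₂]

/-- The operator of the bilinear form `⟨K₁ P x, P y⟩ + ⟨K₂ Q x, Q y⟩`, depending linearly on the
coefficients in `K₁` and `K₂`. -/
def dirichletOp (P : X →L[ℝ] Y) (Q : X →L[ℝ] Z) (K₁ : W₁ →L[ℝ] Y →L[ℝ] Y)
    (K₂ : W₂ →L[ℝ] Z →L[ℝ] Z) : W₁ × W₂ →L[ℝ] X →L[ℝ] X :=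
  (sandwichL P ∘L K₁).coprod (sandwichL Q ∘L K₂)

theorem inner_dirichletOp (P : X →L[ℝ] Y) (Q : X →L[ℝ] Z) (K₁ : W₁ →L[ℝ] Y →L[ℝ] Y)
    (K₂ : W₂ →L[ℝ] Z →L[ℝ] Z) (a : W₁) (b : W₂) (x y : X) :
    inner ℝ (dirichletOp P Q K₁ K₂ (a, b) x) y =
      inner ℝ (K₁ a (P x)) (P y) + inner ℝ (K₂ b (Q x)) (Q y) := by
  rw [← inner_sandwichL, ← inner_sandwichL, ← inner_add_left]
  simp [dirichletOp]

/-- The operator of the bilinear form `β ⟨K P x, P y⟩`. -/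
def controlOp (P : X →L[ℝ] Y) (K : W₁ →L[ℝ] Y →L[ℝ] Y) (β : ℝ) : W₁ →L[ℝ] X →L[ℝ] X :=
  β • (sandwichL P ∘L K)

theorem inner_controlOp (P : X →L[ℝ] Y) (K : W₁ →L[ℝ] Y →L[ℝ] Y) (β : ℝ) (a : W₁) (x y : X) :
    inner ℝ (controlOp P K β a x) y = β * inner ℝ (K a (P x)) (P y) := by
  rw [← inner_sandwichL, ← real_inner_smul_left]
  rfl

/-- The operator of a coupled state system with coefficients in `W₁ × W₂`. -/
def stateOp (P : X →L[ℝ] Y) (Q : X →L[ℝ] Z) (γ : X →L[ℝ] S) (K₁ : W₁ →L[ℝ] Y →L[ℝ] Y)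
    (K₂ : W₂ →L[ℝ] Z →L[ℝ] Z) (K₃ : W₁ →L[ℝ] Y →L[ℝ] Y) (β : ℝ) (a : W₁) (b : W₂) :
    X × X →L[ℝ] X × X :=
  coupledOp (dirichletOp P Q K₁ K₂ (a, b)) (controlOp P K₃ β a) (γ.adjoint ∘L γ)

/-- The data of a coupled state system. -/
def stateRhs (P : X →L[ℝ] Y) (γ : X →L[ℝ] S) (f : Y) (gn gd : S) : X × X :=
  (P.adjoint f + γ.adjoint gn, -γ.adjoint gd)

/-- Two vectors agree exactly when they have the same inner product with every w. Each component of
the operator equation thereby becomes a variational equation. -/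
theorem stateOp_eq_iff (P : X →L[ℝ] Y) (Q : X →L[ℝ] Z) (γ : X →L[ℝ] S) (K₁ : W₁ →L[ℝ] Y →L[ℝ] Y)
    (K₂ : W₂ →L[ℝ] Z →L[ℝ] Z) (K₃ : W₁ →L[ℝ] Y →L[ℝ] Y) (β : ℝ) (a : W₁) (b : W₂) (f : Y)
    (gn gd : S) (x : X × X) :
    stateOp P Q γ K₁ K₂ K₃ β a b x = stateRhs P γ f gn gd ↔
      (∀ w, inner ℝ (K₁ a (P x.1)) (P w) + inner ℝ (K₂ b (Q x.1)) (Q w) +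
        β * inner ℝ (K₃ a (P x.2)) (P w) = inner ℝ f (P w) + inner ℝ gn (γ w)) ∧
      (∀ w, inner ℝ (K₁ a (P x.2)) (P w) + inner ℝ (K₂ b (Q x.2)) (Q w) =
        inner ℝ (γ x.1 - gd) (γ w)) := by
  rw [stateOp, stateRhs, coupledOp_apply, Prod.ext_iff]
  refine and_congr ⟨fun h w => ?_, fun h => ext_inner_right ℝ fun w => ?_⟩
    ⟨fun h w => ?_, fun h => ext_inner_right ℝ fun w => ?_⟩
  · have := congrArg (fun z => inner ℝ z w) h
    simpa only [inner_add_left, inner_dirichletOp, inner_controlOp,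
      ContinuousLinearMap.adjoint_inner_left] using this
  · simpa only [inner_add_left, inner_dirichletOp, inner_controlOp,
      ContinuousLinearMap.adjoint_inner_left] using h w
  · have := congrArg (fun z => inner ℝ z w) h
    simp only [inner_sub_left, inner_neg_left, inner_dirichletOp, ContinuousLinearMap.comp_apply,
      ContinuousLinearMap.adjoint_inner_left] at this ⊢
    linarith
  · have := h w
    simp only [inner_sub_left, inner_neg_left, inner_dirichletOp, ContinuousLinearMap.comp_apply,
      ContinuousLinearMap.adjoint_inner_left] at this ⊢
    linarith

end Operators

end Sandwich

theorem inner_Lp_real {α : Type*} [MeasurableSpace α] {μ : Measure α} (f g : Lp ℝ 2 μ) :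
    inner ℝ f g = ∫ x, f x * g x ∂μ := by
  rw [L2.inner_def]
  exact integral_congr_ae (Eventually.of_forall fun x => mul_comm _ _)

variable {Ω : Set (E d)}

section Forms

variable [IsFiniteMeasure (volume.restrict Ω)]

theorem inner_mulL_real (J : E d →ᵇ ℝ) (u v : Lp ℝ 2 (volume.restrict Ω)) :
    inner ℝ (mulL (volume.restrict Ω) (ContinuousLinearMap.mul ℝ ℝ) J u) v =
      ∫ x in Ω, J x * (u x * v x) := by
  rw [inner_Lp_real]
  refine integral_congr_ae ?_
  filter_upwards [coeFn_mulL (volume.restrict Ω) (ContinuousLinearMap.mul ℝ ℝ) J u] with x hx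
  rw [hx]
  exact mul_assoc _ _ _

theorem inner_mulL_clm (A : E d →ᵇ (E d →L[ℝ] E d)) (u v : Lp (E d) 2 (volume.restrict Ω)) :
    inner ℝ (mulL (volume.restrict Ω) (ContinuousLinearMap.id ℝ (E d →L[ℝ] E d)) A u) v =
      ∫ x in Ω, inner ℝ (A x (u x)) (v x) := by
  rw [L2.inner_def]
  refine integral_congr_ae ?_
  filter_upwards [coeFn_mulL (volume.restrict Ω) (ContinuousLinearMap.id ℝ (E d →L[ℝ] E d)) A u]
    with x hx
  rw [hx]
  rfl

theorem inner_indicatorL {s : Set (E d)} (hs : MeasurableSet s) (hsΩ : s ⊆ Ω)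
    (u v : Lp ℝ 2 (volume.restrict Ω)) :
    inner ℝ (indicatorL (volume.restrict Ω) hs u) v = ∫ x in s, u x * v x := by
  have h3 : ∫ x in Ω, s.indicator (fun x => u x * v x) x = ∫ x in s, u x * v x := by
    rw [integral_indicator hs, Measure.restrict_restrict hs, inter_eq_left.mpr hsΩ]
  rw [inner_Lp_real, ← h3]
  refine integral_congr_ae ?_
  filter_upwards [coeFn_indicatorL (volume.restrict Ω) hs u] with x hx2
  rw [hx2]
  by_cases h : x ∈ s <;> simp [h]

variable (Ω) in
/-- Multiplication by `J` and restriction to `s`. -/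
def indicatorMulL {s : Set (E d)} (hs : MeasurableSet s) :
    (E d →ᵇ ℝ) →L[ℝ] (Lp ℝ 2 (volume.restrict Ω) →L[ℝ] Lp ℝ 2 (volume.restrict Ω)) :=
  (ContinuousLinearMap.compL ℝ _ _ _ (indicatorL (volume.restrict Ω) hs)) ∘L
      mulL (volume.restrict Ω) (ContinuousLinearMap.mul ℝ ℝ)

theorem inner_indicatorMulL {s : Set (E d)} (hs : MeasurableSet s) (hsΩ : s ⊆ Ω)
    (J : E d →ᵇ ℝ) (u v : Lp ℝ 2 (volume.restrict Ω)) :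
    inner ℝ (indicatorMulL Ω hs J u) v = ∫ x in s, J x * (u x * v x) := by
  refine (inner_indicatorL hs hsΩ
    (mulL (volume.restrict Ω) (ContinuousLinearMap.mul ℝ ℝ) J u) v).trans (integral_congr_ae ?_)
  filter_upwards [ae_restrict_of_ae_restrict_of_subset hsΩ
    (coeFn_mulL (volume.restrict Ω) (ContinuousLinearMap.mul ℝ ℝ) J u)] with x hx
  rw [hx]
  exact mul_assoc _ _ _

end Forms

/-- `U ∈ H¹(Ω)` is the composition of `u ∈ H¹(Ω)` with `T`. -/
structure IsPullback (hΩ : IsLipschitzDomain Ω) (T : E d → E d) (u U : H1 Ω) : Prop where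
  fn_eq : fn U =ᵐ[volume.restrict Ω] fun x => fn u (T x)
  grad_eq : grad U =ᵐ[volume.restrict Ω] fun x => star (fderiv ℝ T x) (grad u (T x))
  trace_eq : traceL hΩ U = traceL hΩ u

variable {hΩ : IsLipschitzDomain Ω} {T : E d → E d}

theorem IsDeformation.isUnit_fderiv (hT : IsDeformation Ω T) (x : E d) :
    IsUnit (fderiv ℝ T x) := by
  have hinj : Function.Injective (fderiv ℝ T x) := by
    rw [injective_iff_map_eq_zero]
    intro y hy
    have := hT.antilipschitz_fderiv x y
    rw [hy, norm_zero, mul_zero] at this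
    exact norm_le_zero_iff.mp this
  rw [ContinuousLinearMap.isUnit_iff_bijective]
  exact ⟨hinj, (LinearMap.injective_iff_surjective (f := (fderiv ℝ T x : E d →ₗ[ℝ] E d))).mp hinj⟩

theorem isDeformation_id (Ω : Set (E d)) : IsDeformation Ω id :=
  ⟨contDiff_id, AntilipschitzWith.of_le_mul_dist fun x y => by
    simpa using le_mul_of_one_le_left dist_nonneg one_le_two, LipschitzWith.id.weaken one_le_two,
    Function.surjective_id, ∅, isCompact_empty, empty_subset _, fun _ _ => rfl⟩

theorem isPullback_id (u : H1 Ω) : IsPullback hΩ id u u := by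
  refine ⟨EventuallyEq.rfl, Eventually.of_forall fun x => ?_, rfl⟩
  change _ = star (fderiv ℝ id x) (grad u x)
  rw [fderiv_id]
  change _ = star (1 : E d →L[ℝ] E d) (grad u x)
  rw [star_one]
  rfl

theorem IsPullback.compOp_eq (hT : IsDeformation Ω T) {u U : H1 Ω} (hu : IsPullback hΩ T u U) :
    compOp Ω T (fnL Ω u) = fnL Ω U := by
  refine Lp.ext ?_
  filter_upwards [coeFn_compOp hT (fnL Ω u), hu.fn_eq] with x h1 h2
  rw [h1]
  exact h2.symm

variable [IsFiniteMeasure (volume.restrict Ω)]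

theorem IsDeformation.inner_mulL_comp (hΩ : IsOpen Ω) (hT : IsDeformation Ω T)
    {a a' b b' : Lp ℝ 2 (volume.restrict Ω)} {p p' q q' : Lp (E d) 2 (volume.restrict Ω)}
    (ha : a' =ᵐ[volume.restrict Ω] fun x => a (T x))
    (hb : b' =ᵐ[volume.restrict Ω] fun x => b (T x))
    (hp : p' =ᵐ[volume.restrict Ω] fun x => star (fderiv ℝ T x) (p (T x)))
    (hq : q' =ᵐ[volume.restrict Ω] fun x => star (fderiv ℝ T x) (q (T x))) {J : E d →ᵇ ℝ}
    (hJ : ∀ x, J x = |(fderiv ℝ T x).det|) {A : E d →ᵇ (E d →L[ℝ] E d)}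
    (hA : ∀ x, A x = pullbackCoeff (fderiv ℝ T x)) :
    ∫ x in Ω, (inner ℝ (p x) (q x) + a x * b x) =
      inner ℝ (mulL (volume.restrict Ω) (ContinuousLinearMap.mul ℝ ℝ) J a') b' +
      inner ℝ (mulL (volume.restrict Ω) (ContinuousLinearMap.id ℝ (E d →L[ℝ] E d)) A p') q' := by
  have i1 := L2.integrable_inner (𝕜 := ℝ) p q
  have i2 := L2.integrable_inner (𝕜 := ℝ) b a
  rw [inner_mulL_real, inner_mulL_clm]
  refine (integral_add i1 i2).trans ?_
  rw [add_comm, hT.setIntegral_comp hΩ fun x => inner ℝ (b x) (a x),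
    hT.setIntegral_comp hΩ fun x => inner ℝ (p x) (q x)]
  congr 1
  · refine integral_congr_ae ?_
    filter_upwards [ha, hb] with x h1 h3
    rw [h1, h3, hJ]
    rfl
  · refine integral_congr_ae ?_
    filter_upwards [hp, hq] with x h2 h4
    rw [h2, h4, hA, inner_pullbackCoeff_star (hT.isUnit_fderiv x)]

theorem IsPullback.dirichlet_eq (hT : IsDeformation Ω T) {u U w W : H1 Ω}
    (hu : IsPullback hΩ T u U) (hw : IsPullback hΩ T w W) {J : E d →ᵇ ℝ}
    (hJ : ∀ x, J x = |(fderiv ℝ T x).det|) {A : E d →ᵇ (E d →L[ℝ] E d)}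
    (hA : ∀ x, A x = pullbackCoeff (fderiv ℝ T x)) :
    ∫ x in Ω, (inner ℝ (grad u x) (grad w x) + fn u x * fn w x) =
      inner ℝ (mulL (volume.restrict Ω) (ContinuousLinearMap.mul ℝ ℝ) J (fnL Ω U)) (fnL Ω W) +
      inner ℝ (mulL (volume.restrict Ω) (ContinuousLinearMap.id ℝ (E d →L[ℝ] E d)) A (gradL Ω U))
        (gradL Ω W) :=
  hT.inner_mulL_comp (a := fnL Ω u) (b := fnL Ω w) (p := gradL Ω u) (q := gradL Ω w) hΩ.isOpen
    hu.fn_eq hw.fn_eq hu.grad_eq hw.grad_eq hJ hA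

theorem IsPullback.control_eq (hT : IsDeformation Ω T) {u U w W : H1 Ω}
    (hu : IsPullback hΩ T u U) (hw : IsPullback hΩ T w W) {J : E d →ᵇ ℝ}
    (hJ : ∀ x, J x = |(fderiv ℝ T x).det|) {s : Set (E d)} (hs : MeasurableSet s)
    (hsΩ : s ⊆ Ω) :
    ∫ x in T '' s, fn u x * fn w x = inner ℝ (indicatorMulL Ω hs J (fnL Ω U)) (fnL Ω W) := by
  rw [inner_indicatorMulL hs hsΩ, hT.setIntegral_image hs]
  refine integral_congr_ae ?_
  filter_upwards [ae_restrict_of_ae_restrict_of_subset hsΩ hu.fn_eq,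
    ae_restrict_of_ae_restrict_of_subset hsΩ hw.fn_eq] with x h1 h3
  rw [coe_fnL, coe_fnL, h1, h3, hJ]

/-- Change of variables: the Jacobian is exactly what makes composition of both arguments with T
preserve the L² pairing. -/
theorem IsDeformation.inner_compOp (hΩ : IsOpen Ω) (hT : IsDeformation Ω T) {J : E d →ᵇ ℝ}
    (hJ : ∀ x, J x = |(fderiv ℝ T x).det|) (f g : Lp ℝ 2 (volume.restrict Ω)) :
    inner ℝ (mulL (volume.restrict Ω) (ContinuousLinearMap.mul ℝ ℝ) J (compOp Ω T f))
      (compOp Ω T g) = inner ℝ f g := by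
  rw [inner_mulL_real, inner_Lp_real f g, hT.setIntegral_comp hΩ fun x => f x * g x]
  refine integral_congr_ae ?_
  filter_upwards [coeFn_compOp hT f, coeFn_compOp hT g] with x h1 h2
  rw [h1, h2, hJ]

theorem IsPullback.load_eq (hT : IsDeformation Ω T) {w W : H1 Ω} (hw : IsPullback hΩ T w W)
    {J : E d →ᵇ ℝ} (hJ : ∀ x, J x = |(fderiv ℝ T x).det|) {f : E d → ℝ}
    (hf : MemLp f 2 (volume.restrict Ω)) :
    ∫ y in Ω, f y * fn w y = inner ℝ (mulL (volume.restrict Ω) (ContinuousLinearMap.mul ℝ ℝ) J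
      (compOp Ω T (hf.toLp f))) (fnL Ω W) := by
  rw [← hw.compOp_eq hT, hT.inner_compOp hΩ.isOpen hJ, inner_Lp_real]
  refine integral_congr_ae ?_
  filter_upwards [hf.coeFn_toLp] with x hx
  rw [hx]
  rfl

/-- The operator of the state system on `Ω` with control region `s` and coefficients `J`, `A`. -/
def stateSystemOp (hΩ : IsLipschitzDomain Ω) {s : Set (E d)} (hs : MeasurableSet s) (β : ℝ)
    (J : E d →ᵇ ℝ) (A : E d →ᵇ (E d →L[ℝ] E d)) : H1 Ω × H1 Ω →L[ℝ] H1 Ω × H1 Ω :=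
  stateOp (fnL Ω) (gradL Ω) (traceL hΩ)
    (mulL (volume.restrict Ω) (ContinuousLinearMap.mul ℝ ℝ))
    (mulL (volume.restrict Ω) (ContinuousLinearMap.id ℝ (E d →L[ℝ] E d)))
    (indicatorMulL Ω hs) β J A

/-- The data of the state system on `Ω`. -/
def stateSystemRhs (hΩ : IsLipschitzDomain Ω) (f : Lp ℝ 2 (volume.restrict Ω))
    (gn gd : Lp ℝ 2 (surfaceMeasure Ω)) : H1 Ω × H1 Ω :=
  stateRhs (fnL Ω) (traceL hΩ) f gn gd

/-- The load `J (f ∘ T)`. -/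
def transportLoad (J : E d →ᵇ ℝ) (T : E d → E d) (f : Lp ℝ 2 (volume.restrict Ω)) :
    Lp ℝ 2 (volume.restrict Ω) :=
  mulL (volume.restrict Ω) (ContinuousLinearMap.mul ℝ ℝ) J (compOp Ω T f)

/-- Lets the quantifier over test functions be exchanged for one over their pullbacks, pullback
being total in both directions. -/
theorem forall_iff_of_rel {α β : Type*} {R : α → β → Prop} (h1 : ∀ b, ∃ a, R a b)
    (h2 : ∀ a, ∃ b, R a b) {P : α → Prop} {Q : β → Prop} (h : ∀ a b, R a b → (P a ↔ Q b)) :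
    (∀ a, P a) ↔ ∀ b, Q b :=
  ⟨fun hP b => (h1 b).elim fun a hab => (h a b hab).mp (hP a),
    fun hQ a => (h2 a).elim fun b hab => (h a b hab).mpr (hQ b)⟩

/-- Transport of the state system to the reference configuration. -/
theorem isStateSolution_iff_of_isPullback (hT : IsDeformation Ω T) {u U p P : H1 Ω}
    (hu : IsPullback hΩ T u U) (hp : IsPullback hΩ T p P) {J : E d →ᵇ ℝ}
    (hJ : ∀ x, J x = |(fderiv ℝ T x).det|) {A : E d →ᵇ (E d →L[ℝ] E d)}
    (hA : ∀ x, A x = pullbackCoeff (fderiv ℝ T x)) {s : Set (E d)} (hs : MeasurableSet s)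
    (hsΩ : s ⊆ Ω) {α : ℝ} {f : E d → ℝ} (hf : MemLp f 2 (volume.restrict Ω))
    (gn gd : Lp ℝ 2 (surfaceMeasure Ω)) :
    IsStateSolution Ω (T '' s) α f gn gd (u, p) ↔ stateSystemOp hΩ hs (1 / α) J A (U, P) =
      stateSystemRhs hΩ (transportLoad J T (hf.toLp f)) gn gd := by
  have hpb : ∀ w, ∃ W, IsPullback hΩ T w W := fun w => by
    obtain ⟨W, h1, h2, h3⟩ := hT.exists_pullback hΩ w
    exact ⟨W, h1, h2, h3⟩
  have hpf : ∀ W, ∃ w, IsPullback hΩ T w W := fun W => by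
    obtain ⟨w, h1, h2, h3⟩ := hT.exists_pushforward hΩ W
    exact ⟨w, h1, h2, h3.symm⟩
  have e4 : ∀ w W : H1 Ω, IsPullback hΩ T w W →
      ∫ y, gn y * trace w y ∂surfaceMeasure Ω = inner ℝ gn (traceL hΩ W) := by
    intro w W hw
    rw [hw.trace_eq, ← trace_eq_traceL hΩ, inner_Lp_real]
  have e5 : ∀ w W : H1 Ω, IsPullback hΩ T w W →
      ∫ y, (trace u y - gd y) * trace w y ∂surfaceMeasure Ω =
        inner ℝ (traceL hΩ U - gd) (traceL hΩ W) := by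
    intro w W hw
    rw [hw.trace_eq, hu.trace_eq, ← trace_eq_traceL hΩ, ← trace_eq_traceL hΩ, inner_Lp_real]
    refine integral_congr_ae ?_
    filter_upwards [Lp.coeFn_sub (trace u) gd] with x hx
    rw [hx, Pi.sub_apply]
  have key1 : ∀ w W : H1 Ω, IsPullback hΩ T w W →
      ((∫ y in Ω, (inner ℝ (grad u y) (grad w y) + fn u y * fn w y)) +
          1 / α * ∫ y in T '' s, fn p y * fn w y =
        (∫ y in Ω, f y * fn w y) + ∫ y, gn y * trace w y ∂surfaceMeasure Ω ↔
      inner ℝ (mulL (volume.restrict Ω) (ContinuousLinearMap.mul ℝ ℝ) J (fnL Ω U)) (fnL Ω W) +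
        inner ℝ (mulL (volume.restrict Ω) (ContinuousLinearMap.id ℝ (E d →L[ℝ] E d)) A
          (gradL Ω U)) (gradL Ω W) + 1 / α * inner ℝ (indicatorMulL Ω hs J (fnL Ω P)) (fnL Ω W) =
        inner ℝ (mulL (volume.restrict Ω) (ContinuousLinearMap.mul ℝ ℝ) J
          (compOp Ω T (hf.toLp f))) (fnL Ω W) + inner ℝ gn (traceL hΩ W)) := by
    intro w W hw
    exact iff_of_eq (congrArg₂ (fun a b : ℝ => a = b) (congrArg₂ (fun a b : ℝ => a + 1 / α * b)
      (hu.dirichlet_eq hT hw hJ hA) (hp.control_eq hT hw hJ hs hsΩ))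
      (congrArg₂ (fun a b : ℝ => a + b) (hw.load_eq hT hJ hf) (e4 w W hw)))
  have key2 : ∀ w W : H1 Ω, IsPullback hΩ T w W →
      (∫ y in Ω, (inner ℝ (grad p y) (grad w y) + fn p y * fn w y) =
        ∫ y, (trace u y - gd y) * trace w y ∂surfaceMeasure Ω ↔
      inner ℝ (mulL (volume.restrict Ω) (ContinuousLinearMap.mul ℝ ℝ) J (fnL Ω P)) (fnL Ω W) +
        inner ℝ (mulL (volume.restrict Ω) (ContinuousLinearMap.id ℝ (E d →L[ℝ] E d)) A
          (gradL Ω P)) (gradL Ω W) = inner ℝ (traceL hΩ U - gd) (traceL hΩ W)) := by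
    intro w W hw
    exact iff_of_eq (congrArg₂ (fun a b : ℝ => a = b) (hp.dirichlet_eq hT hw hJ hA) (e5 w W hw))
  have k1 := forall_iff_of_rel hpf hpb key1
  have k2 := forall_iff_of_rel hpf hpb key2
  have hiff := stateOp_eq_iff (fnL Ω) (gradL Ω) (traceL hΩ)
    (mulL (volume.restrict Ω) (ContinuousLinearMap.mul ℝ ℝ))
    (mulL (volume.restrict Ω) (ContinuousLinearMap.id ℝ (E d →L[ℝ] E d)))
    (indicatorMulL Ω hs) (1 / α) J A
    (mulL (volume.restrict Ω) (ContinuousLinearMap.mul ℝ ℝ) J (compOp Ω T (hf.toLp f))) gn gd (U, P)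
  have k3 := and_congr k1 k2
  dsimp only at hiff
  have k4 := k3.trans hiff.symm
  exact k4

end StateSystem

/-! ### Weak derivative of the abstract state system. -/

section StateDerivative

theorem continuous_coupledOp {X : Type*} [NormedAddCommGroup X] [NormedSpace ℝ X] (c : X →L[ℝ] X) :
    Continuous fun q : (X →L[ℝ] X) × (X →L[ℝ] X) => coupledOp q.1 q.2 c := by
  refine (ContinuousLinearMap.prodₗᵢ ℝ).continuous.comp (Continuous.prodMk ?_ ?_) <;> fun_prop

variable {X Y Z S W₁ W₂ : Type*} [NormedAddCommGroup X] [InnerProductSpace ℝ X] [CompleteSpace X]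
  [NormedAddCommGroup Y] [InnerProductSpace ℝ Y] [CompleteSpace Y]
  [NormedAddCommGroup Z] [InnerProductSpace ℝ Z] [CompleteSpace Z]
  [NormedAddCommGroup S] [InnerProductSpace ℝ S] [CompleteSpace S]
  [NormedAddCommGroup W₁] [NormedSpace ℝ W₁] [NormedAddCommGroup W₂] [NormedSpace ℝ W₂]

theorem tendsto_smul_slope {B : Type*} [NormedAddCommGroup B] [NormedSpace ℝ B] {M : ℝ → B}
    {M₀ M' : B} (h : Tendsto (fun t : ℝ => t⁻¹ • (M t - M₀)) (𝓝[>] 0) (𝓝 M')) :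
    Tendsto M (𝓝[>] 0) (𝓝 M₀) := by
  have h1 := (tendsto_id.mono_left (nhdsWithin_le_nhds (a := (0 : ℝ)) (s := Ioi 0))).smul h
  rw [zero_smul] at h1
  have h2 := h1.add_const M₀
  rw [zero_add] at h2
  refine h2.congr' ?_
  filter_upwards [self_mem_nhdsWithin] with t ht
  rw [id, smul_smul, mul_inv_cancel₀ (ne_of_gt ht), one_smul, sub_add_cancel]

theorem tendsto_slope_clm {B B' : Type*} [NormedAddCommGroup B] [NormedSpace ℝ B]
    [NormedAddCommGroup B'] [NormedSpace ℝ B'] (L : B →L[ℝ] B') {M : ℝ → B}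
    {M₀ M' : B} (h : Tendsto (fun t : ℝ => t⁻¹ • (M t - M₀)) (𝓝[>] 0) (𝓝 M')) :
    Tendsto (fun t : ℝ => t⁻¹ • (L (M t) - L M₀)) (𝓝[>] 0) (𝓝 (L M')) := by
  refine ((L.continuous.tendsto _).comp h).congr fun t => ?_
  rw [Function.comp_apply, map_smul, map_sub]

variable {P : X →L[ℝ] Y} {Q : X →L[ℝ] Z} {K₁ : W₁ →L[ℝ] Y →L[ℝ] Y}
    {K₂ : W₂ →L[ℝ] Z →L[ℝ] Z} {K₃ : W₁ →L[ℝ] Y →L[ℝ] Y} {β : ℝ} {a₀ : W₁} {b₀ : W₂}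

/-- By `h1` the Dirichlet block is the identity of X, and the control block is nonnegative, so
`isUnit_coupledOp_one` applies. -/
theorem isUnit_stateOp (γ : X →L[ℝ] S)
    (h1 : ∀ x y, inner ℝ (K₁ a₀ (P x)) (P y) + inner ℝ (K₂ b₀ (Q x)) (Q y) = inner ℝ x y)
    (hK₃ : ∀ y, 0 ≤ inner ℝ (K₃ a₀ y) y) (hβ : 0 ≤ β) :
    IsUnit (stateOp P Q γ K₁ K₂ K₃ β a₀ b₀) := by
  have h2 : dirichletOp P Q K₁ K₂ (a₀, b₀) = 1 := by
    refine ContinuousLinearMap.ext fun x => ext_inner_right ℝ fun y => ?_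
    rw [inner_dirichletOp, h1]
    rfl
  rw [stateOp, h2]
  refine isUnit_coupledOp_one _ (fun x => ?_) γ
  rw [inner_controlOp]
  exact mul_nonneg hβ (hK₃ _)

/-- Weak differentiability of the solutions of a coupled state system with respect to its
coefficients and its load. -/
theorem exists_weak_deriv_stateOp {γ : X →L[ℝ] S}
    (hunit : IsUnit (stateOp P Q γ K₁ K₂ K₃ β a₀ b₀))
    {a : ℝ → W₁} {a' : W₁} (ha : Tendsto (fun t : ℝ => t⁻¹ • (a t - a₀)) (𝓝[>] 0) (𝓝 a'))
    {b : ℝ → W₂} {b' : W₂} (hb : Tendsto (fun t : ℝ => t⁻¹ • (b t - b₀)) (𝓝[>] 0) (𝓝 b'))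
    {g : ℝ → Y} {g₀ : Y} {R : X →L[ℝ] Y} {C : ℝ} (hC : 0 ≤ C)
    (hg1 : ∀ᶠ t : ℝ in 𝓝[>] 0, ∀ v, inner ℝ (t⁻¹ • (g t - g₀)) (P v) ≤ C * ‖v‖)
    (hg2 : ∀ v, Tendsto (fun t : ℝ => inner ℝ (t⁻¹ • (g t - g₀)) (P v)) (𝓝[>] 0)
      (𝓝 (-inner ℝ g₀ (R v)))) {gn gd : S} {x : ℝ → X × X} {x₀ : X × X}
    (hx : ∀ᶠ t in 𝓝[>] 0, stateOp P Q γ K₁ K₂ K₃ β (a t) (b t) (x t) = stateRhs P γ (g t) gn gd)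
    (hx₀ : stateOp P Q γ K₁ K₂ K₃ β a₀ b₀ x₀ = stateRhs P γ g₀ gn gd) :
    ∃ x' : X × X, ∀ ℓ : StrongDual ℝ (X × X),
      Tendsto (fun t : ℝ => ℓ (t⁻¹ • (x t - x₀))) (𝓝[>] 0) (𝓝 (ℓ x')) := by
  -- The other blocks are linear in the coefficients; the trace block does not depend on t and
  -- cancels, hence the 0 in the limit.
  have hM : Tendsto (fun t : ℝ => t⁻¹ • (stateOp P Q γ K₁ K₂ K₃ β (a t) (b t) -
      stateOp P Q γ K₁ K₂ K₃ β a₀ b₀)) (𝓝[>] 0)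
      (𝓝 (coupledOp (dirichletOp P Q K₁ K₂ (a', b')) (controlOp P K₃ β a') 0)) := by
    have h1 : Tendsto (fun t : ℝ => t⁻¹ • ((a t, b t) - (a₀, b₀))) (𝓝[>] 0) (𝓝 (a', b')) :=
      ha.prodMk_nhds hb
    have h2 := tendsto_slope_clm (dirichletOp P Q K₁ K₂) h1
    have h3 := tendsto_slope_clm (controlOp P K₃ β) ha
    refine (((continuous_coupledOp 0).tendsto _).comp (h2.prodMk_nhds h3)).congr fun t => ?_
    refine ContinuousLinearMap.ext fun y => ?_
    simp only [Function.comp_apply, stateOp, coupledOp_apply, smul_apply, sub_apply, zero_apply,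
      Prod.smul_mk, Prod.mk_sub_mk, sub_zero]
    rw [← smul_add]
    refine Prod.ext (congrArg (fun z => t⁻¹ • z) ?_) (congrArg (fun z => t⁻¹ • z) ?_) <;>
      abel
  have hF : ∀ t : ℝ, t⁻¹ • (stateRhs P γ (g t) gn gd - stateRhs P γ g₀ gn gd) =
      (P.adjoint (t⁻¹ • (g t - g₀)), 0) := fun t => by
    rw [stateRhs, stateRhs, Prod.mk_sub_mk, add_sub_add_right_eq_sub, sub_self, Prod.smul_mk,
      smul_zero, ← map_sub, map_smul]
  refine exists_weak_deriv_of_eq hunit hM (tendsto_smul_slope hM) (C := C) (F' := (-R.adjoint g₀, 0)) ?_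
    (fun ℓ => ?_) hx hx₀
  · filter_upwards [hg1] with t ht
    rw [hF, Prod.norm_mk, norm_zero, max_eq_left (norm_nonneg _)]
    -- Testing the dual estimate with the vector itself gives r² ≤ C r, hence r ≤ C.
    have h1 := ht (P.adjoint (t⁻¹ • (g t - g₀)))
    rw [← ContinuousLinearMap.adjoint_inner_left, real_inner_self_eq_norm_mul_norm] at h1
    generalize ‖P.adjoint (t⁻¹ • (g t - g₀))‖ = r at h1
    by_contra! h2
    nlinarith
  · simp only [hF]
    -- By Riesz, a functional restricted to the first factor is an inner product, so `hg2` is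
    -- exactly the required weak convergence.
    have h1 : ∀ z : X, ℓ (z, 0) =
        inner ℝ z ((InnerProductSpace.toDual ℝ X).symm (ℓ ∘L ContinuousLinearMap.inl ℝ X X)) := by
      intro z
      rw [real_inner_comm, InnerProductSpace.toDual_symm_apply]
      rfl
    simp only [h1, ContinuousLinearMap.adjoint_inner_left, inner_neg_left]
    exact hg2 _

end StateDerivative

/-! ### Unique solvability and weak derivative of the transported states. -/

section WeakDerivative

open scoped ENNReal NNReal ContDiff BoundedContinuousFunction

variable {Ω : Set (E d)}

theorem tendsto_toWeakSpace {B ι : Type*} [NormedAddCommGroup B] [NormedSpace ℝ B] {l : Filter ι}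
    {u : ι → B} {v : B} (h : ∀ ℓ : StrongDual ℝ B, Tendsto (fun t => ℓ (u t)) l (𝓝 (ℓ v))) :
    Tendsto (fun t => toWeakSpace ℝ B (u t)) l (𝓝 (toWeakSpace ℝ B v)) := by
  have h1 : IsInducing fun (x : WeakBilin (topDualPairing ℝ B).flip) y =>
    (topDualPairing ℝ B).flip x y := ⟨rfl⟩
  exact h1.tendsto_nhds_iff.mpr (tendsto_pi_nhds.mpr h)

variable [IsFiniteMeasure (volume.restrict Ω)]

theorem mulL_one_real (u : Lp ℝ 2 (volume.restrict Ω)) :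
    mulL (volume.restrict Ω) (ContinuousLinearMap.mul ℝ ℝ)
      (BoundedContinuousFunction.const (E d) 1) u = u := by
  refine Lp.ext ?_
  filter_upwards [coeFn_mulL (volume.restrict Ω) (ContinuousLinearMap.mul ℝ ℝ)
    (BoundedContinuousFunction.const (E d) 1) u] with x hx
  rw [hx]
  exact one_mul _

theorem mulL_one_clm (u : Lp (E d) 2 (volume.restrict Ω)) :
    mulL (volume.restrict Ω) (ContinuousLinearMap.id ℝ (E d →L[ℝ] E d))
      (BoundedContinuousFunction.const (E d) 1) u = u := by
  refine Lp.ext ?_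
  filter_upwards [coeFn_mulL (volume.restrict Ω) (ContinuousLinearMap.id ℝ (E d →L[ℝ] E d))
    (BoundedContinuousFunction.const (E d) 1) u] with x hx
  rw [hx]
  rfl

theorem isUnit_stateSystemOp (hΩ : IsLipschitzDomain Ω) {s : Set (E d)} (hs : MeasurableSet s)
    (hsΩ : s ⊆ Ω) {β : ℝ} (hβ : 0 ≤ β) :
    IsUnit (stateSystemOp hΩ hs β (BoundedContinuousFunction.const (E d) 1)
      (BoundedContinuousFunction.const (E d) 1)) := by
  have h1 : ∀ x y : H1 Ω, inner ℝ (mulL (volume.restrict Ω) (ContinuousLinearMap.mul ℝ ℝ)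
      (BoundedContinuousFunction.const (E d) 1) (fnL Ω x)) (fnL Ω y) +
      inner ℝ (mulL (volume.restrict Ω) (ContinuousLinearMap.id ℝ (E d →L[ℝ] E d))
        (BoundedContinuousFunction.const (E d) 1) (gradL Ω x)) (gradL Ω y) = inner ℝ x y := by
    intro x y
    exact (congrArg₂ (fun a b => inner ℝ a (fnL Ω y) + inner ℝ b (gradL Ω y))
      (mulL_one_real (fnL Ω x)) (mulL_one_clm (gradL Ω x))).trans (H1.inner_eq x y).symm
  have h2 : ∀ y : Lp ℝ 2 (volume.restrict Ω), 0 ≤ inner ℝ (indicatorMulL Ω hs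
      (BoundedContinuousFunction.const (E d) 1) y) y := by
    intro y
    rw [inner_indicatorMulL hs hsΩ]
    refine integral_nonneg fun x => ?_
    exact mul_nonneg zero_le_one (mul_self_nonneg _)
  exact isUnit_stateOp (P := fnL Ω) (Q := gradL Ω)
    (K₁ := mulL (volume.restrict Ω) (ContinuousLinearMap.mul ℝ ℝ))
    (K₂ := mulL (volume.restrict Ω) (ContinuousLinearMap.id ℝ (E d →L[ℝ] E d)))
    (K₃ := indicatorMulL Ω hs) (traceL hΩ) h1 h2 hβ

-- The identity is a deformation with both coefficients equal to 1, so this is the transport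
-- equivalence for T = id.
set_option maxHeartbeats 1000000 in
theorem isStateSolution_iff (hΩ : IsLipschitzDomain Ω) {s : Set (E d)} (hs : MeasurableSet s)
    (hsΩ : s ⊆ Ω) {α : ℝ} {f : E d → ℝ} (hf : MemLp f 2 (volume.restrict Ω))
    (gn gd : Lp ℝ 2 (surfaceMeasure Ω)) (x : H1 Ω × H1 Ω) :
    IsStateSolution Ω s α f gn gd x ↔
      stateSystemOp hΩ hs (1 / α) (BoundedContinuousFunction.const (E d) 1)
        (BoundedContinuousFunction.const (E d) 1) x = stateSystemRhs hΩ (hf.toLp f) gn gd := by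
  obtain ⟨u, p⟩ := x
  have hJ : ∀ y, BoundedContinuousFunction.const (E d) (1 : ℝ) y = |(fderiv ℝ id y).det| :=
    fun y => by simp [ContinuousLinearMap.det]
  have hA : ∀ y, BoundedContinuousFunction.const (E d) (1 : E d →L[ℝ] E d) y =
      pullbackCoeff (fderiv ℝ id y) := fun y => by rw [fderiv_id]; exact pullbackCoeff_one.symm
  have h := isStateSolution_iff_of_isPullback (isDeformation_id Ω) (isPullback_id (hΩ := hΩ) u)
    (isPullback_id p) hJ hA hs hsΩ (α := α) hf gn gd
  have h1 : compOp Ω id (hf.toLp f) = hf.toLp f := Lp.ext (coeFn_compOp (isDeformation_id Ω) _)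
  have h2 : transportLoad (BoundedContinuousFunction.const (E d) 1) id (hf.toLp f) = hf.toLp f :=
    (mulL_one_real (compOp Ω id (hf.toLp f))).trans h1
  rwa [image_id, h2] at h

-- The region is an arbitrary measurable subset of Ω, so the result also serves for the deformed
-- regions, and the transported operators need not be inverted.
set_option maxHeartbeats 1000000 in
theorem exists_isStateSolution (hΩ : IsLipschitzDomain Ω) {s : Set (E d)} (hs : MeasurableSet s)
    (hsΩ : s ⊆ Ω) {α : ℝ} (hα : 0 < α) {f : E d → ℝ} (hf : MemLp f 2 (volume.restrict Ω))
    (gn gd : Lp ℝ 2 (surfaceMeasure Ω)) :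
    ∃ x, ∀ x', IsStateSolution Ω s α f gn gd x' ↔ x' = x := by
  have hu := isUnit_stateSystemOp hΩ hs hsΩ (one_div_pos.mpr hα).le
  have hb := (ContinuousLinearMap.isUnit_iff_bijective).mp hu
  obtain ⟨x, hx⟩ := hb.2 (stateSystemRhs hΩ (hf.toLp f) gn gd)
  refine ⟨x, fun x' => (isStateSolution_iff hΩ hs hsΩ hf gn gd x').trans ?_⟩
  rw [← hx]
  exact hb.1.eq_iff

/-- Since J (f ∘ T) paired with g ∘ T equals f paired with g, the difference quotient can be moved
from f, which is only in L², to g, which will be in H¹. -/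
theorem inner_slope_load (hΩ : IsOpen Ω) {T : E d → E d} (hT : IsDeformation Ω T) {J : E d →ᵇ ℝ}
    (hJ : ∀ x, J x = |(fderiv ℝ T x).det|) (f g : Lp ℝ 2 (volume.restrict Ω)) (t : ℝ) :
    inner ℝ (t⁻¹ • (transportLoad J T f - f)) g =
      - inner ℝ (transportLoad J T f) (t⁻¹ • (compOp Ω T g - g)) := by
  have h : inner ℝ (transportLoad J T f) (compOp Ω T g) = inner ℝ f g :=
    hT.inner_compOp hΩ hJ f g
  rw [real_inner_smul_left, real_inner_smul_right, inner_sub_left, inner_sub_right,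
    h]
  ring

theorem tendsto_transportLoad (hΩ : IsOpen Ω) {V : ℝ → E d →ᵇ E d}
    {V₀ : E d →ᵇ E d} (hV : Tendsto V (𝓝[>] 0) (𝓝 V₀))
    (hT : ∀ᶠ t in 𝓝[>] (0 : ℝ), IsDeformation Ω fun x => x + t • V t x) {J : ℝ → E d →ᵇ ℝ}
    (hJ : Tendsto J (𝓝[>] 0) (𝓝 (BoundedContinuousFunction.const (E d) 1)))
    (f : Lp ℝ 2 (volume.restrict Ω)) :
    Tendsto (fun t => transportLoad (J t) (fun x => x + t • V t x) f) (𝓝[>] 0) (𝓝 f) := by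
  have h1 := ((mulL (volume.restrict Ω) (ContinuousLinearMap.mul ℝ ℝ)).continuous.tendsto _).comp hJ
  have h2 := tendsto_compOp hΩ.measurableSet hV hT f
  have h3 := ((isBoundedBilinearMap_apply (𝕜 := ℝ) (E := Lp ℝ 2 (volume.restrict Ω))
    (F := Lp ℝ 2 (volume.restrict Ω))).continuous.tendsto _).comp (h1.prodMk_nhds h2)
  refine h3.mono_right (le_of_eq (congrArg 𝓝 ?_))
  exact mulL_one_real f

-- After the quotient has moved to v, the transported load is bounded by ‖f‖ + 1 and the quotient of
-- v by its H¹ norm. This is the dual bound on the load quotients.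
set_option maxHeartbeats 1000000 in
theorem exists_inner_slope_load_le (hΩ : IsLipschitzDomain Ω) {V : ℝ → E d →ᵇ E d}
    {V₀ : E d →ᵇ E d} (hV : Tendsto V (𝓝[>] 0) (𝓝 V₀))
    (hT : ∀ᶠ t in 𝓝[>] (0 : ℝ), ∀ s ∈ Icc (0 : ℝ) 1, IsDeformation Ω fun x => x + s • t • V t x)
    {J : ℝ → E d →ᵇ ℝ} (hJ : Tendsto J (𝓝[>] 0) (𝓝 (BoundedContinuousFunction.const (E d) 1)))
    (hJ1 : ∀ᶠ t in 𝓝[>] (0 : ℝ), ∀ x, J t x = |(fderiv ℝ (fun x => x + t • V t x) x).det|)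
    (f : Lp ℝ 2 (volume.restrict Ω)) :
    ∃ C : ℝ, 0 ≤ C ∧ ∀ᶠ t in 𝓝[>] (0 : ℝ), ∀ v : H1 Ω,
      inner ℝ (t⁻¹ • (transportLoad (J t) (fun x => x + t • V t x) f - f)) (fnL Ω v) ≤
        C * ‖v‖ := by
  have hT1 : ∀ᶠ t in 𝓝[>] (0 : ℝ), IsDeformation Ω fun x => x + t • V t x := by
    filter_upwards [hT] with t ht
    simpa using ht 1 (by simp)
  have hgb : ∀ᶠ t in 𝓝[>] (0 : ℝ), ‖transportLoad (J t) (fun x => x + t • V t x) f‖ ≤ ‖f‖ + 1 :=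
    ((tendsto_transportLoad hΩ.isOpen hV hT1 hJ f).norm.eventually
      (gt_mem_nhds (lt_add_one ‖f‖))).mono fun t ht => ht.le
  have hV1 : ∀ᶠ t in 𝓝[>] (0 : ℝ), ‖V t‖ ≤ ‖V₀‖ + 1 :=
    (hV.norm.eventually (gt_mem_nhds (lt_add_one ‖V₀‖))).mono fun t ht => ht.le
  refine ⟨(‖f‖ + 1) * ((‖V₀‖ + 1) * Real.sqrt (2 ^ d)), by positivity, ?_⟩
  filter_upwards [hT, hT1, hJ1, hgb, hV1, self_mem_nhdsWithin] with t h1 h2 h3 h4 h5 (ht : 0 < t) v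
  rw [inner_slope_load hΩ.isOpen h2 h3, ← inner_neg_left]
  refine (real_inner_le_norm _ _).trans ?_
  rw [norm_neg, mul_assoc]
  refine mul_le_mul h4 ?_ (norm_nonneg _) (by positivity)
  rw [norm_smul, norm_inv, Real.norm_of_nonneg ht.le, inv_mul_le_iff₀ ht]
  have h6 := norm_comp_sub_le hΩ (h := fun x => t • V t x) (by fun_prop) h1
    (M := ⟨t * (‖V₀‖ + 1), by positivity⟩) (fun x => by
      rw [norm_smul, Real.norm_of_nonneg ht.le]
      exact mul_le_mul_of_nonneg_left (((V t).norm_coe_le_norm x).trans h5) ht.le) v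
  refine h6.trans_eq ?_
  change t * (‖V₀‖ + 1) * Real.sqrt (2 ^ d) * ‖v‖ = _
  ring

/-- Both factors in `inner_slope_load` converge strongly in L². The limit is the weak form of div (f
V₀), which need not be a function. -/
theorem tendsto_inner_slope_load (hΩ : IsLipschitzDomain Ω) {V : ℝ → E d →ᵇ E d}
    {V₀ : E d →ᵇ E d} (hV : Tendsto V (𝓝[>] 0) (𝓝 V₀))
    (hT : ∀ᶠ t in 𝓝[>] (0 : ℝ), ∀ s ∈ Icc (0 : ℝ) 1, IsDeformation Ω fun x => x + s • t • V t x)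
    {J : ℝ → E d →ᵇ ℝ} (hJ : Tendsto J (𝓝[>] 0) (𝓝 (BoundedContinuousFunction.const (E d) 1)))
    (hJ1 : ∀ᶠ t in 𝓝[>] (0 : ℝ), ∀ x, J t x = |(fderiv ℝ (fun x => x + t • V t x) x).det|)
    (f : Lp ℝ 2 (volume.restrict Ω)) (v : H1 Ω) :
    Tendsto (fun t : ℝ =>
      inner ℝ (t⁻¹ • (transportLoad (J t) (fun x => x + t • V t x) f - f)) (fnL Ω v)) (𝓝[>] 0)
      (𝓝 (-inner ℝ f (mulL (volume.restrict Ω) (innerSL ℝ) V₀ (gradL Ω v)))) := by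
  have hT1 : ∀ᶠ t in 𝓝[>] (0 : ℝ), IsDeformation Ω fun x => x + t • V t x := by
    filter_upwards [hT] with t ht
    simpa using ht 1 (by simp)
  refine ((tendsto_transportLoad hΩ.isOpen hV hT1 hJ f).inner
    (tendsto_slope_compOp hΩ hV hT v)).neg.congr' ?_
  filter_upwards [hT1, hJ1] with t h2 h3
  exact (inner_slope_load hΩ.isOpen h2 h3 f (fnL Ω v) t).symm

/-- DT_t = 1 + t D_t with D_t uniformly convergent, so both coefficients are superpositions with
functions differentiable at the identity. -/
theorem exists_transport_coefficients {V : ℝ → E d →ᵇ E d} {D : ℝ → E d →ᵇ (E d →L[ℝ] E d)}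
    {D₀ : E d →ᵇ (E d →L[ℝ] E d)} (hD : Tendsto D (𝓝[>] 0) (𝓝 D₀))
    (hVD : ∀ t x, HasFDerivAt (V t) (D t x) x) :
    ∃ (J : ℝ → E d →ᵇ ℝ) (J' : E d →ᵇ ℝ) (A : ℝ → E d →ᵇ (E d →L[ℝ] E d))
      (A' : E d →ᵇ (E d →L[ℝ] E d)),
      (∀ᶠ t in 𝓝[>] (0 : ℝ), ∀ x, J t x = |(fderiv ℝ (fun x => x + t • V t x) x).det|) ∧
      Tendsto (fun t => t⁻¹ • (J t - BoundedContinuousFunction.const (E d) 1)) (𝓝[>] 0) (𝓝 J') ∧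
      (∀ᶠ t in 𝓝[>] (0 : ℝ), ∀ x,
        A t x = pullbackCoeff (fderiv ℝ (fun x => x + t • V t x) x)) ∧
      Tendsto (fun t => t⁻¹ • (A t - BoundedContinuousFunction.const (E d) 1)) (𝓝[>] 0) (𝓝 A') := by
  have hfd : ∀ (t : ℝ) (x : E d), fderiv ℝ (fun x => x + t • V t x) x = 1 + t • D t x := fun t x =>
    ((hasFDerivAt_id x).add ((hVD t x).const_smul t)).fderiv
  obtain ⟨J, J', hJ, hJ'⟩ := exists_tendsto_superposition (α := E d) differentiableAt_abs_det
    (Eventually.of_forall fun q => continuous_abs_det.continuousAt) hD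
  obtain ⟨A, A', hA, hA'⟩ := exists_tendsto_superposition (α := E d) differentiableAt_pullbackCoeff
    continuousAt_pullbackCoeff hD
  have hdet : |(1 : E d →L[ℝ] E d).det| = 1 := by simp [ContinuousLinearMap.det]
  rw [hdet] at hJ'
  rw [pullbackCoeff_one] at hA'
  simp only [hfd]
  exact ⟨J, J', A, A', hJ, hJ', hA, hA'⟩

set_option maxHeartbeats 1000000 in
/-- Weak differentiability of the transported states. -/
theorem exists_weak_deriv_transport (hΩ : IsLipschitzDomain Ω) {V : ℝ → E d →ᵇ E d}
    {V₀ : E d →ᵇ E d} (hV : Tendsto V (𝓝[>] 0) (𝓝 V₀))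
    (hT : ∀ᶠ t in 𝓝[>] (0 : ℝ), ∀ s ∈ Icc (0 : ℝ) 1, IsDeformation Ω fun x => x + s • t • V t x)
    {J : ℝ → E d →ᵇ ℝ} {J' : E d →ᵇ ℝ} {A : ℝ → E d →ᵇ (E d →L[ℝ] E d)}
    {A' : E d →ᵇ (E d →L[ℝ] E d)}
    (hJ : ∀ᶠ t in 𝓝[>] (0 : ℝ), ∀ x, J t x = |(fderiv ℝ (fun x => x + t • V t x) x).det|)
    (hJ' : Tendsto (fun t => t⁻¹ • (J t - BoundedContinuousFunction.const (E d) 1)) (𝓝[>] 0)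
      (𝓝 J'))
    (hA' : Tendsto (fun t => t⁻¹ • (A t - BoundedContinuousFunction.const (E d) 1)) (𝓝[>] 0)
      (𝓝 A'))
    {s : Set (E d)} (hs : MeasurableSet s) (hsΩ : s ⊆ Ω) {β : ℝ} (hβ : 0 ≤ β)
    (f : Lp ℝ 2 (volume.restrict Ω)) (gn gd : Lp ℝ 2 (surfaceMeasure Ω))
    {x : ℝ → H1 Ω × H1 Ω} {x₀ : H1 Ω × H1 Ω}
    (hx : ∀ᶠ t in 𝓝[>] (0 : ℝ), stateSystemOp hΩ hs β (J t) (A t) (x t) =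
      stateSystemRhs hΩ (transportLoad (J t) (fun x => x + t • V t x) f) gn gd)
    (hx₀ : stateSystemOp hΩ hs β (BoundedContinuousFunction.const (E d) 1)
      (BoundedContinuousFunction.const (E d) 1) x₀ = stateSystemRhs hΩ f gn gd) :
    ∃ x' : H1 Ω × H1 Ω, ∀ ℓ : StrongDual ℝ (H1 Ω × H1 Ω),
      Tendsto (fun t : ℝ => ℓ (t⁻¹ • (x t - x₀))) (𝓝[>] 0) (𝓝 (ℓ x')) := by
  have hload := exists_inner_slope_load_le hΩ hV hT (tendsto_smul_slope hJ') hJ f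
  have hweak := tendsto_inner_slope_load hΩ hV hT (tendsto_smul_slope hJ') hJ f
  exact exists_weak_deriv_stateOp (P := fnL Ω) (Q := gradL Ω) (γ := traceL hΩ)
    (K₁ := mulL (volume.restrict Ω) (ContinuousLinearMap.mul ℝ ℝ))
    (K₂ := mulL (volume.restrict Ω) (ContinuousLinearMap.id ℝ (E d →L[ℝ] E d)))
    (K₃ := indicatorMulL Ω hs) (isUnit_stateSystemOp hΩ hs hsΩ hβ) hJ' hA'
    (g := fun t => transportLoad (J t) (fun x => x + t • V t x) f) (g₀ := f)
    (R := mulL (volume.restrict Ω) (innerSL ℝ) V₀ ∘L gradL Ω) hload.choose_spec.1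
    hload.choose_spec.2 hweak hx hx₀

end WeakDerivative

/-! ### From the LF topology to uniform convergence. -/

section VectorFields

open scoped BoundedContinuousFunction

/-- A continuous curve of compactly supported `C²` fields converges uniformly with its first
derivatives. -/
theorem exists_tendsto_field {k : ℕ} (hk : 2 ≤ k) {Ω : TopologicalSpace.Opens (E d)} {ε : ℝ}
    (hε : 0 < ε) {V : ℝ → 𝓓^{k}(Ω, E d)} (hV : ContinuousOn V (Icc 0 ε)) :
    ∃ (v : ℝ → E d →ᵇ E d) (v₀ : E d →ᵇ E d) (D : ℝ → E d →ᵇ (E d →L[ℝ] E d))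
      (D₀ : E d →ᵇ (E d →L[ℝ] E d)), (∀ t, ⇑(v t) = V t) ∧ Tendsto v (𝓝[>] 0) (𝓝 v₀) ∧
      Tendsto D (𝓝[>] 0) (𝓝 D₀) ∧ ∀ t x, HasFDerivAt (v t) (D t x) x := by
  have h0 : Tendsto V (𝓝[>] 0) (𝓝 (V 0)) :=
    (hV 0 ⟨le_rfl, hε.le⟩).mono_left (nhdsWithin_le_of_mem (Icc_mem_nhdsGT hε))
  -- A field and its derivative are continuous linear images of the test field in sup-norm spaces,
  -- so the LF topology enters only through these two maps.
  let B : 𝓓^{k}(Ω, E d) →L[ℝ] E d →ᵇ E d := TestFunction.toBoundedContinuousFunctionCLM ℝ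
  let D : 𝓓^{k}(Ω, E d) →L[ℝ] E d →ᵇ (E d →L[ℝ] E d) :=
    TestFunction.toBoundedContinuousFunctionCLM ℝ ∘L TestFunction.fderivCLM ℝ k 1
  refine ⟨fun t => B (V t), B (V 0), fun t => D (V t), D (V 0), fun t => rfl,
    (B.continuous.tendsto _).comp h0, (D.continuous.tendsto _).comp h0, fun t x => ?_⟩
  have h1 : D (V t) x = fderiv ℝ (V t) x :=
    congrFun (TestFunction.fderivCLM_apply_of_le (𝕜 := ℝ) (V t) (by exact_mod_cast hk)) x
  rw [h1]
  refine DifferentiableAt.hasFDerivAt ((V t).contDiff.differentiable ?_ x)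
  simp
  omega

end VectorFields

/-! ### Perturbed domains and material derivatives. -/

section Perturbation

open scoped BoundedContinuousFunction

/-- D t stays bounded as t → 0⁺, so the derivative of t V(t) is at most 1 / 2 for small t, and a
factor s in [0, 1] only decreases it. -/
theorem eventually_isDeformation {k : ℕ} (hk : 2 ≤ k) {Ω : TopologicalSpace.Opens (E d)}
    {V : ℝ → 𝓓^{k}(Ω, E d)} {v : ℝ → E d →ᵇ E d} {D : ℝ → E d →ᵇ (E d →L[ℝ] E d)}
    {D₀ : E d →ᵇ (E d →L[ℝ] E d)} (hv : ∀ t, ⇑(v t) = V t) (hD : Tendsto D (𝓝[>] 0) (𝓝 D₀))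
    (hvD : ∀ t x, HasFDerivAt (v t) (D t x) x) :
    ∀ᶠ t in 𝓝[>] (0 : ℝ), ∀ s ∈ Icc (0 : ℝ) 1,
      IsDeformation (Ω : Set (E d)) fun x => x + s • t • v t x := by
  have hD1 : ∀ᶠ t in 𝓝[>] (0 : ℝ), ‖D t‖ ≤ ‖D₀‖ + 1 :=
    ((continuous_norm.tendsto D₀).comp hD).eventually_le_const (lt_add_one ‖D₀‖)
  have hpos : 0 < 1 / 2 / (‖D₀‖ + 1) := by positivity
  filter_upwards [hD1, Ioo_mem_nhdsGT hpos] with t h1 h2 s hs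
  have h0 : (fun x => s • t • v t x) = fun x => (s * t) • V t x := by
    funext x
    rw [smul_smul, hv]
  have hc : ContDiff ℝ 1 (V t) := (V t).contDiff.of_le (by exact_mod_cast one_le_two.trans hk)
  refine IsDeformation.of_small (h := fun x => s • t • v t x) ?_ ?_ ?_ fun x => ?_
  · rw [h0]
    exact hc.const_smul (s * t)
  · rw [h0]
    exact (V t).hasCompactSupport.smul_left (f := fun _ => s * t)
  · rw [h0]
    exact (tsupport_smul_subset_right (fun _ => s * t) (V t)).trans (V t).tsupport_subset
  · have hfd : HasFDerivAt (fun x => s • t • v t x) (s • t • D t x) x :=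
      ((hvD t x).const_smul t).const_smul s
    rw [hfd.fderiv, norm_smul, norm_smul,
      Real.norm_of_nonneg hs.1, Real.norm_of_nonneg h2.1.le]
    have h3 := ((D t).norm_coe_le_norm x).trans h1
    have h4 := (lt_div_iff₀ (show 0 < ‖D₀‖ + 1 by positivity)).mp h2.2
    have h5 : t * ‖D t x‖ ≤ 1 / 2 := (mul_le_mul_of_nonneg_left h3 h2.1.le).trans h4.le
    exact (mul_le_of_le_one_left (mul_nonneg h2.1.le (norm_nonneg _)) hs.2).trans h5

variable {Ω : Set (E d)}

theorem isWeakMaterialDerivative_of_tendsto {T : ℝ → E d → E d} {u : H1 Ω}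
    {ut : ∀ t : ℝ, H1 (T t '' Ω)} {du : H1 Ω} (U : ℝ → H1 Ω)
    (hU : ∀ᶠ t in 𝓝[>] (0 : ℝ), fn (U t) =ᵐ[volume.restrict Ω] fun x => fn (ut t) (T t x))
    (h : ∀ ℓ : StrongDual ℝ (H1 Ω),
      Tendsto (fun t : ℝ => ℓ (t⁻¹ • (U t - u))) (𝓝[>] 0) (𝓝 (ℓ du))) :
    IsWeakMaterialDerivative T u ut du :=
  ⟨U, hU, tendsto_toWeakSpace h⟩

variable [IsFiniteMeasure (volume.restrict Ω)]

set_option maxHeartbeats 1000000 in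
/-- The unique solution of the state system on a deformed domain and its pullback. -/
theorem exists_isStateSolution_image (hΩ : IsLipschitzDomain Ω) {T : E d → E d}
    (hT : IsDeformation Ω T) {Ω' : Set (E d)} (hΩ' : Ω' = Ω) {s : Set (E d)}
    (hs : MeasurableSet s) (hsΩ : s ⊆ Ω) {α : ℝ} (hα : 0 < α) {f : E d → ℝ}
    (hf : MemLp f 2 (volume.restrict Ω)) (gn gd : Lp ℝ 2 (surfaceMeasure Ω)) :
    ∃ (y : H1 Ω' × H1 Ω') (U : H1 Ω × H1 Ω),
      (∀ y', IsStateSolution Ω' (T '' s) α f gn gd y' ↔ y' = y) ∧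
      (fn U.1 =ᵐ[volume.restrict Ω] fun x => fn y.1 (T x)) ∧
      (fn U.2 =ᵐ[volume.restrict Ω] fun x => fn y.2 (T x)) ∧
      ∀ (J : E d →ᵇ ℝ) (A : E d →ᵇ (E d →L[ℝ] E d)), (∀ x, J x = |(fderiv ℝ T x).det|) →
        (∀ x, A x = pullbackCoeff (fderiv ℝ T x)) →
        stateSystemOp hΩ hs (1 / α) J A U =
          stateSystemRhs hΩ (transportLoad J T (hf.toLp f)) gn gd := by
  -- H¹ of the image and H¹(Ω) are different types. Stating the result for a set equal to Ω lets the
  -- equality be eliminated.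
  subst hΩ'
  have hsub : T '' s ⊆ Ω' := (image_mono hsΩ).trans hT.image_eq.subset
  obtain ⟨⟨u, p⟩, hy⟩ := exists_isStateSolution hΩ (hT.measurableSet_image hs) hsub hα hf gn gd
  obtain ⟨U, hU1, hU2, hU3⟩ := hT.exists_pullback hΩ u
  obtain ⟨P, hP1, hP2, hP3⟩ := hT.exists_pullback hΩ p
  refine ⟨(u, p), (U, P), hy, hU1, hP1, fun J A hJ hA => ?_⟩
  exact (isStateSolution_iff_of_isPullback hT ⟨hU1, hU2, hU3⟩ ⟨hP1, hP2, hP3⟩ hJ hA hs hsΩ hf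
    gn gd).mp ((hy _).mpr rfl)

set_option maxHeartbeats 1000000 in
/-- The states on the perturbed domains and their weak material derivatives. -/
theorem exists_weakMaterialDerivative (hΩ : IsLipschitzDomain Ω) {V : ℝ → E d →ᵇ E d}
    {V₀ : E d →ᵇ E d} (hV : Tendsto V (𝓝[>] 0) (𝓝 V₀)) {D : ℝ → E d →ᵇ (E d →L[ℝ] E d)}
    {D₀ : E d →ᵇ (E d →L[ℝ] E d)} (hD : Tendsto D (𝓝[>] 0) (𝓝 D₀))
    (hVD : ∀ t x, HasFDerivAt (V t) (D t x) x)
    (hT : ∀ᶠ t in 𝓝[>] (0 : ℝ), ∀ s ∈ Icc (0 : ℝ) 1, IsDeformation Ω fun x => x + s • t • V t x)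
    {T : ℝ → E d → E d} (hTV : ∀ t, (fun x => x + t • V t x) = T t)
    (hT1 : ∀ᶠ t in 𝓝[>] (0 : ℝ), IsDeformation Ω (T t))
    {s : Set (E d)} (hs : MeasurableSet s) (hsΩ : s ⊆ Ω) {α : ℝ} (hα : 0 < α) {f : E d → ℝ}
    (hf : MemLp f 2 (volume.restrict Ω)) (gn gd : Lp ℝ 2 (surfaceMeasure Ω)) {x : H1 Ω × H1 Ω}
    (hx : IsStateSolution Ω s α f gn gd x) :
    ∃ y : ∀ t : ℝ, H1 (T t '' Ω) × H1 (T t '' Ω),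
      (∀ t, IsDeformation Ω (T t) → ∀ y',
        IsStateSolution (T t '' Ω) (T t '' s) α f gn gd y' ↔ y' = y t) ∧
      ∃ du dp : H1 Ω, IsWeakMaterialDerivative T x.1 (fun t => (y t).1) du ∧
        IsWeakMaterialDerivative T x.2 (fun t => (y t).2) dp := by
  -- The state and its pullback are chosen together so that they refer to the same solution; for t
  -- where T t is not a deformation the value is 0.
  have hy : ∀ t, ∃ q : (H1 (T t '' Ω) × H1 (T t '' Ω)) × (H1 Ω × H1 Ω), IsDeformation Ω (T t) →
      (∀ y', IsStateSolution (T t '' Ω) (T t '' s) α f gn gd y' ↔ y' = q.1) ∧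
      (fn q.2.1 =ᵐ[volume.restrict Ω] fun x => fn q.1.1 (T t x)) ∧
      (fn q.2.2 =ᵐ[volume.restrict Ω] fun x => fn q.1.2 (T t x)) ∧
      ∀ (J : E d →ᵇ ℝ) (A : E d →ᵇ (E d →L[ℝ] E d)), (∀ x, J x = |(fderiv ℝ (T t) x).det|) →
        (∀ x, A x = pullbackCoeff (fderiv ℝ (T t) x)) →
        stateSystemOp hΩ hs (1 / α) J A q.2 =
          stateSystemRhs hΩ (transportLoad J (T t) (hf.toLp f)) gn gd := by
    intro t
    by_cases h : IsDeformation Ω (T t)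
    · have h1 := exists_isStateSolution_image hΩ h h.image_eq hs hsΩ hα hf gn gd
      exact ⟨(h1.choose, h1.choose_spec.choose), fun _ => h1.choose_spec.choose_spec⟩
    · exact ⟨0, fun h' => absurd h' h⟩
  choose q hq using hy
  have hcoef := exists_transport_coefficients hD hVD
  simp only [hTV] at hcoef
  have hder : ∃ x' : H1 Ω × H1 Ω, ∀ ℓ : StrongDual ℝ (H1 Ω × H1 Ω),
      Tendsto (fun t : ℝ => ℓ (t⁻¹ • ((q t).2 - x))) (𝓝[>] 0) (𝓝 (ℓ x')) := by
    obtain ⟨J, J', A, A', hJ, hJ', hA, hA'⟩ := hcoef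
    refine exists_weak_deriv_transport hΩ hV hT (J := J) (A := A) ?_ hJ' hA' hs hsΩ
      (one_div_pos.mpr hα).le (hf.toLp f) gn gd ?_ ((isStateSolution_iff hΩ hs hsΩ hf gn gd x).mp hx)
    · simpa only [hTV] using hJ
    · filter_upwards [hT1, hJ, hA] with t h1 h2 h3
      exact ((hq t h1).2.2.2 (J t) (A t) h2 h3).trans (congrArg
        (fun S => stateSystemRhs hΩ (transportLoad (J t) S (hf.toLp f)) gn gd) (hTV t).symm)
  refine ⟨fun t => (q t).1, fun t ht => (hq t ht).1, hder.choose.1, hder.choose.2, ?_, ?_⟩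
  · refine isWeakMaterialDerivative_of_tendsto (fun t => (q t).2.1) ?_ fun ℓ => ?_
    · filter_upwards [hT1] with t ht
      exact (hq t ht).2.1
    · exact hder.choose_spec (ℓ ∘L ContinuousLinearMap.fst ℝ (H1 Ω) (H1 Ω))
  · refine isWeakMaterialDerivative_of_tendsto (fun t => (q t).2.2) ?_ fun ℓ => ?_
    · filter_upwards [hT1] with t ht
      exact (hq t ht).2.2.1
    · exact hder.choose_spec (ℓ ∘L ContinuousLinearMap.snd ℝ (H1 Ω) (H1 Ω))

end Perturbation

end ShapeSensitivity

end

/-! ### The main theorem. -/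

theorem theorem4p1 {d k : ℕ} (hd : 2 ≤ d) (hk : 2 ≤ k)
    (Ω : TopologicalSpace.Opens (EuclideanSpace ℝ (Fin d)))
    (hΩ_bdd : Bornology.IsBounded (Ω : Set (EuclideanSpace ℝ (Fin d))))
    (hΩ_lip : HasLipschitzBoundary (Ω : Set (EuclideanSpace ℝ (Fin d))))
    (ω : Set (EuclideanSpace ℝ (Fin d))) (hω_sub : ω ⊆ Ω) (hω_meas : MeasurableSet ω)
    (hω_class : IsOfClassC k ω)
    (α : ℝ) (hα : 0 < α)
    (f : EuclideanSpace ℝ (Fin d) → ℝ)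
    (hf : MemLp f 2 (volume.restrict (Ω : Set (EuclideanSpace ℝ (Fin d)))))
    (un ud : H1 (Ω : Set (EuclideanSpace ℝ (Fin d))))
    (ε : ℝ) (hε : 0 < ε)
    (V : ℝ → 𝓓^{k}(Ω, EuclideanSpace ℝ (Fin d))) (hV : ContinuousOn V (Icc 0 ε)) :
    ∃ x : H1 (Ω : Set (EuclideanSpace ℝ (Fin d))) × H1 (Ω : Set (EuclideanSpace ℝ (Fin d))),
      (∀ x', IsStateSolution Ω ω α f (trace un) (trace ud) x' ↔ x' = x) ∧
      ∃ y : ∀ t : ℝ, H1 (perturb V t '' Ω) × H1 (perturb V t '' Ω),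
        (∃ τ : ℝ, 0 < τ ∧ τ ≤ ε ∧ ∀ t ∈ Ioo 0 τ,
          BijOn (perturb V t) Ω Ω ∧
          ∀ y', IsStateSolution (perturb V t '' Ω) (perturb V t '' ω) α f
            (trace un) (trace ud) y' ↔ y' = y t) ∧
        ∃ du dp : H1 (Ω : Set (EuclideanSpace ℝ (Fin d))),
          IsWeakMaterialDerivative (perturb V) x.1 (fun t => (y t).1) du ∧
          IsWeakMaterialDerivative (perturb V) x.2 (fun t => (y t).2) dp := by
  have hΩ : IsLipschitzDomain (Ω : Set (EuclideanSpace ℝ (Fin d))) := ⟨Ω.isOpen, hΩ_bdd, hΩ_lip⟩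
  have hfin : IsFiniteMeasure (volume.restrict (Ω : Set (EuclideanSpace ℝ (Fin d)))) :=
    ⟨by rw [Measure.restrict_apply_univ]; exact hΩ_bdd.measure_lt_top⟩
  have hfield := exists_tendsto_field hk hε hV
  have hstate := exists_isStateSolution hΩ hω_meas hω_sub hα hf (trace un) (trace ud)
  refine ⟨hstate.choose, hstate.choose_spec, ?_⟩
  obtain ⟨v, v₀, D, D₀, hv, hv₀, hD, hvD⟩ := hfield
  have hT := eventually_isDeformation hk hv hD hvD
  have hvT : ∀ t, (fun x => x + t • v t x) = perturb V t := fun t => by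
    funext x
    rw [hv]
    rfl
  have hT1 : ∀ᶠ t in 𝓝[>] (0 : ℝ),
      IsDeformation (Ω : Set (EuclideanSpace ℝ (Fin d))) (perturb V t) := by
    filter_upwards [hT] with t ht
    rw [← hvT]
    simpa using ht 1 (by simp)
  have hτ := mem_nhdsGT_iff_exists_Ioo_subset.mp hT1
  have key := exists_weakMaterialDerivative hΩ hv₀ hD hvD hT hvT hT1 hω_meas hω_sub hα hf
    (trace un) (trace ud) ((hstate.choose_spec _).mpr rfl)
  refine ⟨key.choose, ?_, key.choose_spec.2⟩
  obtain ⟨τ, hτ0, hτ⟩ := hτ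
  -- The interval on which `perturb V t` is known to be a deformation may reach beyond ε, hence the
  -- minimum.
  refine ⟨min τ ε, lt_min hτ0 hε, min_le_right _ _, fun t ht => ?_⟩
  have hdef : IsDeformation (Ω : Set (EuclideanSpace ℝ (Fin d))) (perturb V t) :=
    hτ ⟨ht.1, ht.2.trans_le (min_le_left _ _)⟩
  exact ⟨hdef.bijOn, key.choose_spec.1 t hdef⟩
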